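/- **Setting.** For $\mu\in\mathbb R$ let $M_\mu$ be the Verma module of $\mathfrak{sl}_2(\mathbb C)$ (standard basis $E,F,H$) with highest weight $\mu$ and highest weight vector $v_0$. Its Shapovalov form is the unique Hermitian form with $(v_0,v_0)=1$, $E^*=F$, $H^*=H$. Let $n\ge 2$ and let $\lambda_1\ge\dots\ge\lambda_n$ be reals such that none of $\lambda_1,\dots,\lambda_n$ and $\lambda:=\sum_i\lambda_i$ is a nonnegative integer. Let $p$ be the number of positive $\lambda_i$, so $\lambda_1,\dots,\lambda_p>0>\lambda_{p+1},\dots,\lambda_n$. Equip $M=M_{\lambda_1}\otimes\cdots\otimes M_{\lambda_n}$ with the product of the Shapovalov forms. For $m\ge 0$ the level $m$ multiplicity space is $E_m=\operatorname{Hom}_{\mathfrak{sl}_2}(M_{\lambda-2m},M)$, with the induced Hermitian form $\langle\varphi,\psi\rangle=(\varphi(v_0),\psi(v_0))$; equivalently $(\varphi(x),\psi(y))=(x,y)\langle\varphi,\psi\rangle$ for all $x,y\in M_{\lambda-2m}$. Call $E_m$ positive (negative) definite if $\langle\varphi,\varphi\rangle>0$ ($<0$) for all $0\ne\varphi\in E_m$,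 and definite if it is one or the other. The explicit type of $M$ is $\langle\lfloor\lambda\rfloor,\lfloor\lambda_1\rfloor,\dots,\lfloor\lambda_n\rfloor\rangle$. **The function $g$.** Let $\operatorname{sign}(x)=x/|x|$ for $x\neq 0$. For reals $x_1\ge x_2$ such that none of $x_1,x_2,x_1+x_2$ is a nonnegative integer, and an integer $k\ge0$, define $g(x_1,x_2,k)$ as follows. * If $0>x_1\ge x_2$: $g=(-1)^k$. * If $x_1>0>x_2$ and $x_1+x_2<0$: $g=\operatorname{sign}\binom{x_1}{k}$. * If $x_1>0>x_2$ and $s:=x_1+x_2>0$: $g=(-1)^k$ for $0\le k\le\lfloor\frac s2\rfloor$; $g=(-1)^{\lceil s/2\rceil}$ for $\lceil\frac s2\rceil\le k\le\lfloor\frac{s+1}2\rfloor$; $g=(-1)^{\lceil s/2\rceil+\lceil (s+1)/2\rceil+k}$ for $\lceil\frac{s+1}2\rceil\le k\le\lceil s\rceil$; $g=1$ for $\lceil s\rceil+1\le k\le\lceil x_1\rceil$; $g=(-1)^{\lceil x_1\rceil+k}$ for $k\ge\lceil x_1\rceil+1$. * If $x_1\ge x_2>0$, put $h(k)=g(x_1,x_2-2\lceil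 x_2\rceil,k-\lceil x_2\rceil)$: $g=1$ for $0\le k\le\lfloor x_2\rfloor$; $g=h(k)$ for $\lceil x_2\rceil\le k\le\max(\lceil x_2\rceil,\lfloor x_1\rfloor)$; $g=h(k)+2\lfloor x_1\rfloor+2\lfloor x_2\rfloor-2\lfloor x_1+x_2\rfloor$ for $\max(\lceil x_2\rceil,\lfloor x_1\rfloor)+1\le k\le\lceil x_1\rceil+\lceil x_2\rceil$; $g=(-1)^{k-\lceil x_1\rceil-\lceil x_2\rceil}$ for $k\ge\lceil x_1\rceil+\lceil x_2\rceil+1$. **Theorem.** For every $m\ge0$, $\dim E_m=\binom{m+n-2}{n-2}$. For each $m$, whether $E_m$ is positive definite, and whether it is negative definite, depends only on the explicit type of $M$. The definite multiplicity spaces are exactly the following. 1. $p=0$: every $E_m$ is definite; it is positive definite for $m$ even and negative definite for $m$ odd. 2. $n=2$: every $E_m$ is definite; it is positive definite iff $g(\lambda_1,\lambda_2,m)>0$ and negative definite iff $g(\lambda_1,\lambda_2,m)<0$. 3. $p=1$, $n\ge3$: there are $\max\{1,\lceil\frac{\lambda+2}2\rceil\}$ definite spaces, at the levels $0\le m\le\max\{0,\lceil\frac\lambda2\rceil\}$.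 In this range $E_m$ is positive definite for $m$ even and negative definite for $m$ odd. 4. $2\le p\le n-2$, $n\ge4$: only $E_0$ is definite, and it is positive definite. 5. $p=n-1$, $n\ge3$: * If $\lambda<0$, there are $\lceil\lambda_p+1\rceil$ definite spaces: levels $0$ through $\lceil\lambda_p\rceil$, all positive definite. * If $\lambda>0$ and $\lceil\lambda+1\rceil\le\lceil\lambda_p\rceil$, there are $\lceil\lambda_p\rceil-\lfloor\lambda\rfloor$ definite spaces: level $0$ and levels $\lceil\lambda+1\rceil$ through $\lceil\lambda_p\rceil$, all positive definite. * If $\lambda>0$ and $\lceil\lambda+1\rceil>\lceil\lambda_p\rceil$, then $E_0$ is positive definite and no other $E_m$ is definite, except that for explicit type $\langle1,0,0,-1\rangle$ the level $2$ space is also definite, namely negative definite. 6. $p=n$, $n\ge3$: levels $0$ through $\lceil\lambda_p\rceil$ are positive definite. No other space is definite, except: * $\langle3d,d,d,d\rangle$, $d\ge0$: levels $2d+1$ and $2d+2$ are positive definite. * $\langle3d+2,d,d,d\rangle$, $d\ge0$: levels $2d+2$ and $2d+3$ are negative definite. * $\langle3d-1,d,d,d-1\rangle$, $d\ge1$: level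 $2d+1$ is positive definite. * $\langle3d+1,d,d,d-1\rangle$, $d\ge1$: level $2d+2$ is negative definite. * $\langle3d-2,d,d-1,d-1\rangle$, $d\ge1$: level $2d$ is positive definite. * $\langle3d,d,d-1,d-1\rangle$, $d\ge1$: level $2d+1$ is negative definite. * $\langle3,0,0,0,0\rangle$: level $3$ is negative definite. * $\langle4,1,1,1,1\rangle$: level $4$ is positive definite. * $\langle0,0,\dots,0\rangle$ with $p\ge4$: level $2$ is positive definite. * $\langle1,1,0,\dots,0\rangle$ with $p\ge4$: level $2$ is positive definite. -/

import Mathlib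

open scoped TensorProduct ComplexConjugate

noncomputable section

namespace SL2

/-! ### Representations of `sl₂` and contravariant forms -/

/-- A representation of `sl₂(ℂ)` on a complex vector space `V`: the operators by which the standard
basis `E, F, H` acts, subject to the defining relations `[H,E] = 2E`, `[H,F] = -2F`, `[E,F] = H`. -/
structure Rep (V : Type*) [AddCommGroup V] [Module ℂ V] where
  E : Module.End ℂ V
  F : Module.End ℂ V
  H : Module.End ℂ V
  lie_H_E : H * E - E * H = (2 : ℂ) • E
  lie_H_F : H * F - F * H = (-2 : ℂ) • F
  lie_E_F : E * F - F * E = H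

/-- The space `Hom(M, N)` of homomorphisms of representations, as a space of linear maps. -/
def Rep.hom {V W : Type*} [AddCommGroup V] [Module ℂ V] [AddCommGroup W] [Module ℂ W]
    (M : Rep V) (N : Rep W) : Submodule ℂ (V →ₗ[ℂ] W) where
  carrier := {φ | (∀ x, φ (M.E x) = N.E (φ x)) ∧ (∀ x, φ (M.F x) = N.F (φ x)) ∧
    (∀ x, φ (M.H x) = N.H (φ x))}
  add_mem' := by
    rintro a b ⟨h1, h2, h3⟩ ⟨k1, k2, k3⟩
    exact ⟨fun x => by simp [h1, k1], fun x => by simp [h2, k2], fun x => by simp [h3, k3]⟩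
  zero_mem' := ⟨fun x => by simp, fun x => by simp, fun x => by simp⟩
  smul_mem' := by
    rintro c a ⟨h1, h2, h3⟩
    exact ⟨fun x => by simp [h1], fun x => by simp [h2], fun x => by simp [h3]⟩

/-- Sesquilinear forms on `V`, antilinear in the first variable. -/
abbrev Form (V : Type*) [AddCommGroup V] [Module ℂ V] := V →ₗ⋆[ℂ] V →ₗ[ℂ] ℂ

/-- The form is Hermitian. -/
def Form.IsHermitian {V : Type*} [AddCommGroup V] [Module ℂ V] (B : Form V) : Prop :=
  ∀ x y, conj (B x y) = B y x

/-- The form is contravariant: `E* = F`, `F* = E` and `H* = H`. -/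
def Form.IsContravariant {V : Type*} [AddCommGroup V] [Module ℂ V] (B : Form V) (M : Rep V) :
    Prop :=
  (∀ x y, B (M.E x) y = B x (M.F y)) ∧ (∀ x y, B (M.F x) y = B x (M.E y)) ∧
    (∀ x y, B (M.H x) y = B x (M.H y))

/-- The sesquilinear form for which the basis `b` is orthogonal with `(b k, b k) = w k`. -/
def diagForm {ι V : Type*} [AddCommGroup V] [Module ℂ V] (b : Module.Basis ι ℂ V) (w : ι → ℝ) :
    Form V :=
  LinearMap.mk₂'ₛₗ (starRingEnd ℂ) (RingHom.id ℂ)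
    (fun x y => (b.repr y).sum fun k c => (w k : ℂ) * (conj (b.repr x k) * c))
    (fun x₁ x₂ y => by
      rw [← Finsupp.sum_add]
      exact Finsupp.sum_congr fun k _ => by simp; ring)
    (fun c x y => by
      rw [Finsupp.smul_sum]
      exact Finsupp.sum_congr fun k _ => by simp; ring)
    (fun x y₁ y₂ => by
      rw [map_add]
      exact Finsupp.sum_add_index' (fun k => by simp) (fun k c d => by ring))
    (fun c x y => by
      rw [map_smul, Finsupp.sum_smul_index' (fun k => by simp), RingHom.id_apply,
        Finsupp.smul_sum]
      exact Finsupp.sum_congr fun k _ => by simp only [smul_eq_mul]; ring)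

theorem diagForm_basis {ι V : Type*} [DecidableEq ι] [AddCommGroup V] [Module ℂ V]
    (b : Module.Basis ι ℂ V) (w : ι → ℝ) (k l : ι) :
    diagForm b w (b k) (b l) = if k = l then (w k : ℂ) else 0 := by
  simp only [diagForm, LinearMap.mk₂'ₛₗ_apply, Module.Basis.repr_self]
  rw [Finsupp.sum_single_index (by simp)]
  by_cases h : k = l
  · subst h; simp
  · simp [h]

/-- Two sesquilinear forms that agree on a basis are equal. -/
theorem form_ext {ι V : Type*} [AddCommGroup V] [Module ℂ V] (b : Module.Basis ι ℂ V)
    {B C : Form V} (h : ∀ k l, B (b k) (b l) = C (b k) (b l)) : B = C :=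
  b.ext fun k => b.ext fun l => h k l

theorem diagForm_isHermitian {ι V : Type*} [AddCommGroup V] [Module ℂ V] (b : Module.Basis ι ℂ V)
    (w : ι → ℝ) : (diagForm b w).IsHermitian := by
  classical
  intro x y
  have hx : ∀ (x y : V), diagForm b w x y =
      ∑ k ∈ (b.repr x).support ∪ (b.repr y).support,
        (w k : ℂ) * (conj (b.repr x k) * b.repr y k) := by
    intro x y
    simp only [diagForm, LinearMap.mk₂'ₛₗ_apply]
    exact Finsupp.sum_of_support_subset _ Finset.subset_union_right _ (by simp)
  rw [hx, hx, map_sum, Finset.union_comm]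
  refine Finset.sum_congr rfl fun k _ => ?_
  simp only [map_mul, Complex.conj_ofReal, Complex.conj_conj]
  ring

/-! ### Verma modules and the Shapovalov form -/

/-- The basis `v_k = F^k v_0` of the Verma module. -/
abbrev vermaBasis : Module.Basis ℕ ℂ (ℕ →₀ ℂ) := Finsupp.basisSingleOne

/-- The Verma module `M_μ` of highest weight `μ`, with its basis `v_k = F^k v_0`:
`F v_k = v_{k+1}`, `H v_k = (μ - 2k) v_k`, `E v_k = k (μ - k + 1) v_{k-1}`. -/
def verma (μ : ℝ) : Rep (ℕ →₀ ℂ) where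
  E := vermaBasis.constr ℂ fun k => ((k : ℂ) * (μ - k + 1)) • vermaBasis (k - 1)
  F := vermaBasis.constr ℂ fun k => vermaBasis (k + 1)
  H := vermaBasis.constr ℂ fun k => ((μ : ℂ) - 2 * k) • vermaBasis k
  lie_H_E := by
    refine vermaBasis.ext fun k => ?_
    rcases k with _ | k
    · simp only [LinearMap.sub_apply, Module.End.mul_apply, LinearMap.smul_apply,
        Module.Basis.constr_basis, map_smul]
      simp
    · simp only [LinearMap.sub_apply, Module.End.mul_apply, LinearMap.smul_apply,
        Module.Basis.constr_basis, map_smul, smul_smul, ← sub_smul, Nat.add_sub_cancel]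
      congr 1; push_cast; ring
  lie_H_F := by
    refine vermaBasis.ext fun k => ?_
    simp only [LinearMap.sub_apply, Module.End.mul_apply, LinearMap.smul_apply,
        Module.Basis.constr_basis, map_smul, ← sub_smul]
    congr 1; push_cast; ring
  lie_E_F := by
    refine vermaBasis.ext fun k => ?_
    rcases k with _ | k
    · simp only [LinearMap.sub_apply, Module.End.mul_apply,
        Module.Basis.constr_basis, map_smul]
      simp
    · simp only [LinearMap.sub_apply, Module.End.mul_apply,
        Module.Basis.constr_basis, map_smul, Nat.add_sub_cancel, ← sub_smul]
      congr 1; push_cast; ring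

theorem verma_E (μ : ℝ) (k : ℕ) :
    (verma μ).E (vermaBasis k) = ((k : ℂ) * (μ - k + 1)) • vermaBasis (k - 1) :=
  Module.Basis.constr_basis ..

theorem verma_F (μ : ℝ) (k : ℕ) : (verma μ).F (vermaBasis k) = vermaBasis (k + 1) :=
  Module.Basis.constr_basis ..

theorem verma_H (μ : ℝ) (k : ℕ) :
    (verma μ).H (vermaBasis k) = ((μ : ℂ) - 2 * k) • vermaBasis k :=
  Module.Basis.constr_basis ..

/-- The number `(v_k, v_k) = ∏_{j < k} (j + 1) (μ - j)`. -/
def shapNorm (μ : ℝ) (k : ℕ) : ℝ := ∏ j ∈ Finset.range k, ((j : ℝ) + 1) * (μ - j)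

/-- The Shapovalov form of `M_μ`, normalized by `(v_0, v_0) = 1`. The next results say that it is
the only contravariant form with this normalization, and that it is Hermitian. -/
def shapovalov (μ : ℝ) : Form (ℕ →₀ ℂ) := diagForm vermaBasis (shapNorm μ)

theorem shapovalov_basis (μ : ℝ) (k l : ℕ) :
    shapovalov μ (vermaBasis k) (vermaBasis l) = if k = l then (shapNorm μ k : ℂ) else 0 :=
  diagForm_basis ..

theorem shapovalov_zero (μ : ℝ) : shapovalov μ (vermaBasis 0) (vermaBasis 0) = 1 := by
  rw [shapovalov_basis]; simp [shapNorm]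

theorem shapovalov_isHermitian (μ : ℝ) : (shapovalov μ).IsHermitian :=
  diagForm_isHermitian _ _

/-- Equality of two sesquilinear expressions can be checked on bases. -/
theorem ext_basis₂ {ι κ V W : Type*} [AddCommGroup V] [Module ℂ V] [AddCommGroup W] [Module ℂ W]
    (b : Module.Basis ι ℂ V) (c : Module.Basis κ ℂ W) {B C : V →ₗ⋆[ℂ] W →ₗ[ℂ] ℂ}
    (h : ∀ k l, B (b k) (c l) = C (b k) (c l)) (x : V) (y : W) : B x y = C x y := by
  have : B = C := b.ext fun k => c.ext fun l => h k l
  rw [this]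

theorem shapovalov_isContravariant (μ : ℝ) : (shapovalov μ).IsContravariant (verma μ) := by
  have hF : ∀ x y, shapovalov μ ((verma μ).F x) y = shapovalov μ x ((verma μ).E y) := by
    refine ext_basis₂ (B := (shapovalov μ).comp (verma μ).F)
      (C := (shapovalov μ).compl₂ (verma μ).E) vermaBasis vermaBasis fun k l => ?_
    simp only [LinearMap.comp_apply, LinearMap.compl₂_apply, verma_F, verma_E, map_smul,
      shapovalov_basis]
    rcases l with _ | l
    · simp
    · by_cases h : k = l
      · subst h
        simp [shapNorm, Finset.prod_range_succ]
        ring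
      · simp [h]
  refine ⟨fun x y => ?_, hF, ?_⟩
  · rw [← shapovalov_isHermitian, ← hF, shapovalov_isHermitian]
  · refine ext_basis₂ (B := (shapovalov μ).comp (verma μ).H)
      (C := (shapovalov μ).compl₂ (verma μ).H) vermaBasis vermaBasis fun k l => ?_
    simp only [LinearMap.comp_apply, LinearMap.compl₂_apply, verma_H, map_smul,
      shapovalov_basis, map_smulₛₗ, LinearMap.smul_apply]
    by_cases h : k = l
    · subst h
      have : conj ((μ : ℂ) - 2 * (k : ℂ)) = (μ : ℂ) - 2 * (k : ℂ) := by
        simp [Complex.conj_ofReal, Complex.conj_ofNat]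
      rw [this]
    · simp [h]

theorem shapovalov_unique (μ : ℝ) (B : Form (ℕ →₀ ℂ)) (hB : B.IsContravariant (verma μ))
    (h0 : B (vermaBasis 0) (vermaBasis 0) = 1) : B = shapovalov μ := by
  have hS := shapovalov_isContravariant μ
  refine form_ext vermaBasis fun k => ?_
  induction k with
  | zero =>
    intro l
    rcases l with _ | l
    · rw [h0, shapovalov_zero]
    · rw [← verma_F μ, ← hB.1, ← hS.1, verma_E]; simp
  | succ k ih =>
    intro l
    rw [← verma_F μ, hB.2.1, hS.2.1, verma_E, map_smul, map_smul, ih]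

/-! ### Tensor products -/

section Tensor

variable {n : ℕ} {V : Fin n → Type*} [∀ i, AddCommGroup (V i)] [∀ i, Module ℂ (V i)]

/-- The operator `1 ⊗ ⋯ ⊗ x ⊗ ⋯ ⊗ 1` with `x` in the `i`-th factor. -/
def atFactor (i : Fin n) (x : Module.End ℂ (V i)) : Module.End ℂ (⨂[ℂ] i, V i) :=
  PiTensorProduct.map (Function.update (fun _ => LinearMap.id) i x)

theorem atFactor_tprod (i : Fin n) (x : Module.End ℂ (V i)) (v : ∀ i, V i) :
    atFactor i x (⨂ₜ[ℂ] j, v j) = ⨂ₜ[ℂ] j, Function.update v i (x (v i)) j := by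
  rw [atFactor, PiTensorProduct.map_tprod]
  congr 1
  funext j
  by_cases h : j = i
  · subst h; simp
  · simp [h]

theorem atFactor_mul (i : Fin n) (x y : Module.End ℂ (V i)) :
    atFactor i x * atFactor i y = atFactor i (x * y) := by
  ext v
  simp [atFactor_tprod]

theorem atFactor_comm {i j : Fin n} (h : i ≠ j) (x : Module.End ℂ (V i))
    (y : Module.End ℂ (V j)) : atFactor i x * atFactor j y = atFactor j y * atFactor i x := by
  ext v
  simp [atFactor_tprod, h, h.symm, Function.update_comm h]

theorem atFactor_sub (i : Fin n) (x y : Module.End ℂ (V i)) :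
    atFactor i (x - y) = atFactor i x - atFactor i y := by
  ext v
  simp [atFactor_tprod, MultilinearMap.map_update_sub]

theorem atFactor_smul (i : Fin n) (c : ℂ) (x : Module.End ℂ (V i)) :
    atFactor i (c • x) = c • atFactor i x := by
  ext v
  simp [atFactor_tprod, MultilinearMap.map_update_smul]

theorem sum_atFactor_commutator (x y : ∀ i, Module.End ℂ (V i)) :
    (∑ i, atFactor i (x i)) * (∑ i, atFactor i (y i)) -
      (∑ i, atFactor i (y i)) * (∑ i, atFactor i (x i)) =
      ∑ i, atFactor i (x i * y i - y i * x i) := by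
  rw [Finset.sum_mul_sum, Finset.sum_mul_sum, Finset.sum_comm (γ := Fin n),
    ← Finset.sum_sub_distrib]
  refine Finset.sum_congr rfl fun i _ => ?_
  rw [← Finset.sum_sub_distrib, Finset.sum_eq_single i]
  · rw [atFactor_mul, atFactor_mul, atFactor_sub]
  · intro j _ hj
    rw [atFactor_comm hj, sub_self]
  · simp

/-- The tensor product of representations: `E`, `F`, `H` act by `∑ i, 1 ⊗ ⋯ ⊗ X ⊗ ⋯ ⊗ 1`. -/
def tensorRep (M : ∀ i, Rep (V i)) : Rep (⨂[ℂ] i, V i) where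
  E := ∑ i, atFactor i (M i).E
  F := ∑ i, atFactor i (M i).F
  H := ∑ i, atFactor i (M i).H
  lie_H_E := by
    rw [sum_atFactor_commutator, Finset.smul_sum]
    exact Finset.sum_congr rfl fun i _ => by rw [(M i).lie_H_E, atFactor_smul]
  lie_H_F := by
    rw [sum_atFactor_commutator, Finset.smul_sum]
    exact Finset.sum_congr rfl fun i _ => by rw [(M i).lie_H_F, atFactor_smul]
  lie_E_F := by
    rw [sum_atFactor_commutator]
    exact Finset.sum_congr rfl fun i _ => by rw [(M i).lie_E_F]

end Tensor

variable {n : ℕ}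

/-- The tensor product `M_{λ_1} ⊗ ⋯ ⊗ M_{λ_n}` of Verma modules. -/
def vermaTensor (lam : Fin n → ℝ) : Rep (⨂[ℂ] _ : Fin n, (ℕ →₀ ℂ)) :=
  tensorRep fun i => verma (lam i)

/-- The product of the Shapovalov forms on `M_{λ_1} ⊗ ⋯ ⊗ M_{λ_n}`, written in the product basis;
`tensorForm_tprod` is its characteristic property. -/
def tensorForm (lam : Fin n → ℝ) : Form (⨂[ℂ] _ : Fin n, (ℕ →₀ ℂ)) :=
  diagForm (Basis.piTensorProduct fun _ : Fin n => vermaBasis)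
    (fun k => ∏ i, shapNorm (lam i) (k i))

theorem tensorForm_isHermitian (lam : Fin n → ℝ) : (tensorForm lam).IsHermitian :=
  diagForm_isHermitian _ _

theorem tensorForm_tprod (lam : Fin n → ℝ) (v w : Fin n → (ℕ →₀ ℂ)) :
    tensorForm lam (⨂ₜ[ℂ] i, v i) (⨂ₜ[ℂ] i, w i) = ∏ i, shapovalov (lam i) (v i) (w i) := by
  classical
  simp only [tensorForm, shapovalov, diagForm, LinearMap.mk₂'ₛₗ_apply,
    Basis.piTensorProduct_repr_tprod_apply]
  rw [Finsupp.sum_of_support_subset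
    (s := Fintype.piFinset fun i => (vermaBasis.repr (w i)).support) _ _ _ (by simp)]
  · simp only [Finsupp.sum, Finset.prod_univ_sum]
    refine Finset.sum_congr rfl fun k _ => ?_
    rw [Basis.piTensorProduct_repr_tprod_apply, map_prod, Complex.ofReal_prod,
      ← Finset.prod_mul_distrib, ← Finset.prod_mul_distrib]
  · intro k hk
    rw [Finsupp.mem_support_iff, Basis.piTensorProduct_repr_tprod_apply,
      Finset.prod_ne_zero_iff] at hk
    exact Fintype.mem_piFinset.2 fun i => Finsupp.mem_support_iff.2 (hk i (Finset.mem_univ i))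

theorem tensorForm_adjoint (lam : Fin n → ℝ) (a b : Fin n → Module.End ℂ (ℕ →₀ ℂ))
    (h : ∀ i x y, shapovalov (lam i) (a i x) y = shapovalov (lam i) x (b i y))
    (x y : ⨂[ℂ] _ : Fin n, (ℕ →₀ ℂ)) :
    tensorForm lam ((∑ i, atFactor i (a i)) x) y =
      tensorForm lam x ((∑ i, atFactor i (b i)) y) := by
  refine ext_basis₂ (B := (tensorForm lam).comp (∑ i, atFactor i (a i)))
    (C := (tensorForm lam).compl₂ (∑ i, atFactor i (b i)))
    (Basis.piTensorProduct fun _ : Fin n => vermaBasis)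
    (Basis.piTensorProduct fun _ : Fin n => vermaBasis) (fun k l => ?_) x y
  simp only [LinearMap.comp_apply, LinearMap.compl₂_apply, Basis.piTensorProduct_apply,
    LinearMap.sum_apply, map_sum, atFactor_tprod, tensorForm_tprod]
  refine Finset.sum_congr rfl fun i _ => Finset.prod_congr rfl fun j _ => ?_
  by_cases hj : j = i
  · subst hj; simp only [Function.update_self, h]
  · simp only [Function.update_of_ne hj]

theorem tensorForm_isContravariant (lam : Fin n → ℝ) :
    (tensorForm lam).IsContravariant (vermaTensor lam) :=
  ⟨tensorForm_adjoint lam _ _ fun i => (shapovalov_isContravariant (lam i)).1,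
    tensorForm_adjoint lam _ _ fun i => (shapovalov_isContravariant (lam i)).2.1,
    tensorForm_adjoint lam _ _ fun i => (shapovalov_isContravariant (lam i)).2.2⟩

/-! ### Multiplicity spaces -/

/-- The level `m` multiplicity space `E_m = Hom(M_{λ - 2m}, M_{λ_1} ⊗ ⋯ ⊗ M_{λ_n})`,
where `λ = λ_1 + ⋯ + λ_n`. -/
def multSpace (lam : Fin n → ℝ) (m : ℕ) :
    Submodule ℂ ((ℕ →₀ ℂ) →ₗ[ℂ] ⨂[ℂ] _ : Fin n, (ℕ →₀ ℂ)) :=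
  Rep.hom (verma ((∑ i, lam i) - 2 * m)) (vermaTensor lam)

/-- The induced form on `E_m`, `⟨φ, ψ⟩ = (φ v_0, ψ v_0)`. By `tensorForm_apply_apply` it is the form
whose product with the Shapovalov form of `M_{λ - 2m}` is the form on the isotypic piece
`M_{λ - 2m} ⊗ E_m`. -/
def multForm (lam : Fin n → ℝ) (m : ℕ) (φ ψ : multSpace lam m) : ℂ :=
  tensorForm lam (φ.1 (vermaBasis 0)) (ψ.1 (vermaBasis 0))

theorem tensorForm_apply_apply (lam : Fin n → ℝ) (m : ℕ) (φ ψ : multSpace lam m)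
    (x y : ℕ →₀ ℂ) :
    tensorForm lam (φ.1 x) (ψ.1 y) =
      shapovalov ((∑ i, lam i) - 2 * m) x y * multForm lam m φ ψ := by
  have hT := tensorForm_isContravariant lam
  have hS := shapovalov_isContravariant ((∑ i, lam i) - 2 * m)
  obtain ⟨hφE, hφF, -⟩ := φ.2
  obtain ⟨hψE, hψF, -⟩ := ψ.2
  have key : ∀ k l : ℕ, tensorForm lam (φ.1 (vermaBasis k)) (ψ.1 (vermaBasis l)) =
      shapovalov ((∑ i, lam i) - 2 * m) (vermaBasis k) (vermaBasis l) * multForm lam m φ ψ := by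
    intro k
    induction k with
    | zero =>
      intro l
      rcases l with _ | l
      · rw [shapovalov_zero, one_mul, multForm]
      · rw [← verma_F ((∑ i, lam i) - 2 * m) l, hψF, ← hT.1, ← hφE, ← hS.1, verma_E]
        simp
    | succ k ih =>
      intro l
      rw [← verma_F ((∑ i, lam i) - 2 * m) k, hφF, hT.2.1, ← hψE, hS.2.1, verma_E, map_smul,
        map_smul, map_smul, ih]
      simp only [smul_eq_mul]
      ring
  have := ext_basis₂ (B := ((tensorForm lam).comp φ.1).compl₂ ψ.1)
    (C := multForm lam m φ ψ • shapovalov ((∑ i, lam i) - 2 * m)) vermaBasis vermaBasis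
    (fun k l => by
      simp only [LinearMap.comp_apply, LinearMap.compl₂_apply, LinearMap.smul_apply, key,
        smul_eq_mul]
      ring) x y
  simp only [LinearMap.comp_apply, LinearMap.compl₂_apply, LinearMap.smul_apply,
    smul_eq_mul] at this
  rw [this, mul_comm]

/-- `E_m` is positive definite (`⟨φ, φ⟩` is real as the form is Hermitian). -/
def PosDefAt (lam : Fin n → ℝ) (m : ℕ) : Prop :=
  ∀ φ : multSpace lam m, φ ≠ 0 → 0 < (multForm lam m φ φ).re

/-- `E_m` is negative definite. -/
def NegDefAt (lam : Fin n → ℝ) (m : ℕ) : Prop :=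
  ∀ φ : multSpace lam m, φ ≠ 0 → (multForm lam m φ φ).re < 0

/-- `E_m` is definite. -/
def DefiniteAt (lam : Fin n → ℝ) (m : ℕ) : Prop := PosDefAt lam m ∨ NegDefAt lam m

/-! ### Data of the classification -/

/-- `(λ_1, …, λ_n)` is generic: no `λ_i`, and not the sum, is a nonnegative integer. -/
def IsGeneric (lam : Fin n → ℝ) : Prop :=
  (∀ (i : Fin n) (k : ℕ), lam i ≠ k) ∧ ∀ k : ℕ, ∑ i, lam i ≠ k

/-- The explicit type `⟨⌊λ⌋, ⌊λ_1⌋, …, ⌊λ_n⌋⟩`. -/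
def explicitType (lam : Fin n → ℝ) : List ℤ :=
  ⌊∑ i, lam i⌋ :: List.ofFn fun i => ⌊lam i⌋

/-- The function `g` for `x₂ ≤ x₁` and `x₂ < 0`; here `negOnePow j = (-1) ^ j` for an integer `j`, and
`Ring.choose x k = x (x - 1) ⋯ (x - k + 1) / k!`. -/
def gNeg (x₁ x₂ : ℝ) (k : ℕ) : ℤ :=
  if x₁ < 0 then (-1) ^ k
  else if x₁ + x₂ < 0 then SignType.sign (Ring.choose x₁ k)
  else if (k : ℤ) ≤ ⌊(x₁ + x₂) / 2⌋ then (-1) ^ k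
  else if (k : ℤ) ≤ ⌊(x₁ + x₂ + 1) / 2⌋ then (⌈(x₁ + x₂) / 2⌉.negOnePow : ℤ)
  else if (k : ℤ) ≤ ⌈x₁ + x₂⌉ then
    ((⌈(x₁ + x₂) / 2⌉ + ⌈(x₁ + x₂ + 1) / 2⌉ + k).negOnePow : ℤ)
  else if (k : ℤ) ≤ ⌈x₁⌉ then 1
  else ((⌈x₁⌉ + k).negOnePow : ℤ)

/-- The function `g`, on pairs `x₂ ≤ x₁` of reals that are not nonnegative integers and whose sum
is not one either. -/
def g (x₁ x₂ : ℝ) (k : ℕ) : ℤ :=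
  if x₂ < 0 then gNeg x₁ x₂ k
  else if (k : ℤ) ≤ ⌊x₂⌋ then 1
  else if (k : ℤ) ≤ max ⌈x₂⌉ ⌊x₁⌋ then gNeg x₁ (x₂ - 2 * ⌈x₂⌉) (k - ⌈x₂⌉₊)
  else if (k : ℤ) ≤ ⌈x₁⌉ + ⌈x₂⌉ then
    gNeg x₁ (x₂ - 2 * ⌈x₂⌉) (k - ⌈x₂⌉₊) + 2 * ⌊x₁⌋ + 2 * ⌊x₂⌋ - 2 * ⌊x₁ + x₂⌋
  else ((k - ⌈x₁⌉ - ⌈x₂⌉).negOnePow : ℤ)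

/-- The exceptional positive definite levels `m` for the explicit type `t`, when all highest
weights are positive. -/
def ExceptionalPos (t : List ℤ) (m : ℕ) : Prop :=
  (∃ d : ℤ, 0 ≤ d ∧ t = [3 * d, d, d, d] ∧ ((m : ℤ) = 2 * d + 1 ∨ (m : ℤ) = 2 * d + 2)) ∨
  (∃ d : ℤ, 1 ≤ d ∧ t = [3 * d - 1, d, d, d - 1] ∧ (m : ℤ) = 2 * d + 1) ∨
  (∃ d : ℤ, 1 ≤ d ∧ t = [3 * d - 2, d, d - 1, d - 1] ∧ (m : ℤ) = 2 * d) ∨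
  (t = [4, 1, 1, 1, 1] ∧ m = 4) ∨
  (∃ p : ℕ, 4 ≤ p ∧ t = 0 :: List.replicate p 0 ∧ m = 2) ∨
  (∃ p : ℕ, 4 ≤ p ∧ t = 1 :: 1 :: List.replicate (p - 1) 0 ∧ m = 2)

/-- The exceptional negative definite levels `m` for the explicit type `t`, when all highest
weights are positive. -/
def ExceptionalNeg (t : List ℤ) (m : ℕ) : Prop :=
  (∃ d : ℤ, 0 ≤ d ∧ t = [3 * d + 2, d, d, d] ∧ ((m : ℤ) = 2 * d + 2 ∨ (m : ℤ) = 2 * d + 3)) ∨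
  (∃ d : ℤ, 1 ≤ d ∧ t = [3 * d + 1, d, d, d - 1] ∧ (m : ℤ) = 2 * d + 2) ∨
  (∃ d : ℤ, 1 ≤ d ∧ t = [3 * d, d, d - 1, d - 1] ∧ (m : ℤ) = 2 * d + 1) ∨
  (t = [3, 0, 0, 0, 0] ∧ m = 3)

end SL2

end

/-! In the basis `u_k = v_k / (v_k, v_k)` of a Verma module, `E` sends `u_k` to `u_{k-1}` with
coefficient one. So on the tensor product neither `E` nor the degree depends on the highest weights,
and `E_m` becomes a fixed space: the finitely supported functions on multi-indices that have degree
`m` and are killed by `lower`. Only the diagonal form on it, with coefficients `1 / prodNorm`,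
varies. Everything is defined over the reals, so the real form suffices (`multForm_pos_iff`). A
singular vector is determined by its slice along the highest weight vector of the first factor, and
this slice is arbitrary, which gives the dimension (`finrank_singularCoord`).

Deformation. When the total weight is not a nonnegative integer, `E F` is injective in each degree.
Hence each degree is the orthogonal sum of its singular vectors and the image of `F`, and the form
is nondegenerate on singular vectors (`IsSl2.singular_nondeg`). A continuous family of nondegenerate
forms cannot lose definiteness (`posDef_of_path`). So definiteness depends only on the ceilings of
the weights and of their sum, negative numbers having ceiling `0` (`def_of_hasCeil`).

Fusion. `M_a ⊗ M_b` is the orthogonal sum of the `M_{a+b-2k}`. The norm of the highest weight vector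
`∑ (-1)^i u_i ⊗ u_{k-i}` is given by Vandermonde's identity (`fuseNorm_mul`), and its sign is `(-1)
^ fuseExp`. So definiteness for `a, b, l` amounts to definiteness, with prescribed signs, for all `a
+ b - 2k, l` (`defL_fuse`). For two factors the space is a line and its sign is that of `g`. For
three factors there is an orthogonal basis indexed by `K` with sign exponents `pathExp`, and
definiteness says that one parity is constant in `K` (`defT_triple_iff`).

Classification. The summand `k = 0` shows that definiteness survives merging two factors
(`DefT.merge`). The order of the factors is irrelevant, and the ceiling of a partial sum may be
given any value compatible with the type. So a definite space with many factors yields several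
three-factor parity conditions. Comparing neighbouring `K` at both ends of the range
(`parity_last_two`, `parity_first_two`) bounds `m` and leaves few exceptions. Conversely, definite
levels come from the signs of product basis vectors (`def_neg`, `def_of_le_ceil`), from induction on
fusion (`defT_one_pos`, `defT_one_neg`), and, for exceptional types, from a parity check with three
factors and fusion down to smaller cases with more (`ExcTriple.defT`, `ExcLong.defT`). -/

noncomputable section

namespace SL2

/-! ### Tensoring a representation with a Verma module, in coordinates -/

section Abstract

variable {X : Type*} [AddCommGroup X] [Module ℝ X]

/-- `x` is not a nonnegative integer. -/
def NotNat (x : ℝ) : Prop := ∀ k : ℕ, x ≠ k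

theorem NotNat.sub_nat {x : ℝ} (h : NotNat x) (k : ℕ) : NotNat (x - k) := fun l hl =>
  h (l + k) (by push_cast; linarith)

theorem NotNat.sub_two_mul {x : ℝ} (h : NotNat x) (k : ℕ) : NotNat (x - 2 * k) := by
  have := h.sub_nat (2 * k)
  push_cast at this
  exact this

theorem NotNat.of_neg {x : ℝ} (h : x < 0) : NotNat x := fun k hk => by
  have : (0 : ℝ) ≤ k := k.cast_nonneg
  linarith

theorem shapNorm_succ (a : ℝ) (k : ℕ) :
    shapNorm a (k + 1) = shapNorm a k * (((k : ℝ) + 1) * (a - k)) :=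
  Finset.prod_range_succ _ _

theorem shapNorm_ne_zero {a : ℝ} (ha : NotNat a) (k : ℕ) : shapNorm a k ≠ 0 :=
  Finset.prod_ne_zero_iff.2 fun j _ => mul_ne_zero (by positivity) (sub_ne_zero.2 (ha j))

/-- The operator `E` on `M_a ⊗ X`, where `∑ u_k ⊗ y_k` is represented by `y` and
`u_k = v_k / (v_k, v_k)`. -/
def tensE (E : Module.End ℝ X) : Module.End ℝ (ℕ →₀ X) :=
  Finsupp.lcomapDomain Nat.succ Nat.succ_injective + Finsupp.mapRange.linearMap E

/-- The operator `F` on `M_a ⊗ X`. -/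
def tensF (a : ℝ) (F : Module.End ℝ X) : Module.End ℝ (ℕ →₀ X) :=
  Finsupp.lsum ℝ (fun k : ℕ => (((k : ℝ) + 1) * (a - k)) • Finsupp.lsingle (k + 1)) +
    Finsupp.mapRange.linearMap F

/-- The degree operator on `M_a ⊗ X`. -/
def tensD (D : Module.End ℝ X) : Module.End ℝ (ℕ →₀ X) :=
  Finsupp.lsum ℝ (fun k : ℕ => (k : ℝ) • Finsupp.lsingle k) + Finsupp.mapRange.linearMap D

/-- The product form on `M_a ⊗ X`. -/
def tensB (a : ℝ) (B : X →ₗ[ℝ] X →ₗ[ℝ] ℝ) : (ℕ →₀ X) →ₗ[ℝ] (ℕ →₀ X) →ₗ[ℝ] ℝ :=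
  Finsupp.lsum ℝ fun k : ℕ => (shapNorm a k)⁻¹ • B.compl₂ (Finsupp.lapply k)

theorem tensE_apply (E : Module.End ℝ X) (y : ℕ →₀ X) (k : ℕ) :
    tensE E y k = y (k + 1) + E (y k) := by
  simp [tensE, Finsupp.lcomapDomain]

theorem tensE_single_zero (E : Module.End ℝ X) (x : X) :
    tensE E (Finsupp.single 0 x) = Finsupp.single 0 (E x) := by
  ext k
  rw [tensE_apply]
  rcases k with _ | k <;> simp

theorem tensE_single_succ (E : Module.End ℝ X) (k : ℕ) (x : X) :
    tensE E (Finsupp.single (k + 1) x) = Finsupp.single k x + Finsupp.single (k + 1) (E x) := by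
  ext j
  rw [tensE_apply]
  by_cases h : j = k
  · subst h; simp
  · by_cases h' : j = k + 1
    · subst h'; simp
    · simp [Ne.symm h, Ne.symm h']

theorem tensF_single (a : ℝ) (F : Module.End ℝ X) (k : ℕ) (x : X) :
    tensF a F (Finsupp.single k x) =
      (((k : ℝ) + 1) * (a - k)) • Finsupp.single (k + 1) x + Finsupp.single k (F x) := by
  simp [tensF]

theorem tensD_single (D : Module.End ℝ X) (k : ℕ) (x : X) :
    tensD D (Finsupp.single k x) = (k : ℝ) • Finsupp.single k x + Finsupp.single k (D x) := by
  simp [tensD]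

theorem tensD_apply (D : Module.End ℝ X) (y : ℕ →₀ X) (k : ℕ) :
    tensD D y k = (k : ℝ) • y k + D (y k) := by
  induction y using Finsupp.induction_linear with
  | zero => simp
  | add f g hf hg => simp only [map_add, Finsupp.add_apply, hf, hg, smul_add]; abel
  | single j x =>
    rw [tensD_single]
    by_cases h : j = k
    · subst h; simp
    · simp [h]

theorem tensB_single (a : ℝ) (B : X →ₗ[ℝ] X →ₗ[ℝ] ℝ) (k : ℕ) (x : X) (y : ℕ →₀ X) :
    tensB a B (Finsupp.single k x) y = (shapNorm a k)⁻¹ * B x (y k) := by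
  simp [tensB]

/-- `sl₂`-structure with invariant form: `H = wt - 2D`, and the degree operator `D` has no negative
eigenvalues. -/
structure IsSl2 (E F D : Module.End ℝ X) (B : X →ₗ[ℝ] X →ₗ[ℝ] ℝ) (wt : ℝ) : Prop where
  comm : ∀ x, E (F x) = F (E x) + wt • x - (2 : ℝ) • D x
  degE : ∀ x, D (E x) = E (D x) - E x
  degF : ∀ x, D (F x) = F (D x) + F x
  adj : ∀ x y, B (E x) y = B x (F y)
  symm : ∀ x y, B x y = B y x
  nondeg : ∀ x, (∀ y, B x y = 0) → x = 0
  nonneg : ∀ (x : X) (c : ℝ), c < 0 → D x = c • x → x = 0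

theorem tensB_symm {B : X →ₗ[ℝ] X →ₗ[ℝ] ℝ} (hB : ∀ x y, B x y = B y x) (a : ℝ)
    (x y : ℕ →₀ X) : tensB a B x y = tensB a B y x := by
  induction x using Finsupp.induction_linear with
  | zero => simp
  | add f g hf hg => simp only [map_add, LinearMap.add_apply, hf, hg]
  | single j x =>
    induction y using Finsupp.induction_linear with
    | zero => simp
    | add f g hf hg => simp only [map_add, LinearMap.add_apply, hf, hg]
    | single k y =>
      rw [tensB_single, tensB_single]
      by_cases h : j = k
      · subst h; simp [hB x y]
      · simp [h, Ne.symm h]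

theorem tensB_nondeg {B : X →ₗ[ℝ] X →ₗ[ℝ] ℝ} (hs : ∀ x y, B x y = B y x)
    (hB : ∀ x, (∀ y, B x y = 0) → x = 0) {a : ℝ} (ha : NotNat a)
    (x : ℕ →₀ X) (hx : ∀ y, tensB a B x y = 0) : x = 0 := by
  ext k
  refine hB _ fun y => ?_
  have := hx (Finsupp.single k y)
  rw [tensB_symm hs, tensB_single, hs] at this
  exact (mul_eq_zero.1 this).resolve_left (inv_ne_zero (shapNorm_ne_zero ha k))

theorem tensD_nonneg {D : Module.End ℝ X}
    (hD : ∀ (x : X) (c : ℝ), c < 0 → D x = c • x → x = 0) (y : ℕ →₀ X) (c : ℝ) (hc : c < 0)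
    (h : tensD D y = c • y) : y = 0 := by
  ext k
  have h1 : D (y k) = (c - k) • y k := by
    have := DFunLike.congr_fun h k
    rw [tensD_apply, Finsupp.smul_apply] at this
    rw [sub_smul, ← this]
    abel
  have : (0 : ℝ) ≤ k := k.cast_nonneg
  exact hD _ _ (by linarith) h1

/-- The relations are checked on pure tensors. Genericity of `a` enters through the division by the
norms of the `v_k`. Iterating this from a trivial module reaches every product of Verma modules. -/
theorem IsSl2.tens {E F D : Module.End ℝ X} {B : X →ₗ[ℝ] X →ₗ[ℝ] ℝ} {wt : ℝ}
    (h : IsSl2 E F D B wt) {a : ℝ} (ha : NotNat a) :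
    IsSl2 (tensE E) (tensF a F) (tensD D) (tensB a B) (a + wt) where
  comm y := by
    induction y using Finsupp.induction_linear with
    | zero => simp
    | add f g hf hg => simp only [map_add, hf, hg, smul_add]; abel
    | single j x =>
      rcases j with _ | j
      · simp only [tensF_single, tensE_single_zero, tensD_single, map_add, map_smul,
          tensE_single_succ, h.comm, Finsupp.single_add, Finsupp.single_sub, ← Finsupp.smul_single]
        push_cast
        module
      · simp only [tensF_single, tensD_single, map_add, map_smul,
          tensE_single_succ, h.comm, Finsupp.single_add, Finsupp.single_sub, ← Finsupp.smul_single]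
        push_cast
        module
  degE y := by
    induction y using Finsupp.induction_linear with
    | zero => simp
    | add f g hf hg => simp only [map_add, hf, hg]; abel
    | single j x =>
      rcases j with _ | j
      · simp only [tensE_single_zero, tensD_single, map_add, map_smul, h.degE, Finsupp.single_sub]
        push_cast
        module
      · simp only [tensD_single, map_add, map_smul, tensE_single_succ, h.degE, Finsupp.single_sub]
        push_cast
        module
  degF y := by
    induction y using Finsupp.induction_linear with
    | zero => simp
    | add f g hf hg => simp only [map_add, hf, hg]; abel
    | single j x =>
      simp only [tensD_single, map_add, map_smul, tensF_single, h.degF, Finsupp.single_add]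
      push_cast
      module
  adj x y := by
    induction x using Finsupp.induction_linear with
    | zero => simp
    | add f g hf hg => simp only [map_add, LinearMap.add_apply, hf, hg]
    | single j x =>
      induction y using Finsupp.induction_linear with
      | zero => simp
      | add f g hf hg => simp only [map_add, hf, hg]
      | single k y =>
        rcases j with _ | j
        · simp only [tensE_single_zero, tensB_single, tensF_single, Finsupp.add_apply,
            Finsupp.smul_apply]
          by_cases hk : k = 0
          · subst hk; simp [h.adj]
          · simp [hk]
        · simp only [tensE_single_succ, map_add, LinearMap.add_apply, tensB_single, tensF_single,
            Finsupp.smul_apply]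
          by_cases hk : k = j
          · subst hk
            have h1 := shapNorm_ne_zero ha k
            have h2 : a - k ≠ 0 := sub_ne_zero.2 (ha k)
            have h3 : (k : ℝ) + 1 ≠ 0 := by positivity
            simp [shapNorm_succ]
            field_simp
          · by_cases hk' : k = j + 1
            · subst hk'; simp [h.adj]
            · simp [hk, hk']
  symm := tensB_symm h.symm a
  nondeg := tensB_nondeg h.symm h.nondeg ha
  nonneg := tensD_nonneg h.nonneg

/-! ### Consequences of the relations: nondegeneracy on singular vectors. -/

variable {E F D : Module.End ℝ X} {B : X →ₗ[ℝ] X →ₗ[ℝ] ℝ} {wt : ℝ}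

theorem IsSl2.D_E_pow (h : IsSl2 E F D B wt) {x : X} {c : ℝ} (hx : D x = c • x) (r : ℕ) :
    D ((E ^ r) x) = (c - r) • (E ^ r) x := by
  induction r with
  | zero => simp [hx]
  | succ r ih =>
    rw [pow_succ', Module.End.mul_apply, h.degE, ih, map_smul]
    push_cast
    module

theorem IsSl2.D_F_pow (h : IsSl2 E F D B wt) {x : X} {c : ℝ} (hx : D x = c • x) (r : ℕ) :
    D ((F ^ r) x) = (c + r) • (F ^ r) x := by
  induction r with
  | zero => simp [hx]
  | succ r ih =>
    rw [pow_succ', Module.End.mul_apply, h.degF, ih, map_smul]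
    push_cast
    module

theorem IsSl2.E_F_pow (h : IsSl2 E F D B wt) {x : X} {c : ℝ} (hx : D x = c • x) (hE : E x = 0)
    (r : ℕ) : E ((F ^ (r + 1)) x) = (((r : ℝ) + 1) * (wt - 2 * c - r)) • (F ^ r) x := by
  induction r with
  | zero => simp [h.comm, hx, hE]; module
  | succ r ih =>
    rw [pow_succ' F (r + 1), Module.End.mul_apply, h.comm, ih, map_smul, ← Module.End.mul_apply,
      ← pow_succ', h.D_F_pow hx]
    push_cast
    module

theorem IsSl2.E_pow_F (h : IsSl2 E F D B wt) {x : X} {c : ℝ} (hx : D x = c • x) (r : ℕ) :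
    (E ^ (r + 1)) (F x) =
      F ((E ^ (r + 1)) x) + (((r : ℝ) + 1) * (wt - 2 * c + r)) • (E ^ r) x := by
  induction r with
  | zero => simp [h.comm, hx]; module
  | succ r ih =>
    rw [pow_succ' E (r + 1), Module.End.mul_apply, ih, map_add, map_smul, h.comm,
      h.D_E_pow hx, ← Module.End.mul_apply E (E ^ (r + 1)), ← Module.End.mul_apply E (E ^ r),
      ← pow_succ' E r]
    push_cast
    module

/-- Since `E^(r+1) F x = 0` for all `r`, the commutation formula `IsSl2.E_pow_F` expresses a
multiple of `E^r x` through `F E^(r+1) x`. Negative degrees vanish, so `E^(j+1) x = 0`, and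
descending induction on the exponent reaches `x = 0`. -/
theorem IsSl2.eq_zero_of_E_F (h : IsSl2 E F D B wt) (hwt : NotNat wt) {x : X} {j : ℕ}
    (hx : D x = (j : ℝ) • x) (hEF : E (F x) = 0) : x = 0 := by
  have h0 : ∀ r, (E ^ (r + 1)) (F x) = 0 := fun r => by
    rw [pow_succ, Module.End.mul_apply, hEF, map_zero]
  have key : ∀ s, s ≤ j + 1 → (E ^ (j + 1 - s)) x = 0 := by
    intro s
    induction s with
    | zero =>
      intro _
      refine h.nonneg _ (-1) (by norm_num) ?_
      rw [h.D_E_pow hx]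
      push_cast
      congr 1
      ring
    | succ s ih =>
      intro hs
      obtain ⟨r, hr⟩ : ∃ r, j = r + s := ⟨j - s, by omega⟩
      have e1 : j + 1 - s = r + 1 := by omega
      have e2 : j + 1 - (s + 1) = r := by omega
      have h1 := h.E_pow_F hx r
      rw [h0, ← e1, ih (by omega), map_zero, zero_add] at h1
      rw [e2]
      refine (smul_eq_zero.1 h1.symm).resolve_left (mul_ne_zero (by positivity) fun h2 => ?_)
      -- With `j = r + s` the factor `wt - 2j + r` equals `wt - (r + 2s)`, which vanishes only for a
      -- natural number `wt`.
      refine hwt (r + 2 * s) ?_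
      rw [hr] at h2
      push_cast at h2 ⊢
      linarith
  simpa using key (j + 1) le_rfl

/-- On the finite-dimensional space of degree `m - 1` the injective map `E F` is also surjective. So
`E y = E F z` for some `z`, and `y` is the sum of the singular vector `y - F z` and of `F z`, which
is orthogonal to `x` because `B x (F z) = B (E x) z = 0`. -/
theorem IsSl2.singular_nondeg (h : IsSl2 E F D B wt) (hwt : NotNat wt)
    (hfin : ∀ j : ℕ, FiniteDimensional ℝ (LinearMap.ker (D - (j : ℝ) • LinearMap.id)))
    {x : X} {m : ℕ} (hE : E x = 0)
    (hB : ∀ y, E y = 0 → D y = (m : ℝ) • y → B x y = 0) (y : X) (hy : D y = (m : ℝ) • y) :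
    B x y = 0 := by
  have hker : ∀ (j : ℕ) z, z ∈ LinearMap.ker (D - (j : ℝ) • LinearMap.id) ↔ D z = (j : ℝ) • z :=
    fun j z => by simp [sub_eq_zero]
  rcases m with _ | m
  · refine hB y (h.nonneg _ (-1) (by norm_num) ?_) hy
    rw [h.degE, hy]
    simp
  · have := hfin m
    have hmaps : ∀ z ∈ LinearMap.ker (D - (m : ℝ) • LinearMap.id),
        (E * F) z ∈ LinearMap.ker (D - (m : ℝ) • LinearMap.id) := fun z hz => by
      rw [hker] at hz ⊢
      rw [Module.End.mul_apply, h.degE, h.degF, hz, map_smul, map_add, map_smul]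
      module
    have hinj : Function.Injective ((E * F).restrict hmaps) := by
      rw [← LinearMap.ker_eq_bot, LinearMap.ker_eq_bot']
      rintro ⟨z, hz⟩ hz0
      have : E (F z) = 0 := congrArg Subtype.val hz0
      exact Subtype.ext (h.eq_zero_of_E_F hwt ((hker _ _).1 hz) this)
    have hEy : E y ∈ LinearMap.ker (D - (m : ℝ) • LinearMap.id) := by
      rw [hker, h.degE, hy, map_smul]
      push_cast
      module
    obtain ⟨⟨z, hz⟩, hz0⟩ := LinearMap.injective_iff_surjective.1 hinj ⟨E y, hEy⟩
    have hz1 : E (F z) = E y := congrArg Subtype.val hz0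
    rw [hker] at hz
    have h1 := hB (y - F z) (by rw [map_sub, hz1, sub_self]) (by
      rw [map_sub, h.degF, hz, hy, map_smul]
      push_cast
      module)
    rw [map_sub, ← h.adj, hE] at h1
    simpa using h1

/-- The form `(-1)^e B` is positive definite on the singular vectors of degree `m`. -/
def DefForm (e : ℕ) (E D : Module.End ℝ X) (B : X →ₗ[ℝ] X →ₗ[ℝ] ℝ) (m : ℕ) : Prop :=
  ∀ x, E x = 0 → D x = (m : ℝ) • x → x ≠ 0 → 0 < (-1) ^ e * B x x

theorem DefForm.congr {Y : Type*} [AddCommGroup Y] [Module ℝ Y] {E' D' : Module.End ℝ Y}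
    {B' : Y →ₗ[ℝ] Y →ₗ[ℝ] ℝ} (φ : X ≃ₗ[ℝ] Y) (hE : ∀ x, φ (E x) = E' (φ x))
    (hD : ∀ x, φ (D x) = D' (φ x)) (hB : ∀ x y, B x y = B' (φ x) (φ y)) (e m : ℕ) :
    DefForm e E D B m ↔ DefForm e E' D' B' m := by
  constructor
  · intro h y h1 h2 h3
    obtain ⟨x, rfl⟩ := φ.surjective y
    rw [← hB]
    refine h x (φ.injective ?_) (φ.injective ?_) (by rintro rfl; simp at h3)
    · rw [hE, h1, map_zero]
    · rw [hD, h2, map_smul]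
  · intro h x h1 h2 h3
    rw [hB]
    refine h _ ?_ ?_ (by simpa using h3)
    · rw [← hE, h1, map_zero]
    · rw [← hD, h2, map_smul]

/-- `E'`, `D'` and `B'` are given independently on the new space, as the multi-index formulas will
be. `F'` has no prescribed formula there and is defined by transport. -/
theorem IsSl2.congr {Y : Type*} [AddCommGroup Y] [Module ℝ Y] {E' D' : Module.End ℝ Y}
    {B' : Y →ₗ[ℝ] Y →ₗ[ℝ] ℝ} (φ : Y ≃ₗ[ℝ] X) (hE : ∀ x, φ (E' x) = E (φ x))
    (hD : ∀ x, φ (D' x) = D (φ x)) (hB : ∀ x y, B' x y = B (φ x) (φ y))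
    (h : IsSl2 E F D B wt) : IsSl2 E' (φ.symm.toLinearMap ∘ₗ F ∘ₗ φ.toLinearMap) D' B' wt where
  comm y := φ.injective (by simp [hE, hD, h.comm])
  degE y := φ.injective (by simp [hE, hD, h.degE])
  degF y := φ.injective (by simp [hD, h.degF])
  adj x y := by simp [hB, hE, h.adj]
  symm x y := by simp [hB, h.symm (φ x)]
  nondeg x hx := by
    have : φ x = 0 := h.nondeg _ fun y => by
      have := hx (φ.symm y)
      rwa [hB, LinearEquiv.apply_symm_apply] at this
    simpa using this
  nonneg x c hc hx := by
    have : φ x = 0 := h.nonneg _ c hc (by rw [← hD, hx, map_smul])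
    simpa using this

end Abstract

/-! ### Signs and Vandermonde's identity -/

theorem factorial_mul_ring_choose (x : ℝ) (k : ℕ) :
    (k.factorial : ℝ) * Ring.choose x k = ∏ j ∈ Finset.range k, (x - j) := by
  have h := Ring.descPochhammer_eq_factorial_smul_choose x k
  rw [nsmul_eq_mul] at h
  rw [← h, ← descPochhammer_eval_eq_prod_range, ← Polynomial.aeval_eq_smeval,
    Polynomial.aeval_def, Polynomial.eval₂_eq_eval_map, descPochhammer_map]

theorem shapNorm_eq (a : ℝ) (k : ℕ) :
    shapNorm a k = k.factorial * ∏ j ∈ Finset.range k, (a - j) := by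
  rw [shapNorm, Finset.prod_mul_distrib, ← Finset.prod_range_add_one_eq_factorial]
  push_cast
  rfl

theorem shapNorm_eq_choose (a : ℝ) (k : ℕ) :
    shapNorm a k = (k.factorial : ℝ) ^ 2 * Ring.choose a k := by
  rw [shapNorm_eq, ← factorial_mul_ring_choose]
  ring

/-- The tail of the product, read backwards with signs changed, is a falling factorial of `i + j - 1
- a`. This puts the terms of `fuseNorm` over a common denominator and exposes binomial coefficients.
-/
theorem shapNorm_add (a : ℝ) (i j : ℕ) :
    shapNorm a (i + j) * (i.factorial * j.factorial) =
      shapNorm a i * ((-1) ^ j * ((i + j).factorial * j.factorial) *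
        (j.factorial * Ring.choose ((i + j : ℕ) - 1 - a) j)) := by
  rw [shapNorm_eq, shapNorm_eq, Finset.prod_range_add, factorial_mul_ring_choose,
    ← Finset.prod_range_reflect (fun l : ℕ => (((i + j : ℕ) : ℝ) - 1 - a - l)) j]
  have : ∏ l ∈ Finset.range j, (((i + j : ℕ) : ℝ) - 1 - a - ((j - 1 - l : ℕ) : ℝ)) =
      (-1) ^ j * ∏ l ∈ Finset.range j, (a - ((i + l : ℕ) : ℝ)) := by
    rw [← Finset.card_range j, ← Finset.prod_const, Finset.card_range, ← Finset.prod_mul_distrib]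
    refine Finset.prod_congr rfl fun l hl => ?_
    have hl' : l + 1 ≤ j := Finset.mem_range.1 hl
    rw [Nat.sub_sub, add_comm 1 l, Nat.cast_sub hl']
    push_cast
    ring
  rw [this]
  have h1 : ((-1 : ℝ) ^ j) * (-1) ^ j = 1 := by rw [← mul_pow]; simp
  linear_combination (-
    (i.factorial : ℝ) * (∏ l ∈ Finset.range i, (a - (l : ℝ))) * (i + j).factorial * j.factorial *
      ∏ l ∈ Finset.range j, (a - ((i + l : ℕ) : ℝ))) * h1

/-- The norm of the singular vector `∑ (-1)^i u_i ⊗ u_{k-i}` of `M_a ⊗ M_b`. -/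
def fuseNorm (a b : ℝ) (k : ℕ) : ℝ :=
  ∑ ij ∈ Finset.HasAntidiagonal.antidiagonal k, (shapNorm a ij.1 * shapNorm b ij.2)⁻¹

/-- By `shapNorm_add` each term of the product is `(-1)^k (k!)^2` times a product of binomial
coefficients with upper entries `k - 1 - a` and `k - 1 - b`. Vandermonde's identity sums them to the
binomial coefficient of `2k - 2 - (a + b)` over `k`, whose factors in reverse order and with
opposite signs are those of the right-hand side. -/
theorem fuseNorm_mul {a b : ℝ} (ha : NotNat a) (hb : NotNat b) (k : ℕ) :
    fuseNorm a b k * (shapNorm a k * shapNorm b k) = shapNorm (a + b - ((k : ℝ) - 1)) k := by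
  have hk : (k.factorial : ℝ) ≠ 0 := by positivity
  have hs : ((k : ℝ) - 1 - a) + ((k : ℝ) - 1 - b) = 2 * (k : ℝ) - 2 - (a + b) := by ring
  have hR : shapNorm (a + b - ((k : ℝ) - 1)) k = (-1) ^ k * (k.factorial : ℝ) ^ 2 *
      Ring.choose (((k : ℝ) - 1 - a) + ((k : ℝ) - 1 - b)) k := by
    rw [hs, shapNorm_eq, sq, mul_assoc, mul_assoc, factorial_mul_ring_choose,
      ← Finset.prod_range_reflect, mul_left_comm]
    congr 1
    rw [← Finset.card_range k, ← Finset.prod_const, Finset.card_range, ← Finset.prod_mul_distrib]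
    refine Finset.prod_congr rfl fun l hl => ?_
    have hl' : l + 1 ≤ k := Finset.mem_range.1 hl
    rw [Nat.sub_sub, add_comm 1 l, Nat.cast_sub hl']
    push_cast
    ring
  rw [hR, Ring.add_choose_eq k (Commute.all _ _), fuseNorm, Finset.sum_mul, Finset.mul_sum,
    ← Finset.Nat.sum_antidiagonal_swap]
  refine Finset.sum_congr rfl fun ⟨j, i⟩ hij => ?_
  rw [Finset.HasAntidiagonal.mem_antidiagonal] at hij
  simp only [Prod.fst_swap, Prod.snd_swap] at hij ⊢
  have hi : (i.factorial : ℝ) ≠ 0 := by positivity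
  have hj : (j.factorial : ℝ) ≠ 0 := by positivity
  have h1 := shapNorm_add a i j
  have h2 := shapNorm_add b j i
  rw [show i + j = k by omega] at h1
  rw [hij] at h2
  have na := shapNorm_ne_zero ha i
  have nb := shapNorm_ne_zero hb j
  have h3 : (shapNorm a k * shapNorm b k) * ((i.factorial : ℝ) * j.factorial) ^ 2 =
      ((shapNorm a i * shapNorm b j) * ((-1) ^ k * (k.factorial : ℝ) ^ 2 *
        (Ring.choose ((k : ℝ) - 1 - a) j * Ring.choose ((k : ℝ) - 1 - b) i))) *
        ((i.factorial : ℝ) * j.factorial) ^ 2 := by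
    have : (-1 : ℝ) ^ k = (-1) ^ j * (-1) ^ i := by rw [← pow_add, hij]
    rw [this]
    calc _ = (shapNorm a k * (i.factorial * j.factorial)) *
          (shapNorm b k * (j.factorial * i.factorial)) := by ring
      _ = _ := by rw [h1, h2]; ring
  have h4 := mul_right_cancel₀ (pow_ne_zero 2 (mul_ne_zero hi hj)) h3
  rw [h4]
  field_simp

theorem natCeil_sub_natCast_real (x : ℝ) (k : ℕ) : ⌈x - k⌉₊ = ⌈x⌉₊ - k := Nat.ceil_sub_natCast x k

/-- The factor `a - j` is positive for `j < ⌈a⌉₊` and negative afterwards. The natural ceiling is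
`0` for negative `a`, so that case is included. -/
theorem shapNorm_sign {a : ℝ} (ha : NotNat a) (k : ℕ) :
    0 < (-1) ^ (k - ⌈a⌉₊) * shapNorm a k := by
  induction k with
  | zero => simp [shapNorm]
  | succ k ih =>
    rw [shapNorm_succ]
    have hk : (0 : ℝ) < k + 1 := by positivity
    by_cases h : k < ⌈a⌉₊
    · have h1 : (0 : ℝ) < a - k := sub_pos.2 (Nat.lt_ceil.1 h)
      rw [show k - ⌈a⌉₊ = 0 by omega, pow_zero, one_mul] at ih
      rw [show k + 1 - ⌈a⌉₊ = 0 by omega, pow_zero, one_mul]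
      positivity
    · have h1 : 0 < (k : ℝ) - a :=
        sub_pos.2 (lt_of_le_of_ne (Nat.ceil_le.1 (not_lt.1 h)) (ha k))
      rw [show k + 1 - ⌈a⌉₊ = (k - ⌈a⌉₊) + 1 by omega, pow_succ]
      calc 0 < ((-1) ^ (k - ⌈a⌉₊) * shapNorm a k) * ((k + 1) * (k - a)) := by positivity
        _ = _ := by ring

/-- The exponent of the sign of the form on the level `k` multiplicity space of `M_a ⊗ M_b`, where
`A`, `B`, `C` are the ceilings of `a`, `b`, `a + b`. -/
def fuseExp (A B C k : ℕ) : ℕ := (k - A) + (k - B) + min k (2 * k - 1 - C)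

/-- The three summands of `fuseExp` count the negative factors of the three norms in `fuseNorm_mul`.
For `k ≥ 1` the norm at weight `a + b - (k - 1)` has `k - (C - (k - 1))` of them, with truncated
subtractions, which is `min k (2k - 1 - C)`. -/
theorem fuseNorm_sign {a b : ℝ} (ha : NotNat a) (hb : NotNat b) (hab : NotNat (a + b)) (k : ℕ) :
    0 < (-1) ^ fuseExp ⌈a⌉₊ ⌈b⌉₊ ⌈a + b⌉₊ k * fuseNorm a b k := by
  rcases k with _ | k
  · simp [fuseExp, fuseNorm, shapNorm]
  · have hs : NotNat (a + b - k) := hab.sub_nat k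
    have h1 := fuseNorm_mul ha hb (k + 1)
    have h2 := shapNorm_sign hs (k + 1)
    have h3 := shapNorm_sign ha (k + 1)
    have h4 := shapNorm_sign hb (k + 1)
    rw [natCeil_sub_natCast_real] at h2
    rw [show a + b - (((k + 1 : ℕ) : ℝ) - 1) = a + b - k by push_cast; ring] at h1
    rw [← h1] at h2
    have e : fuseExp ⌈a⌉₊ ⌈b⌉₊ ⌈a + b⌉₊ (k + 1) = (k + 1 - ⌈a⌉₊) + (k + 1 - ⌈b⌉₊) +
        (k + 1 - (⌈a + b⌉₊ - k)) := by unfold fuseExp; omega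
    rw [e]
    refine pos_of_mul_pos_left (b := ((-1) ^ (k + 1 - ⌈a⌉₊) * shapNorm a (k + 1)) *
      ((-1) ^ (k + 1 - ⌈b⌉₊) * shapNorm b (k + 1))) ?_ (mul_pos h3 h4).le
    refine lt_of_lt_of_eq h2 ?_
    have h5 : ∀ n : ℕ, ((-1 : ℝ) ^ n) * (-1) ^ n = 1 := fun n => by rw [← mul_pow]; simp
    rw [pow_add, pow_add]
    linear_combination (-((-1 : ℝ) ^ (k + 1 - (⌈a + b⌉₊ - k)) * fuseNorm a b (k + 1) *
      (shapNorm a (k + 1) * shapNorm b (k + 1)))) *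
      ((-1 : ℝ) ^ (k + 1 - ⌈b⌉₊) * (-1 : ℝ) ^ (k + 1 - ⌈b⌉₊) * h5 (k + 1 - ⌈a⌉₊) +
        h5 (k + 1 - ⌈b⌉₊))

theorem fuseNorm_ne_zero {a b : ℝ} (ha : NotNat a) (hb : NotNat b) (hab : NotNat (a + b)) (k : ℕ) :
    fuseNorm a b k ≠ 0 := fun h => by
  have := fuseNorm_sign ha hb hab k
  rw [h, mul_zero] at this
  exact this.ne rfl

/-! ### Fusion of two Verma modules -/

section Fusion

variable {X : Type*} [AddCommGroup X] [Module ℝ X]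

/-- Fusion concerns only the first two factors. While they are decomposed, the remaining product `X`
is regarded as a trivial module, and its own operators act through `lastFactor`. -/
theorem isSl2_trivial {B : X →ₗ[ℝ] X →ₗ[ℝ] ℝ} (hs : ∀ x y, B x y = B y x)
    (hB : ∀ x, (∀ y, B x y = 0) → x = 0) : IsSl2 (0 : Module.End ℝ X) 0 0 B 0 where
  comm x := by simp
  degE x := by simp
  degF x := by simp
  adj x y := by simp
  symm := hs
  nondeg := hB
  nonneg x c hc h := (smul_eq_zero.1 (h.symm.trans (LinearMap.zero_apply x))).resolve_left hc.ne

theorem isSl2_pair {B : X →ₗ[ℝ] X →ₗ[ℝ] ℝ} (hs : ∀ x y, B x y = B y x)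
    (hB : ∀ x, (∀ y, B x y = 0) → x = 0) {a b : ℝ} (ha : NotNat a) (hb : NotNat b) :
    IsSl2 (tensE (tensE (0 : Module.End ℝ X))) (tensF a (tensF b 0)) (tensD (tensD 0))
      (tensB a (tensB b B)) (a + b) := by
  simpa using ((isSl2_trivial hs hB).tens hb).tens ha

/-- Two linear maps on `ℕ →₀ ℕ →₀ X` agree when they agree on pure tensors. -/
theorem pair_ext {Y : Type*} [AddCommGroup Y] [Module ℝ Y] {f g : (ℕ →₀ ℕ →₀ X) →ₗ[ℝ] Y}
    (h : ∀ i j x, f (Finsupp.single i (Finsupp.single j x)) =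
      g (Finsupp.single i (Finsupp.single j x))) : f = g :=
  Finsupp.lhom_ext' fun i => Finsupp.lhom_ext' fun j => LinearMap.ext fun x => h i j x

/-- An operator on the last factor of `M_a ⊗ M_b ⊗ X`. -/
def lastFactor (T : Module.End ℝ X) : Module.End ℝ (ℕ →₀ ℕ →₀ X) :=
  Finsupp.mapRange.linearMap (Finsupp.mapRange.linearMap T)

theorem lastFactor_single (T : Module.End ℝ X) (i j : ℕ) (x : X) :
    lastFactor T (Finsupp.single i (Finsupp.single j x)) =
      Finsupp.single i (Finsupp.single j (T x)) := by
  simp [lastFactor]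

theorem tensE_tensE (E : Module.End ℝ X) :
    tensE (tensE E) = tensE (tensE 0) + lastFactor E := by
  refine pair_ext fun i j x => ?_
  rw [LinearMap.add_apply, lastFactor_single]
  rcases i with _ | i <;> rcases j with _ | j <;>
    (simp [tensE_single_zero, tensE_single_succ, Finsupp.single_add]; try abel)

theorem tensD_tensD (D : Module.End ℝ X) :
    tensD (tensD D) = tensD (tensD 0) + lastFactor D := by
  refine pair_ext fun i j x => ?_
  rw [LinearMap.add_apply, lastFactor_single]
  simp [tensD_single, Finsupp.single_add]
  abel

theorem tensF_lastFactor (a b : ℝ) (T : Module.End ℝ X) :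
    tensF a (tensF b 0) * lastFactor T = lastFactor T * tensF a (tensF b 0) := by
  refine pair_ext fun i j x => ?_
  simp only [Module.End.mul_apply, lastFactor_single, tensF_single, map_add, map_smul,
    Finsupp.single_add, ← Finsupp.smul_single, LinearMap.zero_apply, Finsupp.single_zero, map_zero]

/-- The singular vector `∑ (-1)^i u_i ⊗ u_{k-i} ⊗ x`. -/
def singVec (k : ℕ) : X →ₗ[ℝ] (ℕ →₀ ℕ →₀ X) :=
  ∑ ij ∈ Finset.HasAntidiagonal.antidiagonal k,
    ((-1 : ℝ) ^ ij.1) • (Finsupp.lsingle ij.1 ∘ₗ Finsupp.lsingle ij.2)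

theorem singVec_eq (k : ℕ) (x : X) :
    singVec k x = ∑ ij ∈ Finset.HasAntidiagonal.antidiagonal k,
      ((-1 : ℝ) ^ ij.1) • Finsupp.single ij.1 (Finsupp.single ij.2 x) := by
  simp [singVec]

theorem singVec_apply (k : ℕ) (x : X) (i j : ℕ) :
    singVec k x i j = if i + j = k then ((-1 : ℝ) ^ i) • x else 0 := by
  rw [singVec_eq, Finsupp.finsetSum_apply, Finsupp.finsetSum_apply]
  split_ifs with h
  · rw [Finset.sum_eq_single (i, j)]
    · simp
    · rintro ⟨p, q⟩ - hne
      by_cases hp : p = i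
      · subst hp
        have : q ≠ j := fun hq => hne (by rw [hq])
        simp [this]
      · simp [hp]
    · intro hn
      exact absurd (Finset.HasAntidiagonal.mem_antidiagonal.2 h) hn
  · refine Finset.sum_eq_zero ?_
    rintro ⟨p, q⟩ hpq
    rw [Finset.HasAntidiagonal.mem_antidiagonal] at hpq
    by_cases hp : p = i
    · subst hp
      have : q ≠ j := fun hq => h (by rw [← hq]; exact hpq)
      simp [this]
    · simp [hp]

/-- As `E u_i = u_{i-1}` without a coefficient, the alternating signs make neighbouring terms
cancel. -/
theorem tensE_singVec (k : ℕ) (x : X) : tensE (tensE 0) (singVec k x) = 0 := by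
  ext i j
  rw [tensE_apply, Finsupp.add_apply, tensE_apply, singVec_apply, singVec_apply]
  by_cases h : i + j + 1 = k
  · rw [if_pos (by omega), if_pos (by omega), pow_succ]
    simp
  · rw [if_neg (by omega), if_neg (by omega)]
    simp

theorem tensD_singVec (k : ℕ) (x : X) :
    tensD (tensD 0) (singVec k x) = (k : ℝ) • singVec k x := by
  ext i j
  rw [tensD_apply, Finsupp.add_apply, tensD_apply, Finsupp.smul_apply, Finsupp.smul_apply,
    Finsupp.smul_apply, singVec_apply]
  split_ifs with h
  · rw [← h, LinearMap.zero_apply, add_zero, ← add_smul]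
    push_cast
    rfl
  · simp

theorem lastFactor_singVec (T : Module.End ℝ X) (k : ℕ) (x : X) :
    lastFactor T (singVec k x) = singVec k (T x) := by
  rw [singVec_eq, singVec_eq, map_sum]
  exact Finset.sum_congr rfl fun ij _ => by rw [map_smul, lastFactor_single]

theorem tensB_singVec (a b : ℝ) (B : X →ₗ[ℝ] X →ₗ[ℝ] ℝ) (k l : ℕ) (x y : X) :
    tensB a (tensB b B) (singVec k x) (singVec l y) =
      if k = l then fuseNorm a b k * B x y else 0 := by
  rw [singVec_eq, map_sum, LinearMap.sum_apply]
  split_ifs with h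
  · subst h
    rw [fuseNorm, Finset.sum_mul]
    refine Finset.sum_congr rfl ?_
    rintro ⟨i, j⟩ hij
    rw [Finset.HasAntidiagonal.mem_antidiagonal] at hij
    simp only at hij
    have h1 : ((-1 : ℝ) ^ i) * (-1) ^ i = 1 := by rw [← mul_pow]; simp
    simp only [map_smul, LinearMap.smul_apply, tensB_single, singVec_apply, if_pos hij, smul_eq_mul,
      mul_inv]
    linear_combination ((shapNorm a i)⁻¹ * (shapNorm b j)⁻¹ * B x y) * h1
  · refine Finset.sum_eq_zero ?_
    rintro ⟨i, j⟩ hij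
    rw [Finset.HasAntidiagonal.mem_antidiagonal] at hij
    simp only at hij
    simp only [map_smul, LinearMap.smul_apply, tensB_single, singVec_apply,
      if_neg (show i + j ≠ l by omega), map_zero, mul_zero, smul_zero]

/-- The embedding `M_{a+b-2k} ⊗ X → M_a ⊗ M_b ⊗ X`. -/
def fuseMap (a b : ℝ) (k : ℕ) : (ℕ →₀ X) →ₗ[ℝ] (ℕ →₀ ℕ →₀ X) :=
  Finsupp.lsum ℝ fun j : ℕ => (shapNorm (a + b - 2 * k) j)⁻¹ •
    ((tensF a (tensF b 0) ^ j : Module.End ℝ (ℕ →₀ ℕ →₀ X)) ∘ₗ singVec k)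

theorem fuseMap_single (a b : ℝ) (k j : ℕ) (x : X) :
    fuseMap a b k (Finsupp.single j x) =
      (shapNorm (a + b - 2 * k) j)⁻¹ • (tensF a (tensF b 0) ^ j) (singVec k x) := by
  simp [fuseMap]

variable {B : X →ₗ[ℝ] X →ₗ[ℝ] ℝ} (hs : ∀ x y, B x y = B y x)
  (hB : ∀ x, (∀ y, B x y = 0) → x = 0) {a b : ℝ} (ha : NotNat a) (hb : NotNat b)
  (hab : NotNat (a + b))

theorem lastFactor_tensF_pow (a b : ℝ) (T : Module.End ℝ X) (j : ℕ) (y : ℕ →₀ ℕ →₀ X) :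
    lastFactor T ((tensF a (tensF b 0) ^ j) y) = (tensF a (tensF b 0) ^ j) (lastFactor T y) := by
  have h : Commute (tensF a (tensF b 0) ^ j) (lastFactor T) :=
    Commute.pow_left (tensF_lastFactor a b T) j
  exact (LinearMap.congr_fun h.eq y).symm

include hs hB ha hb hab in
-- The normalized vector `F^j w` over its Verma norm plays the role of `u_j` in `M_{a+b-2k}`, where
-- `w` is the singular vector. The relation for `E F^(j+1) w` has exactly the coefficient that the
-- normalization removes.
theorem tensE_fuseMap (E : Module.End ℝ X) (k : ℕ) (y : ℕ →₀ X) :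
    tensE (tensE E) (fuseMap a b k y) = fuseMap a b k (tensE E y) := by
  have hsl := isSl2_pair hs hB ha hb
  have hab' := hab.sub_two_mul k
  induction y using Finsupp.induction_linear with
  | zero => simp
  | add f g hf hg => simp only [map_add, hf, hg]
  | single j x =>
    rw [tensE_tensE, fuseMap_single, LinearMap.add_apply, map_smul, map_smul,
      lastFactor_tensF_pow, lastFactor_singVec]
    rcases j with _ | j
    · rw [tensE_single_zero, fuseMap_single, pow_zero, Module.End.one_apply, tensE_singVec]
      simp
    · rw [tensE_single_succ, map_add, fuseMap_single, fuseMap_single,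
        hsl.E_F_pow (tensD_singVec k x) (tensE_singVec k x), smul_smul, shapNorm_succ]
      congr 2
      have h1 := shapNorm_ne_zero hab' j
      have h2 : a + b - 2 * k - j ≠ 0 := sub_ne_zero.2 (hab' j)
      have h3 : (j : ℝ) + 1 ≠ 0 := by positivity
      field_simp

include hs hB ha hb in
theorem tensD_fuseMap (D : Module.End ℝ X) (k : ℕ) (y : ℕ →₀ X) :
    tensD (tensD D) (fuseMap a b k y) = fuseMap a b k (tensD D y + (k : ℝ) • y) := by
  have hsl := isSl2_pair hs hB ha hb
  induction y using Finsupp.induction_linear with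
  | zero => simp
  | add f g hf hg => simp only [map_add, hf, hg, smul_add]; abel
  | single j x =>
    rw [tensD_tensD, fuseMap_single, LinearMap.add_apply, map_smul, map_smul,
      lastFactor_tensF_pow, lastFactor_singVec, hsl.D_F_pow (tensD_singVec k x), tensD_single,
      map_add, map_add, map_smul, map_smul, fuseMap_single, fuseMap_single]
    module

theorem tensF_fuseMap (hab : NotNat (a + b)) (k : ℕ) (j : ℕ) (x : X) :
    tensF a (tensF b 0) (fuseMap a b k (Finsupp.single j x)) =
      fuseMap a b k ((((j : ℝ) + 1) * (a + b - 2 * k - j)) • Finsupp.single (j + 1) x) := by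
  have hab' := hab.sub_two_mul k
  rw [map_smul, fuseMap_single, fuseMap_single, map_smul, ← Module.End.mul_apply, ← pow_succ',
    smul_smul, shapNorm_succ]
  congr 1
  have h1 := shapNorm_ne_zero hab' j
  have h2 : a + b - 2 * k - j ≠ 0 := sub_ne_zero.2 (hab' j)
  have h3 : (j : ℝ) + 1 ≠ 0 := by positivity
  field_simp

include hs hB ha hb in
-- Moving one `F` at a time across the form turns it into `E`, which lowers the exponent on the
-- other side and kills singular vectors. Different exponents therefore give orthogonal vectors.
theorem tensB_pow_singVec (k l i j : ℕ) (x y : X) :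
    tensB a (tensB b B) ((tensF a (tensF b 0) ^ i) (singVec k x))
      ((tensF a (tensF b 0) ^ j) (singVec l y)) =
      if i = j ∧ k = l then shapNorm (a + b - 2 * k) i * (fuseNorm a b k * B x y) else 0 := by
  have hsl := isSl2_pair hs hB ha hb
  induction i generalizing j with
  | zero =>
    rcases j with _ | j
    · simp only [pow_zero, Module.End.one_apply, tensB_singVec]
      simp [shapNorm]
    · rw [if_neg (by simp), pow_succ', Module.End.mul_apply, ← hsl.adj]
      simp [tensE_singVec]
  | succ i ih =>
    rcases j with _ | j
    · rw [if_neg (by simp), hsl.symm, pow_succ', Module.End.mul_apply, ← hsl.adj]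
      simp [tensE_singVec]
    · rw [pow_succ', Module.End.mul_apply, hsl.symm, ← hsl.adj,
        hsl.E_F_pow (tensD_singVec l y) (tensE_singVec l y), map_smul, LinearMap.smul_apply,
        hsl.symm, ih]
      by_cases h : i = j ∧ k = l
      · obtain ⟨rfl, rfl⟩ := h
        simp only [and_self, if_true, shapNorm_succ, smul_eq_mul]
        ring
      · rw [if_neg h, if_neg (by simpa using h), smul_zero]

include hs hB ha hb hab in
theorem tensB_fuseMap (k l : ℕ) (x y : ℕ →₀ X) :
    tensB a (tensB b B) (fuseMap a b k x) (fuseMap a b l y) =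
      if k = l then fuseNorm a b k * tensB (a + b - 2 * k) B x y else 0 := by
  induction x using Finsupp.induction_linear with
  | zero => simp
  | add f g hf hg =>
    simp only [map_add, LinearMap.add_apply, hf, hg]
    split_ifs <;> ring
  | single i x =>
    induction y using Finsupp.induction_linear with
    | zero => simp
    | add f g hf hg =>
      simp only [map_add, hf, hg]
      split_ifs <;> ring
    | single j y =>
      have h1 := shapNorm_ne_zero (hab.sub_two_mul k) i
      rw [fuseMap_single, fuseMap_single, map_smul, map_smul, LinearMap.smul_apply,
        tensB_pow_singVec hs hB ha hb, tensB_single]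
      by_cases hk : k = l
      · subst hk
        by_cases hi : i = j
        · subst hi
          simp
          field_simp
        · simp [hi]
      · simp [hk]

/-- The sum of the embeddings of `M_{a+b-2k} ⊗ X` over all `k`. -/
def fuseSum (a b : ℝ) : (ℕ →₀ ℕ →₀ X) →ₗ[ℝ] (ℕ →₀ ℕ →₀ X) :=
  Finsupp.lsum ℝ fun k => fuseMap a b k

theorem fuseSum_single (a b : ℝ) (k : ℕ) (y : ℕ →₀ X) :
    fuseSum a b (Finsupp.single k y) = fuseMap a b k y := by
  simp [fuseSum]

include hs hB ha hb hab in
theorem tensB_fuseSum (t : ℕ →₀ ℕ →₀ X) (k : ℕ) (y : ℕ →₀ X) :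
    tensB a (tensB b B) (fuseSum a b t) (fuseMap a b k y) =
      fuseNorm a b k * tensB (a + b - 2 * k) B (t k) y := by
  induction t using Finsupp.induction_linear with
  | zero => simp
  | add f g hf hg => simp only [map_add, LinearMap.add_apply, hf, hg, Finsupp.add_apply]; ring
  | single j x =>
    rw [fuseSum_single, tensB_fuseMap hs hB ha hb hab]
    by_cases h : j = k
    · subst h; simp
    · simp [h]

include hs hB ha hb hab in
-- Pairing with the image of the `k`-th embedding isolates the component `t k`, by orthogonality; it
-- vanishes because the form is nondegenerate and `fuseNorm` is not zero.
theorem fuseSum_injective (t : ℕ →₀ ℕ →₀ X) (h : fuseSum a b t = 0) : t = 0 := by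
  ext1 k
  refine tensB_nondeg hs hB (hab.sub_two_mul k) _ fun y => ?_
  have := tensB_fuseSum hs hB ha hb hab t k y
  rw [h, map_zero, LinearMap.zero_apply] at this
  exact (mul_eq_zero.1 this.symm).resolve_left (fuseNorm_ne_zero ha hb hab k)

include ha hb hab in
-- The image `R` is stable under `F` and contains the singular vectors. By induction on the degree,
-- modulo `R` all `v_i ⊗ v_j` of one degree agree up to sign, and the singular vector of that degree
-- is then congruent to a nonzero multiple of any of them.
theorem fuseSum_surjective : Function.Surjective (fuseSum a b : (ℕ →₀ ℕ →₀ X) →ₗ[ℝ] _) := by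
  rw [← LinearMap.range_eq_top]
  set R := LinearMap.range (fuseSum a b : (ℕ →₀ ℕ →₀ X) →ₗ[ℝ] (ℕ →₀ ℕ →₀ X)) with hR
  have hmap : ∀ k y, fuseMap a b k y ∈ R := fun k y => ⟨Finsupp.single k y, fuseSum_single a b k y⟩
  have hsing : ∀ k x, singVec k x ∈ R := fun k x => by
    have := hmap k (Finsupp.single 0 x)
    rwa [fuseMap_single, pow_zero, Module.End.one_apply, shapNorm, Finset.prod_range_zero, inv_one,
      one_smul] at this
  have hF : ∀ y ∈ R, tensF a (tensF b 0) y ∈ R := by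
    rintro _ ⟨t, rfl⟩
    induction t using Finsupp.induction_linear with
    | zero => simp
    | add f g hf hg => simp only [map_add]; exact R.add_mem hf hg
    | single k y =>
      rw [fuseSum_single]
      induction y using Finsupp.induction_linear with
      | zero => simp
      | add f g hf hg => simp only [map_add]; exact R.add_mem hf hg
      | single j x => rw [tensF_fuseMap hab]; exact hmap _ _
  have na := shapNorm_ne_zero ha
  have nb := shapNorm_ne_zero hb
  have main : ∀ m i j x, i + j = m →
      (Finsupp.single i (Finsupp.single j x) : ℕ →₀ ℕ →₀ X) ∈ R := by
    intro m
    induction m with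
    | zero =>
      intro i j x hij
      obtain ⟨rfl, rfl⟩ : i = 0 ∧ j = 0 := by omega
      simpa [singVec_eq] using hsing 0 x
    | succ m ih =>
      -- These are the vectors `v_i ⊗ v_j ⊗ x`, on which `F` acts with coefficients one.
      let v : ℕ → ℕ → X → (ℕ →₀ ℕ →₀ X) := fun i j x =>
        (shapNorm a i * shapNorm b j) • Finsupp.single i (Finsupp.single j x)
      have hstep : ∀ i j x, i + j = m → v (i + 1) j x + v i (j + 1) x ∈ R := by
        intro i j x hij
        have := hF _ (R.smul_mem (shapNorm a i * shapNorm b j) (ih i j x hij))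
        rw [map_smul, tensF_single, tensF_single, LinearMap.zero_apply, Finsupp.single_zero,
          add_zero, ← Finsupp.smul_single, smul_add, smul_smul, smul_smul] at this
        convert this using 2
        · simp only [v, shapNorm_succ]; congr 1; ring
        · simp only [v, shapNorm_succ]; congr 1; ring
      have hmod : ∀ i j x, i + j = m + 1 →
          v i j x - ((-1 : ℝ) ^ i) • v 0 (m + 1) x ∈ R := by
        intro i
        induction i with
        | zero => intro j x hj; obtain rfl : j = m + 1 := by omega
                  simp
        | succ i ihi =>
          intro j x hj
          have h1 := hstep i j x (by omega)
          have h2 := ihi (j + 1) x (by omega)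
          have h3 := R.sub_mem h1 h2
          convert h3 using 1
          rw [pow_succ]
          module
      have hv0 : ∀ x, v 0 (m + 1) x ∈ R := by
        intro x
        -- The sign `(-1)^i` in the singular vector cancels the sign from `hmod`, so the
        -- coefficients add up to `fuseNorm` without cancellation of signs between the two.
        have h1 : singVec (m + 1) x - fuseNorm a b (m + 1) • v 0 (m + 1) x ∈ R := by
          rw [singVec_eq, fuseNorm, Finset.sum_smul, ← Finset.sum_sub_distrib]
          refine R.sum_mem ?_
          rintro ⟨i, j⟩ hij
          rw [Finset.HasAntidiagonal.mem_antidiagonal] at hij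
          simp only at hij ⊢
          have h2 := R.smul_mem (((-1 : ℝ) ^ i) * (shapNorm a i * shapNorm b j)⁻¹) (hmod i j x hij)
          convert h2 using 1
          have h3 : ((-1 : ℝ) ^ i) * (-1) ^ i = 1 := by rw [← mul_pow]; simp
          have h4 := na i
          have h5 := nb j
          have h6 : ((-1 : ℝ) ^ i) * (shapNorm a i * shapNorm b j)⁻¹ * (-1) ^ i =
              (shapNorm a i * shapNorm b j)⁻¹ := by
            linear_combination (shapNorm a i * shapNorm b j)⁻¹ * h3
          rw [smul_sub, smul_smul _ ((-1 : ℝ) ^ i), h6]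
          congr 1
          simp only [v, smul_smul]
          congr 1
          field_simp
        have h2 := R.sub_mem (hsing (m + 1) x) h1
        rw [sub_sub_cancel] at h2
        exact (R.smul_mem_iff (fuseNorm_ne_zero ha hb hab _)).1 h2
      intro i j x hij
      have h1 := R.add_mem (hmod i j x hij) (R.smul_mem ((-1 : ℝ) ^ i) (hv0 x))
      rw [sub_add_cancel] at h1
      exact (R.smul_mem_iff (mul_ne_zero (na i) (nb j))).1 h1
  rw [eq_top_iff]
  rintro y -
  induction y using Finsupp.induction_linear with
  | zero => exact R.zero_mem
  | add f g hf hg => exact R.add_mem hf hg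
  | single i y =>
    induction y using Finsupp.induction_linear with
    | zero => simp
    | add f g hf hg => rw [Finsupp.single_add]; exact R.add_mem hf hg
    | single j x => exact main _ i j x rfl

theorem negOne_pow_mul_pos {e f : ℕ} {c x : ℝ} (hc : 0 < (-1) ^ f * c) :
    0 < (-1) ^ e * (c * x) ↔ 0 < (-1) ^ (e + f) * x := by
  have h : ((-1 : ℝ) ^ f) * (-1) ^ f = 1 := by rw [← mul_pow]; simp
  have : (-1) ^ e * (c * x) = ((-1) ^ f * c) * ((-1) ^ (e + f) * x) := by
    rw [pow_add]; linear_combination (-((-1) ^ e * c * x)) * h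
  rw [this, mul_pos_iff_of_pos_left hc]

include hs hB ha hb hab in
/-- Fusion: the multiplicity space of `M_a ⊗ M_b ⊗ X` is the orthogonal sum of those of
`M_{a+b-2k} ⊗ X`, up to the signs of `fuseExp`. -/
theorem defForm_fuse {E D : Module.End ℝ X}
    (hD : ∀ (x : X) (c : ℝ), c < 0 → D x = c • x → x = 0) (e m : ℕ) :
    DefForm e (tensE (tensE E)) (tensD (tensD D)) (tensB a (tensB b B)) m ↔
      ∀ k ≤ m, DefForm (e + fuseExp ⌈a⌉₊ ⌈b⌉₊ ⌈a + b⌉₊ k) (tensE E) (tensD D)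
        (tensB (a + b - 2 * k) B) (m - k) := by
  constructor
  · intro h k hk x h1 h2 h3
    have h4 : fuseMap a b k x ≠ 0 := fun h0 => by
      rw [← fuseSum_single] at h0
      exact h3 (by simpa using fuseSum_injective hs hB ha hb hab _ h0)
    have h5 := h (fuseMap a b k x) (by rw [tensE_fuseMap hs hB ha hb hab, h1, map_zero])
      (by rw [tensD_fuseMap hs hB ha hb, h2, Nat.cast_sub hk, ← map_smul]; congr 1; module) h4
    rw [tensB_fuseMap hs hB ha hb hab, if_pos rfl] at h5
    exact (negOne_pow_mul_pos (fuseNorm_sign ha hb hab k)).1 h5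
  · intro h x h1 h2 h3
    obtain ⟨t, rfl⟩ := fuseSum_surjective ha hb hab x
    -- `fuseSum` intertwines `E` with its componentwise action and is injective, so singularity can
    -- be read off each component.
    have hEt : ∀ k, tensE E (t k) = 0 := by
      have : tensE (tensE E) (fuseSum a b t) =
          fuseSum a b (Finsupp.mapRange.linearMap (tensE E) t) := by
        have key : tensE (tensE E) ∘ₗ fuseSum a b =
            fuseSum a b ∘ₗ Finsupp.mapRange.linearMap (tensE E) :=
          Finsupp.lhom_ext fun k y => by
            simp [fuseSum_single, tensE_fuseMap hs hB ha hb hab]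
        exact LinearMap.congr_fun key t
      rw [this] at h1
      have h4 := fuseSum_injective hs hB ha hb hab _ h1
      intro k
      simpa using DFunLike.congr_fun h4 k
    have hDt : ∀ k, tensD D (t k) = ((m : ℝ) - k) • t k := by
      -- The `k`-th embedding raises the degree by `k`. This is what the outer `tensD` adds when the
      -- family of components is indexed by `k`.
      have key : tensD (tensD D) ∘ₗ fuseSum a b =
          fuseSum a b ∘ₗ tensD (tensD D) := by
        refine Finsupp.lhom_ext fun k y => ?_
        rw [LinearMap.comp_apply, LinearMap.comp_apply, fuseSum_single,
          tensD_fuseMap hs hB ha hb, tensD_single, map_add, map_add, map_smul, map_smul,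
          fuseSum_single, fuseSum_single, add_comm]
      have h4 := LinearMap.congr_fun key t
      rw [LinearMap.comp_apply, LinearMap.comp_apply, h2, ← map_smul] at h4
      have h5 := fuseSum_injective hs hB ha hb hab _ (by rw [map_sub]; exact sub_eq_zero.2 h4)
      intro k
      have h6 := DFunLike.congr_fun h5 k
      rw [Finsupp.sub_apply, Finsupp.smul_apply, tensD_apply, Finsupp.zero_apply, sub_eq_zero] at h6
      rw [sub_smul, h6]
      abel
    have h0 : ∀ k, m < k → t k = 0 := fun k hk => by
      refine tensD_nonneg hD _ _ ?_ (hDt k)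
      have : (m : ℝ) < k := Nat.cast_lt.2 hk
      linarith
    -- Orthogonality of the summands removes all cross terms.
    have hQ : tensB a (tensB b B) (fuseSum a b t) (fuseSum a b t) =
        ∑ k ∈ t.support, fuseNorm a b k * tensB (a + b - 2 * k) B (t k) (t k) := by
      conv_lhs => rw [show (fuseSum a b t) = ∑ k ∈ t.support, fuseMap a b k (t k) by
        simp [fuseSum, Finsupp.sum]]
      rw [map_sum]
      refine Finset.sum_congr rfl fun k _ => ?_
      rw [← tensB_fuseSum hs hB ha hb hab]
      simp [fuseSum, Finsupp.sum]
    have ht : t.support.Nonempty := by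
      rw [Finsupp.support_nonempty_iff]
      rintro rfl
      simp at h3
    rw [hQ, Finset.mul_sum]
    refine Finset.sum_pos (fun k hk => ?_) ht
    have hk0 : t k ≠ 0 := Finsupp.mem_support_iff.1 hk
    have hkm : k ≤ m := not_lt.1 fun hlt => hk0 (h0 k hlt)
    refine (negOne_pow_mul_pos (fuseNorm_sign ha hb hab k)).2
      (h k hkm _ (hEt k) ?_ hk0)
    rw [hDt, Nat.cast_sub hkm]

end Fusion

/-! ### Tensor products of Verma modules in coordinates -/

section Coordinates

variable (K : Type*) [Field K]

/-- The operator `E` in the coordinates of the basis `u_k = v_k / (v_k, v_k)`. -/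
def lower (ι : Type*) [Fintype ι] [DecidableEq ι] : Module.End K ((ι → ℕ) →₀ K) :=
  ∑ i, Finsupp.lcomapDomain (fun k : ι → ℕ => k + Pi.single i 1) (add_left_injective _)

theorem lower_apply {ι : Type*} [Fintype ι] [DecidableEq ι] (f : (ι → ℕ) →₀ K) (k : ι → ℕ) :
    lower K ι f k = ∑ i, f (k + Pi.single i 1) := by
  simp [lower, Finsupp.lcomapDomain, Finsupp.finsetSum_apply]

/-- The degree operator in coordinates. -/
def deg (ι : Type*) [Fintype ι] : Module.End K ((ι → ℕ) →₀ K) :=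
  Finsupp.lsum K fun k : ι → ℕ => ((∑ i, k i : ℕ) : K) • Finsupp.lsingle k

theorem deg_apply {ι : Type*} [Fintype ι] (f : (ι → ℕ) →₀ K) (k : ι → ℕ) :
    deg K ι f k = ((∑ i, k i : ℕ) : K) * f k := by
  induction f using Finsupp.induction_linear with
  | zero => simp
  | add f g hf hg => simp only [map_add, Finsupp.add_apply, hf, hg]; ring
  | single j x =>
    by_cases h : j = k
    · subst h; simp [deg]
    · simp [deg, h]

variable {K}

theorem deg_eq_iff [CharZero K] {ι : Type*} [Fintype ι] (f : (ι → ℕ) →₀ K) (m : ℕ) :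
    deg K ι f = (m : K) • f ↔ ∀ k, f k ≠ 0 → ∑ i, k i = m := by
  constructor
  · intro h k hk
    have := DFunLike.congr_fun h k
    rw [deg_apply, Finsupp.smul_apply, smul_eq_mul] at this
    exact_mod_cast mul_right_cancel₀ hk this
  · intro h
    ext k
    rw [deg_apply, Finsupp.smul_apply, smul_eq_mul]
    by_cases hk : f k = 0
    · simp [hk]
    · rw [h k hk]

/-- The norm of the product basis vector `v_k`. -/
def prodNorm {ι : Type*} [Fintype ι] (lam : ι → ℝ) (k : ι → ℕ) : ℝ := ∏ i, shapNorm (lam i) (k i)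

theorem prodNorm_ne_zero {ι : Type*} [Fintype ι] {lam : ι → ℝ} (h : ∀ i, NotNat (lam i))
    (k : ι → ℕ) : prodNorm lam k ≠ 0 :=
  Finset.prod_ne_zero_iff.2 fun i _ => shapNorm_ne_zero (h i) _

/-- The product of the Shapovalov forms in coordinates. -/
def coordForm {ι : Type*} [Fintype ι] (lam : ι → ℝ) :
    ((ι → ℕ) →₀ ℝ) →ₗ[ℝ] ((ι → ℕ) →₀ ℝ) →ₗ[ℝ] ℝ :=
  Finsupp.lsum ℝ fun k : ι → ℕ =>
    LinearMap.toSpanSingleton ℝ _ ((prodNorm lam k)⁻¹ • Finsupp.lapply k)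

theorem coordForm_single {ι : Type*} [Fintype ι] (lam : ι → ℝ) (k : ι → ℕ) (c : ℝ)
    (g : (ι → ℕ) →₀ ℝ) :
    coordForm lam (Finsupp.single k c) g = c * ((prodNorm lam k)⁻¹ * g k) := by
  simp [coordForm]

theorem coordForm_apply {ι : Type*} [Fintype ι] (lam : ι → ℝ) (f g : (ι → ℕ) →₀ ℝ)
    (s : Finset (ι → ℕ)) (hs : f.support ⊆ s) :
    coordForm lam f g = ∑ k ∈ s, f k * ((prodNorm lam k)⁻¹ * g k) := by
  rw [← Finsupp.sum_of_support_subset f hs (fun k c => c * ((prodNorm lam k)⁻¹ * g k)) (by simp)]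
  simp [coordForm, Finsupp.sum]

theorem coordForm_symm {ι : Type*} [Fintype ι] (lam : ι → ℝ) (f g : (ι → ℕ) →₀ ℝ) :
    coordForm lam f g = coordForm lam g f := by
  classical
  rw [coordForm_apply lam f g _ Finset.subset_union_left,
    coordForm_apply lam g f _ Finset.subset_union_right]
  exact Finset.sum_congr rfl fun k _ => by ring

theorem coordForm_nondeg {ι : Type*} [Fintype ι] {lam : ι → ℝ} (h : ∀ i, NotNat (lam i))
    (f : (ι → ℕ) →₀ ℝ) (hf : ∀ g, coordForm lam f g = 0) : f = 0 := by
  ext k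
  have := hf (Finsupp.single k 1)
  rw [coordForm_symm, coordForm_single, one_mul] at this
  exact (mul_eq_zero.1 this).resolve_left (inv_ne_zero (prodNorm_ne_zero h k))

/-- `(-1)^e` times the form is positive definite on the multiplicity space of degree `m`. -/
def Def {ι : Type*} [Fintype ι] [DecidableEq ι] (e : ℕ) (lam : ι → ℝ) (m : ℕ) : Prop :=
  DefForm e (lower ℝ ι) (deg ℝ ι) (coordForm lam) m

theorem def_reindex {ι κ : Type*} [Fintype ι] [DecidableEq ι] [Fintype κ] [DecidableEq κ]
    (σ : ι ≃ κ) (e : ℕ) (lam : κ → ℝ) (m : ℕ) : Def e (lam ∘ σ) m ↔ Def e lam m := by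
  let φ : ((ι → ℕ) →₀ ℝ) ≃ₗ[ℝ] ((κ → ℕ) →₀ ℝ) :=
    Finsupp.domLCongr (σ.arrowCongr (Equiv.refl ℕ))
  have hφ : ∀ f k, φ f k = f (k ∘ σ) := fun f k => by
    simp [φ, Finsupp.domLCongr, Finsupp.equivMapDomain_apply]
    rfl
  have hφs : ∀ k c, φ (Finsupp.single k c) = Finsupp.single (k ∘ σ.symm) c := fun k c => by
    simp [φ]
    rfl
  refine DefForm.congr φ (fun f => ?_) (fun f => ?_) (fun f g => ?_) e m
  · ext k
    rw [hφ, lower_apply, lower_apply, ← σ.sum_comp]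
    refine Finset.sum_congr rfl fun i _ => ?_
    rw [hφ]
    congr 1
    ext j
    by_cases h : j = i
    · subst h; simp
    · simp [h]
  · ext k
    rw [hφ, deg_apply, deg_apply, hφ, ← σ.sum_comp]
    rfl
  · induction f using Finsupp.induction_linear with
    | zero => simp
    | add f g hf hg => simp only [map_add, LinearMap.add_apply, hf, hg]
    | single k c =>
      rw [hφs, coordForm_single, coordForm_single, hφ, prodNorm, prodNorm, ← σ.prod_comp]
      simp [Function.comp_def]

/-- Splitting off the first factor. -/
def consEquiv (n : ℕ) : ((Fin (n + 1) → ℕ) →₀ K) ≃ₗ[K] (ℕ →₀ (Fin n → ℕ) →₀ K) :=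
  Finsupp.domLCongr (Fin.consEquiv fun _ => ℕ).symm ≪≫ₗ Finsupp.curryLinearEquiv K

theorem consEquiv_apply {n : ℕ} (f : (Fin (n + 1) → ℕ) →₀ K) (j : ℕ) (r : Fin n → ℕ) :
    consEquiv n f j r = f (Fin.cons j r) := by
  simp [consEquiv, Finsupp.equivMapDomain_apply]
  rfl

theorem consEquiv_single {n : ℕ} (k : Fin (n + 1) → ℕ) (c : K) :
    consEquiv n (Finsupp.single k c) = Finsupp.single (k 0) (Finsupp.single (Fin.tail k) c) := by
  ext j r
  rw [consEquiv_apply]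
  by_cases h0 : k 0 = j
  · subst h0
    rw [Finsupp.single_eq_same]
    by_cases h1 : Fin.tail k = r
    · subst h1
      rw [Fin.cons_self_tail, Finsupp.single_eq_same, Finsupp.single_eq_same]
    · rw [Finsupp.single_apply, Finsupp.single_apply, if_neg h1, if_neg]
      exact fun h => h1 (by simpa using congrArg Fin.tail h)
  · rw [Finsupp.single_apply, Finsupp.single_apply, if_neg h0, Finsupp.zero_apply, if_neg]
    rintro rfl
    exact h0 rfl

theorem cons_add_single_zero {n : ℕ} (j : ℕ) (r : Fin n → ℕ) :
    (Fin.cons j r : Fin (n + 1) → ℕ) + Pi.single 0 1 = Fin.cons (j + 1) r := by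
  ext i
  refine Fin.cases ?_ (fun i => ?_) i <;> simp

theorem cons_add_single_succ {n : ℕ} (j : ℕ) (r : Fin n → ℕ) (i : Fin n) :
    (Fin.cons j r : Fin (n + 1) → ℕ) + Pi.single i.succ 1 = Fin.cons j (r + Pi.single i 1) := by
  ext l
  refine Fin.cases ?_ (fun l => ?_) l
  · simp
  · by_cases h : l = i
    · subst h; simp
    · simp [h]

theorem consEquiv_lower {n : ℕ} (f : (Fin (n + 1) → ℕ) →₀ ℝ) :
    consEquiv n (lower ℝ (Fin (n + 1)) f) = tensE (lower ℝ (Fin n)) (consEquiv n f) := by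
  ext j r
  rw [consEquiv_apply, tensE_apply, Finsupp.add_apply, consEquiv_apply, lower_apply, lower_apply,
    Fin.sum_univ_succ, cons_add_single_zero]
  congr 1
  exact Finset.sum_congr rfl fun i _ => by rw [cons_add_single_succ, consEquiv_apply]

theorem consEquiv_deg {n : ℕ} (f : (Fin (n + 1) → ℕ) →₀ ℝ) :
    consEquiv n (deg ℝ (Fin (n + 1)) f) = tensD (deg ℝ (Fin n)) (consEquiv n f) := by
  ext j r
  rw [consEquiv_apply, tensD_apply, Finsupp.add_apply, deg_apply, deg_apply, Finsupp.smul_apply,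
    consEquiv_apply, Fin.sum_univ_succ]
  simp [add_mul]

theorem consEquiv_coordForm {n : ℕ} (lam : Fin (n + 1) → ℝ) (f g : (Fin (n + 1) → ℕ) →₀ ℝ) :
    coordForm lam f g =
      tensB (lam 0) (coordForm (Fin.tail lam)) (consEquiv n f) (consEquiv n g) := by
  induction f using Finsupp.induction_linear with
  | zero => simp
  | add f g hf hg => simp only [map_add, LinearMap.add_apply, hf, hg]
  | single k c =>
    rw [consEquiv_single, tensB_single, coordForm_single, coordForm_single, consEquiv_apply,
      Fin.cons_self_tail, prodNorm, prodNorm, Fin.prod_univ_succ]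
    simp only [Fin.tail, mul_inv]
    ring

/-- The factors are added one at a time, starting from the empty product, a trivial line.
Nondegeneracy on singular vectors only requires that some `F` exist. -/
theorem exists_isSl2 {n : ℕ} (lam : Fin n → ℝ) (h : ∀ i, NotNat (lam i)) :
    ∃ F, IsSl2 (lower ℝ (Fin n)) F (deg ℝ (Fin n)) (coordForm lam) (∑ i, lam i) := by
  induction n with
  | zero =>
    refine ⟨0, ?_⟩
    have h1 : lower ℝ (Fin 0) = 0 := by simp [lower]
    have h2 : deg ℝ (Fin 0) = 0 := by
      ext k
      simp [deg_apply]
    rw [h1, h2]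
    simpa using isSl2_trivial (coordForm_symm lam) (coordForm_nondeg h)
  | succ n ih =>
    obtain ⟨F, hF⟩ := ih (Fin.tail lam) fun i => h _
    have := (hF.tens (h 0)).congr (consEquiv n) consEquiv_lower consEquiv_deg
      (consEquiv_coordForm lam)
    rw [Fin.sum_univ_succ]
    exact ⟨_, this⟩

theorem deg_nonneg {ι : Type*} [Fintype ι] (f : (ι → ℕ) →₀ ℝ) (c : ℝ) (hc : c < 0)
    (h : deg ℝ ι f = c • f) : f = 0 := by
  ext k
  have := DFunLike.congr_fun h k
  rw [deg_apply, Finsupp.smul_apply, smul_eq_mul] at this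
  by_contra hk
  have h1 := mul_right_cancel₀ hk this
  have : (0 : ℝ) ≤ ((∑ i, k i : ℕ) : ℝ) := Nat.cast_nonneg _
  linarith

theorem def_cons_iff {n : ℕ} (e : ℕ) (lam : Fin (n + 1) → ℝ) (m : ℕ) :
    Def e lam m ↔ DefForm e (tensE (lower ℝ (Fin n))) (tensD (deg ℝ (Fin n)))
      (tensB (lam 0) (coordForm (Fin.tail lam))) m :=
  DefForm.congr (consEquiv n) consEquiv_lower consEquiv_deg (consEquiv_coordForm lam) e m

theorem tensE_mapRange {X Y : Type*} [AddCommGroup X] [Module ℝ X] [AddCommGroup Y] [Module ℝ Y]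
    {E : Module.End ℝ X} {E' : Module.End ℝ Y} (φ : X ≃ₗ[ℝ] Y) (h : ∀ x, φ (E x) = E' (φ x))
    (y : ℕ →₀ X) : Finsupp.mapRange.linearEquiv φ (tensE E y) =
      tensE E' (Finsupp.mapRange.linearEquiv φ y) := by
  ext k
  simp [tensE_apply, h]

theorem tensD_mapRange {X Y : Type*} [AddCommGroup X] [Module ℝ X] [AddCommGroup Y] [Module ℝ Y]
    {D : Module.End ℝ X} {D' : Module.End ℝ Y} (φ : X ≃ₗ[ℝ] Y) (h : ∀ x, φ (D x) = D' (φ x))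
    (y : ℕ →₀ X) : Finsupp.mapRange.linearEquiv φ (tensD D y) =
      tensD D' (Finsupp.mapRange.linearEquiv φ y) := by
  ext k
  simp [tensD_apply, h]

theorem tensB_mapRange {X Y : Type*} [AddCommGroup X] [Module ℝ X] [AddCommGroup Y] [Module ℝ Y]
    {B : X →ₗ[ℝ] X →ₗ[ℝ] ℝ} {B' : Y →ₗ[ℝ] Y →ₗ[ℝ] ℝ} (φ : X ≃ₗ[ℝ] Y)
    (h : ∀ x y, B x y = B' (φ x) (φ y)) (a : ℝ) (x y : ℕ →₀ X) :
    tensB a B x y = tensB a B' (Finsupp.mapRange.linearEquiv φ x)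
      (Finsupp.mapRange.linearEquiv φ y) := by
  induction x using Finsupp.induction_linear with
  | zero => simp
  | add f g hf hg => simp only [map_add, LinearMap.add_apply, hf, hg]
  | single k c => simp [tensB_single, h]

theorem def_cons_cons_iff {n : ℕ} (e : ℕ) (lam : Fin (n + 2) → ℝ) (m : ℕ) :
    Def e lam m ↔ DefForm e (tensE (tensE (lower ℝ (Fin n)))) (tensD (tensD (deg ℝ (Fin n))))
      (tensB (lam 0) (tensB (lam 1) (coordForm (Fin.tail (Fin.tail lam))))) m := by
  rw [def_cons_iff]
  have h1 := tensE_mapRange (X := (Fin (n + 1) → ℕ) →₀ ℝ) (Y := ℕ →₀ (Fin n → ℕ) →₀ ℝ)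
    (E := lower ℝ (Fin (n + 1))) (E' := tensE (lower ℝ (Fin n))) (consEquiv n) consEquiv_lower
  have h2 := tensD_mapRange (X := (Fin (n + 1) → ℕ) →₀ ℝ) (Y := ℕ →₀ (Fin n → ℕ) →₀ ℝ)
    (D := deg ℝ (Fin (n + 1))) (D' := tensD (deg ℝ (Fin n))) (consEquiv n) consEquiv_deg
  have h3 := tensB_mapRange (X := (Fin (n + 1) → ℕ) →₀ ℝ) (Y := ℕ →₀ (Fin n → ℕ) →₀ ℝ)
    (consEquiv n) (consEquiv_coordForm (Fin.tail lam)) (lam 0)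
  exact DefForm.congr _ h1 h2 h3 e m

/-- Fusion of the first two factors. -/
theorem def_fuse {n : ℕ} (e m : ℕ) {a b : ℝ} (lam : Fin n → ℝ) (ha : NotNat a) (hb : NotNat b)
    (hab : NotNat (a + b)) (h : ∀ i, NotNat (lam i)) :
    Def e (Fin.cons a (Fin.cons b lam : Fin (n + 1) → ℝ) : Fin (n + 2) → ℝ) m ↔
      ∀ k ≤ m, Def (e + fuseExp ⌈a⌉₊ ⌈b⌉₊ ⌈a + b⌉₊ k)
        (Fin.cons (a + b - 2 * k) lam : Fin (n + 1) → ℝ) (m - k) := by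
  have h1 := def_cons_cons_iff e (Fin.cons a (Fin.cons b lam : Fin (n + 1) → ℝ)) m
  have h2 := defForm_fuse (E := lower ℝ (Fin n)) (coordForm_symm lam) (coordForm_nondeg h) ha hb hab
    deg_nonneg e m
  have h3 := fun k => def_cons_iff (e + fuseExp ⌈a⌉₊ ⌈b⌉₊ ⌈a + b⌉₊ k)
    (Fin.cons (a + b - 2 * (k : ℝ)) lam : Fin (n + 1) → ℝ) (m - k)
  refine h1.trans (h2.trans ?_)
  exact forall_congr' fun k => imp_congr_right fun _ => (h3 k).symm

end Coordinates

/-! ### Definiteness depends only on the ceilings of the highest weights -/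

/-- Positivity at time `t` is a condition on the unit sphere. The set of such `t` is open because
the sphere is compact, and closed because a positive semidefinite nondegenerate form is positive
definite. As `[0, 1]` is connected, the set is everything. -/
theorem posDef_of_path {V ι : Type*} [NormedAddCommGroup V] [NormedSpace ℝ V]
    [FiniteDimensional ℝ V] (s : Finset ι) (l : ι → V →ₗ[ℝ] ℝ) (w : unitInterval → ι → ℝ)
    (hw : ∀ k ∈ s, Continuous fun t => w t k)
    (hnd : ∀ t x, (∀ y, ∑ k ∈ s, w t k * (l k x * l k y) = 0) → x = 0)
    (h0 : ∀ x, x ≠ 0 → 0 < ∑ k ∈ s, w 0 k * (l k x * l k x)) (x : V) (hx : x ≠ 0) :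
    0 < ∑ k ∈ s, w 1 k * (l k x * l k x) := by
  have : ProperSpace V := FiniteDimensional.proper ℝ V
  have hl : ∀ k, Continuous (l k) := fun k => LinearMap.continuous_of_finiteDimensional _
  let Q : unitInterval → V → ℝ := fun t x => ∑ k ∈ s, w t k * (l k x * l k x)
  have hQ : Continuous fun p : unitInterval × Metric.sphere (0 : V) 1 => Q p.1 p.2 := by
    refine continuous_finsetSum _ fun k hk => ?_
    have h1 := (hw k hk).comp (continuous_fst (Y := Metric.sphere (0 : V) 1))
    have h2 := (hl k).comp (continuous_subtype_val.comp
      (continuous_snd (X := unitInterval) (Y := Metric.sphere (0 : V) 1)))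
    exact h1.mul (h2.mul h2)
  have hscale : ∀ t (x : V), x ≠ 0 → ∃ y : Metric.sphere (0 : V) 1, ∃ c : ℝ, 0 < c ∧
      Q t x = c * Q t y := by
    intro t x hx
    have hn : 0 < ‖x‖ := norm_pos_iff.2 hx
    refine ⟨⟨‖x‖⁻¹ • x, ?_⟩, ‖x‖ ^ 2, by positivity, ?_⟩
    · simp [norm_smul, hn.ne']
    · simp only [Q, map_smul, smul_eq_mul, Finset.mul_sum]
      refine Finset.sum_congr rfl fun k _ => ?_
      field_simp
  let T : Set unitInterval := {t | ∀ x : Metric.sphere (0 : V) 1, 0 < Q t x}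
  have hopen : IsOpen T := by
    have hc : IsClosed {p : unitInterval × Metric.sphere (0 : V) 1 | Q p.1 p.2 ≤ 0} :=
      isClosed_le hQ continuous_const
    -- The complement of `T` is the projection of a closed set along the compact sphere.
    have := isClosedMap_fst_of_compactSpace _ hc
    rw [← isClosed_compl_iff]
    convert this using 1
    ext t
    simp [T]
  have hT : T = {t | ∀ x : Metric.sphere (0 : V) 1, 0 ≤ Q t x} := by
    ext t
    refine ⟨fun h x => (h x).le, fun h x => lt_of_le_of_ne (h x) fun hzero => ?_⟩
    have hnn : ∀ y : V, 0 ≤ Q t y := by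
      intro y
      by_cases hy : y = 0
      · simp [hy, Q]
      · obtain ⟨z, c, hc, hz⟩ := hscale t y hy
        rw [hz]
        exact mul_nonneg hc.le (h z)
    have hx0 : (x : V) = 0 := by
      refine hnd t _ fun y => ?_
      -- If `Q t x = 0`, nonnegativity of `Q t (x + r y)` for every real `r` forces the linear
      -- coefficient to vanish, by the discriminant. So `x` lies in the radical.
      have key : ∀ r : ℝ, 0 ≤ Q t y * (r * r) +
          (2 * ∑ k ∈ s, w t k * (l k x * l k y)) * r + 0 := by
        intro r
        have h1 := hnn (x + r • y)
        have h2 : Q t (x + r • y) = Q t x + (Q t y * (r * r) +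
            (2 * ∑ k ∈ s, w t k * (l k x * l k y)) * r) := by
          simp only [Q, Finset.mul_sum, Finset.sum_mul, ← Finset.sum_add_distrib, map_add,
            map_smul, smul_eq_mul]
          exact Finset.sum_congr rfl fun k _ => by ring
        rw [h2, ← hzero] at h1
        linarith
      have h3 := discrim_le_zero key
      rw [discrim] at h3
      nlinarith [sq_nonneg (2 * ∑ k ∈ s, w t k * (l k x * l k y))]
    have h4 := x.2
    rw [hx0] at h4
    simp at h4
  have hclosed : IsClosed T := by
    rw [hT, Set.ofPred_forall]
    exact isClosed_iInter fun x => isClosed_le continuous_const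
      (hQ.comp (continuous_id.prodMk continuous_const))
  have hne : T.Nonempty := ⟨0, fun x => h0 _ fun h => by
    have h4 := x.2
    rw [h] at h4
    simp at h4⟩
  have huniv : T = Set.univ := IsClopen.eq_univ ⟨hclosed, hopen⟩ hne
  have h1 : (1 : unitInterval) ∈ T := huniv ▸ Set.mem_univ _
  obtain ⟨y, c, hc, hy⟩ := hscale 1 x hx
  change 0 < Q 1 x
  rw [hy]
  exact mul_pos hc (h1 y)

theorem mem_levelSet {ι : Type*} [Fintype ι] [DecidableEq ι] {m : ℕ} {k : ι → ℕ} :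
    k ∈ Finset.piAntidiag Finset.univ m ↔ ∑ i, k i = m := by
  simp [Finset.mem_piAntidiag]

theorem support_subset_levelSet {ι : Type*} [Fintype ι] [DecidableEq ι] {K : Type*} [Field K]
    [CharZero K] {m : ℕ} {f : (ι → ℕ) →₀ K} (hf : deg K ι f = (m : K) • f) :
    f.support ⊆ Finset.piAntidiag Finset.univ m := fun k hk =>
  mem_levelSet.2 ((deg_eq_iff f m).1 hf k (Finsupp.mem_support_iff.1 hk))

theorem finiteDimensional_level {ι : Type*} [Fintype ι] (m : ℕ) :
    FiniteDimensional ℝ (LinearMap.ker (deg ℝ ι - (m : ℝ) • LinearMap.id)) := by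
  classical
  have h1 : FiniteDimensional ℝ (Finsupp.supported ℝ ℝ
      (↑(Finset.piAntidiag (Finset.univ : Finset ι) m) : Set (ι → ℕ))) :=
    Module.Finite.equiv (Finsupp.supportedEquivFinsupp (R := ℝ) (M := ℝ) _).symm
  refine Submodule.finiteDimensional_of_le (S₂ := Finsupp.supported ℝ ℝ
    (↑(Finset.piAntidiag (Finset.univ : Finset ι) m) : Set (ι → ℕ))) fun f hf => ?_
  rw [Finsupp.mem_supported]
  exact_mod_cast support_subset_levelSet (by simpa [sub_eq_zero] using hf)

/-- By `IsSl2.singular_nondeg` orthogonality extends to all vectors of degree `m`. Testing against a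
basis vector then kills each coordinate. -/
theorem coordForm_singular_nondeg {n : ℕ} {lam : Fin n → ℝ} (h : ∀ i, NotNat (lam i))
    (hsum : NotNat (∑ i, lam i)) {m : ℕ} {f : (Fin n → ℕ) →₀ ℝ} (h1 : lower ℝ (Fin n) f = 0)
    (h2 : deg ℝ (Fin n) f = (m : ℝ) • f)
    (hf : ∀ g, lower ℝ (Fin n) g = 0 → deg ℝ (Fin n) g = (m : ℝ) • g → coordForm lam f g = 0) :
    f = 0 := by
  obtain ⟨F, hF⟩ := exists_isSl2 lam h
  have key := hF.singular_nondeg hsum finiteDimensional_level h1 hf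
  ext k
  by_contra hk
  have hkm := (deg_eq_iff f m).1 h2 k hk
  have := key (Finsupp.single k 1) ((deg_eq_iff _ m).2 fun l hl => by
    rcases eq_or_ne k l with rfl | hne
    · exact hkm
    · simp [hne] at hl)
  rw [coordForm_symm, coordForm_single, one_mul] at this
  exact hk ((mul_eq_zero.1 this).resolve_left (inv_ne_zero (prodNorm_ne_zero h k)))

/-- The space `W` of singular vectors is the same for all weights; only the coefficients `1 /
prodNorm` move. They are continuous since no individual weight crosses a nonnegative integer, and
the form stays nondegenerate on `W` since the sum does not either. -/
theorem def_of_path {n : ℕ} {e m : ℕ} {lam lam' : Fin n → ℝ}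
    (h : ∀ (t : unitInterval) i, NotNat ((1 - t) * lam i + t * lam' i))
    (hsum : ∀ t : unitInterval, NotNat (∑ i, ((1 - t) * lam i + t * lam' i)))
    (hdef : Def e lam m) : Def e lam' m := by
  let L : unitInterval → Fin n → ℝ := fun t i => (1 - t) * lam i + t * lam' i
  let W : Submodule ℝ ((Fin n → ℕ) →₀ ℝ) :=
    LinearMap.ker (lower ℝ (Fin n)) ⊓ LinearMap.ker (deg ℝ (Fin n) - (m : ℝ) • LinearMap.id)
  have hW : ∀ f, f ∈ W ↔ lower ℝ (Fin n) f = 0 ∧ deg ℝ (Fin n) f = (m : ℝ) • f := fun f => by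
    simp [W, sub_eq_zero]
  have hfd : FiniteDimensional ℝ W := by
    have := finiteDimensional_level (ι := Fin n) m
    exact Submodule.finiteDimensional_of_le inf_le_right
  have hfree : Module.Free ℝ W := Module.Free.of_divisionRing ℝ W
  let ψ := (Module.finBasis ℝ W).equivFun
  let l : (Fin n → ℕ) → (Fin (Module.finrank ℝ W) → ℝ) →ₗ[ℝ] ℝ := fun k =>
    Finsupp.lapply k ∘ₗ W.subtype ∘ₗ ψ.symm.toLinearMap
  let s : Finset (Fin n → ℕ) := Finset.piAntidiag Finset.univ m
  let w : unitInterval → (Fin n → ℕ) → ℝ := fun t k => (-1) ^ e * (prodNorm (L t) k)⁻¹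
  have hform : ∀ t x y, ∑ k ∈ s, w t k * (l k x * l k y) =
      (-1) ^ e * coordForm (L t) (ψ.symm x : W) (ψ.symm y : W) := by
    intro t x y
    rw [coordForm_apply (L t) _ _ s
      (support_subset_levelSet ((hW _).1 (ψ.symm x).2).2), Finset.mul_sum]
    refine Finset.sum_congr rfl fun k _ => ?_
    simp only [w, l, LinearMap.comp_apply, Finsupp.lapply_apply, Submodule.subtype_apply,
      LinearEquiv.coe_coe]
    ring
  have hne : ∀ x, x ≠ 0 → ((ψ.symm x : W) : (Fin n → ℕ) →₀ ℝ) ≠ 0 := fun x hx => by simpa using hx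
  have hL0 : L 0 = lam := by ext i; simp [L]
  have hL1 : L 1 = lam' := by ext i; simp [L]
  intro f h1 h2 h3
  have key := posDef_of_path s l w (fun k _ => by
      refine continuous_const.mul (Continuous.inv₀ ?_ fun t => prodNorm_ne_zero (h t) k)
      refine continuous_finsetProd _ fun i _ => continuous_finsetProd _ fun j _ => ?_
      fun_prop)
    (fun t x hx => by
      have : ((ψ.symm x : W) : (Fin n → ℕ) →₀ ℝ) = 0 := by
        obtain ⟨ha, hb⟩ := (hW _).1 (ψ.symm x).2
        refine coordForm_singular_nondeg (h t) (hsum t) ha hb fun g hg1 hg2 => ?_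
        have := hx (ψ ⟨g, (hW g).2 ⟨hg1, hg2⟩⟩)
        rw [hform, LinearEquiv.symm_apply_apply] at this
        exact (mul_eq_zero.1 this).resolve_left (pow_ne_zero _ (by norm_num))
      simpa using this)
    (fun x hx => by
      rw [hform, hL0]
      obtain ⟨ha, hb⟩ := (hW _).1 (ψ.symm x).2
      exact hdef _ ha hb (hne x hx)) (ψ ⟨f, (hW f).2 ⟨h1, h2⟩⟩) (by simpa using h3)
  rwa [hform, hL1, LinearEquiv.symm_apply_apply] at key

/-- `x` is not a nonnegative integer and `c` is its ceiling, replaced by `0` if `x < 0`. -/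
def HasCeil (x : ℝ) (c : ℕ) : Prop := x < c ∧ (c = 0 ∨ (c : ℝ) - 1 < x)

theorem hasCeil_iff {x : ℝ} {c : ℕ} : HasCeil x c ↔ NotNat x ∧ ⌈x⌉₊ = c := by
  constructor
  · rintro ⟨h1, rfl | h2⟩
    · have h3 : x < 0 := by simpa using h1
      exact ⟨NotNat.of_neg h3, Nat.ceil_eq_zero.2 h3.le⟩
    · rcases Nat.eq_zero_or_pos c with rfl | hc
      · have h3 : x < 0 := by simpa using h1
        exact ⟨NotNat.of_neg h3, Nat.ceil_eq_zero.2 h3.le⟩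
      · refine ⟨fun k hk => ?_, ?_⟩
        · rw [hk] at h1 h2
          have h3 : k < c := by exact_mod_cast h1
          have h4 : c < k + 1 := by
            have : (c : ℝ) < k + 1 := by linarith
            exact_mod_cast this
          omega
        · rw [Nat.ceil_eq_iff hc.ne']
          refine ⟨?_, h1.le⟩
          rw [Nat.cast_sub hc]
          simpa using h2
  · rintro ⟨h1, rfl⟩
    refine ⟨lt_of_le_of_ne (Nat.le_ceil x) (h1 _), ?_⟩
    by_cases h : ⌈x⌉₊ = 0
    · exact Or.inl h
    · right
      have hc : 1 ≤ ⌈x⌉₊ := by omega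
      have := ((Nat.ceil_eq_iff h).1 rfl).1
      rw [Nat.cast_sub hc] at this
      simpa using this

theorem HasCeil.notNat {x : ℝ} {c : ℕ} (h : HasCeil x c) : NotNat x := (hasCeil_iff.1 h).1

theorem HasCeil.ceil_eq {x : ℝ} {c : ℕ} (h : HasCeil x c) : ⌈x⌉₊ = c := (hasCeil_iff.1 h).2

theorem NotNat.hasCeil {x : ℝ} (h : NotNat x) : HasCeil x ⌈x⌉₊ := hasCeil_iff.2 ⟨h, rfl⟩

/-- `HasCeil` is phrased by strict linear inequalities, so that it describes an interval and the
straight segment is an admissible path. -/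
theorem HasCeil.convex {x y : ℝ} {c : ℕ} (hx : HasCeil x c) (hy : HasCeil y c) (t : unitInterval) :
    HasCeil ((1 - t) * x + t * y) c := by
  obtain ⟨hx1, hx2⟩ := hx
  obtain ⟨hy1, hy2⟩ := hy
  have h0 : (0 : ℝ) ≤ t := t.2.1
  have h1 : (t : ℝ) ≤ 1 := t.2.2
  have key : ∀ u v : ℝ, 0 < u → 0 < v → 0 < (1 - t) * u + t * v := by
    intro u v hu hv
    rcases h0.eq_or_lt with h | h
    · rw [← h]; simpa using hu
    · have := mul_pos h hv
      have := mul_nonneg (sub_nonneg.2 h1) hu.le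
      linarith
  refine ⟨?_, ?_⟩
  · have := key _ _ (sub_pos.2 hx1) (sub_pos.2 hy1)
    linarith
  · by_cases hc : c = 0
    · exact Or.inl hc
    · have := key _ _ (sub_pos.2 (hx2.resolve_left hc)) (sub_pos.2 (hy2.resolve_left hc))
      right
      linarith

theorem def_of_hasCeil {n : ℕ} {e m : ℕ} {lam lam' : Fin n → ℝ} {c : Fin n → ℕ} {N : ℕ}
    (h : ∀ i, HasCeil (lam i) (c i)) (hs : HasCeil (∑ i, lam i) N)
    (h' : ∀ i, HasCeil (lam' i) (c i)) (hs' : HasCeil (∑ i, lam' i) N) (hdef : Def e lam m) :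
    Def e lam' m := by
  refine def_of_path (fun t i => ((h i).convex (h' i) t).notNat) (fun t => ?_) hdef
  rw [Finset.sum_add_distrib, ← Finset.mul_sum, ← Finset.mul_sum]
  exact (hs.convex hs' t).notNat

/-! ### Multiplicity spaces in coordinates -/

section Hom

variable {V : Type*} [AddCommGroup V] [Module ℂ V]

/-- The singular vectors of weight `μ`. -/
def Rep.singular (N : Rep V) (μ : ℝ) : Submodule ℂ V :=
  LinearMap.ker N.E ⊓ LinearMap.ker (N.H - (μ : ℂ) • LinearMap.id)

theorem Rep.mem_singular {N : Rep V} {μ : ℝ} {x : V} :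
    x ∈ N.singular μ ↔ N.E x = 0 ∧ N.H x = (μ : ℂ) • x := by
  simp [Rep.singular, sub_eq_zero]

theorem Rep.H_F_pow (N : Rep V) {μ : ℝ} {x : V} (hx : x ∈ N.singular μ) (k : ℕ) :
    N.H ((N.F ^ k) x) = ((μ : ℂ) - 2 * k) • (N.F ^ k) x := by
  induction k with
  | zero => simpa using (Rep.mem_singular.1 hx).2
  | succ k ih =>
    have h := LinearMap.congr_fun N.lie_H_F ((N.F ^ k) x)
    simp only [LinearMap.sub_apply, Module.End.mul_apply, LinearMap.smul_apply, ih, map_smul] at h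
    rw [pow_succ', Module.End.mul_apply, sub_eq_iff_eq_add.1 h]
    push_cast
    module

theorem Rep.E_F_pow (N : Rep V) {μ : ℝ} {x : V} (hx : x ∈ N.singular μ) (k : ℕ) :
    N.E ((N.F ^ (k + 1)) x) = (((k : ℂ) + 1) * (μ - k)) • (N.F ^ k) x := by
  have hEF : ∀ y, N.E (N.F y) = N.F (N.E y) + N.H y := fun y => by
    have h := LinearMap.congr_fun N.lie_E_F y
    simp only [LinearMap.sub_apply, Module.End.mul_apply] at h
    rw [← h]
    abel
  induction k with
  | zero =>
    obtain ⟨h1, h2⟩ := Rep.mem_singular.1 hx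
    simp [hEF, h1, h2]
  | succ k ih =>
    rw [pow_succ', Module.End.mul_apply, hEF, ih, map_smul, N.H_F_pow hx, ← Module.End.mul_apply,
      ← pow_succ']
    push_cast
    module

theorem apply_vermaBasis {N : Rep V} {μ : ℝ} (φ : Rep.hom (verma μ) N) (k : ℕ) :
    φ.1 (vermaBasis k) = (N.F ^ k) (φ.1 (vermaBasis 0)) := by
  induction k with
  | zero => simp
  | succ k ih => rw [← verma_F μ, φ.2.2.1, ih, pow_succ', Module.End.mul_apply]

/-- Homomorphisms from a Verma module are singular vectors. -/
def homEquiv (N : Rep V) (μ : ℝ) : Rep.hom (verma μ) N ≃ₗ[ℂ] N.singular μ where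
  toFun φ := ⟨φ.1 (vermaBasis 0), Rep.mem_singular.2 ⟨by
    rw [← φ.2.1, verma_E]; simp, by
    rw [← φ.2.2.2, verma_H, map_smul]; simp⟩⟩
  map_add' φ ψ := rfl
  map_smul' c φ := rfl
  invFun x := ⟨vermaBasis.constr ℂ fun k => (N.F ^ k) x.1, by
    have hb : ∀ k, (vermaBasis.constr ℂ fun k => (N.F ^ k) x.1) (vermaBasis k) = (N.F ^ k) x.1 :=
      fun k => Module.Basis.constr_basis ..
    refine ⟨fun y => ?_, fun y => ?_, fun y => ?_⟩
    · refine LinearMap.congr_fun (f := (vermaBasis.constr ℂ fun k => (N.F ^ k) x.1) ∘ₗ (verma μ).E)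
        (g := N.E ∘ₗ (vermaBasis.constr ℂ fun k => (N.F ^ k) x.1)) (vermaBasis.ext fun k => ?_) y
      rw [LinearMap.comp_apply, LinearMap.comp_apply, verma_E, map_smul, hb, hb]
      rcases k with _ | k
      · simpa using (Rep.mem_singular.1 x.2).1.symm
      · rw [N.E_F_pow x.2]
        simp only [Nat.add_sub_cancel]
        congr 1
        push_cast
        ring
    · refine LinearMap.congr_fun (f := (vermaBasis.constr ℂ fun k => (N.F ^ k) x.1) ∘ₗ (verma μ).F)
        (g := N.F ∘ₗ (vermaBasis.constr ℂ fun k => (N.F ^ k) x.1)) (vermaBasis.ext fun k => ?_) y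
      rw [LinearMap.comp_apply, LinearMap.comp_apply, verma_F, hb, hb, pow_succ',
        Module.End.mul_apply]
    · refine LinearMap.congr_fun (f := (vermaBasis.constr ℂ fun k => (N.F ^ k) x.1) ∘ₗ (verma μ).H)
        (g := N.H ∘ₗ (vermaBasis.constr ℂ fun k => (N.F ^ k) x.1)) (vermaBasis.ext fun k => ?_) y
      rw [LinearMap.comp_apply, LinearMap.comp_apply, verma_H, map_smul, hb, N.H_F_pow x.2]⟩
  left_inv φ := by
    refine Subtype.ext (vermaBasis.ext fun k => ?_)
    rw [apply_vermaBasis φ]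
    exact Module.Basis.constr_basis ..
  right_inv x := by
    refine Subtype.ext ?_
    change (vermaBasis.constr ℂ fun k => (N.F ^ k) x.1) (vermaBasis 0) = x.1
    rw [Module.Basis.constr_basis]
    simp

end Hom

section Coord

variable {n : ℕ}

/-- The product basis `v_k`. -/
abbrev prodBasis (n : ℕ) : Module.Basis (Fin n → ℕ) ℂ (⨂[ℂ] _ : Fin n, (ℕ →₀ ℂ)) :=
  Basis.piTensorProduct fun _ : Fin n => vermaBasis

theorem prodNorm_add_single (lam : Fin n → ℝ) (k : Fin n → ℕ) (i : Fin n) :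
    prodNorm lam (k + Pi.single i 1) = prodNorm lam k * (((k i : ℝ) + 1) * (lam i - k i)) := by
  rw [prodNorm, prodNorm, ← Finset.mul_prod_erase _ _ (Finset.mem_univ i),
    ← Finset.mul_prod_erase _ _ (Finset.mem_univ i)]
  have : ∏ j ∈ Finset.univ.erase i, shapNorm (lam j) ((k + Pi.single i 1 : Fin n → ℕ) j) =
      ∏ j ∈ Finset.univ.erase i, shapNorm (lam j) (k j) :=
    Finset.prod_congr rfl fun j hj => by simp [Finset.ne_of_mem_erase hj]
  rw [this]
  simp only [Pi.add_apply, Pi.single_eq_same, shapNorm_succ]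
  ring

/-- The product basis `u_k = v_k / (v_k, v_k)`. -/
def dualBasis {lam : Fin n → ℝ} (h : ∀ i, NotNat (lam i)) :
    Module.Basis (Fin n → ℕ) ℂ (⨂[ℂ] _ : Fin n, (ℕ →₀ ℂ)) :=
  (prodBasis n).isUnitSMul (w := fun k => ((prodNorm lam k : ℂ))⁻¹) fun k =>
    (inv_ne_zero (Complex.ofReal_ne_zero.2 (prodNorm_ne_zero h k))).isUnit

variable {lam : Fin n → ℝ} (h : ∀ i, NotNat (lam i))

theorem dualBasis_apply (k : Fin n → ℕ) :
    dualBasis h k = ((prodNorm lam k : ℂ))⁻¹ • prodBasis n k :=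
  Module.Basis.isUnitSMul_apply _ _

theorem prodBasis_eq (k : Fin n → ℕ) :
    prodBasis n k = (prodNorm lam k : ℂ) • dualBasis h k := by
  rw [dualBasis_apply, smul_smul, mul_inv_cancel₀ (Complex.ofReal_ne_zero.2 (prodNorm_ne_zero h k)),
    one_smul]

theorem prodBasis_repr (x : ⨂[ℂ] _ : Fin n, (ℕ →₀ ℂ)) (k : Fin n → ℕ) :
    (prodBasis n).repr x k = (prodNorm lam k : ℂ)⁻¹ * (dualBasis h).repr x k := by
  have : (Finsupp.lapply k ∘ₗ (prodBasis n).repr.toLinearMap) =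
      (prodNorm lam k : ℂ)⁻¹ • (Finsupp.lapply k ∘ₗ (dualBasis h).repr.toLinearMap) := by
    refine (dualBasis h).ext fun l => ?_
    simp only [LinearMap.comp_apply, LinearMap.smul_apply, LinearEquiv.coe_coe,
      Finsupp.lapply_apply, Module.Basis.repr_self]
    rw [dualBasis_apply, map_smul, Module.Basis.repr_self]
    by_cases hkl : l = k
    · subst hkl; simp
    · simp [hkl]
  exact LinearMap.congr_fun this x

/-- The coefficient `k (μ - k + 1)` of `E` is exactly the ratio of consecutive norms, so the
normalization of the basis absorbs it. Hence `E` becomes the weight-independent operator `lower`. -/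
theorem atFactor_E_dualBasis (i : Fin n) (k : Fin n → ℕ) :
    (dualBasis h).repr (atFactor i (verma (lam i)).E (dualBasis h k)) =
      Finsupp.lcomapDomain (R := ℂ) (fun k : Fin n → ℕ => k + Pi.single i 1)
        (add_left_injective _) (Finsupp.single k 1) := by
  have hcomap : ∀ l, Finsupp.lcomapDomain (R := ℂ) (fun k : Fin n → ℕ => k + Pi.single i 1)
        (add_left_injective _) (Finsupp.single k (1 : ℂ)) l =
        (Finsupp.single k (1 : ℂ) : (Fin n → ℕ) →₀ ℂ) (l + Pi.single i 1) := fun l => rfl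
  have hE : atFactor i (verma (lam i)).E (prodBasis n k) =
      ((k i : ℂ) * (lam i - k i + 1)) • prodBasis n (k - Pi.single i 1) := by
    rw [Basis.piTensorProduct_apply, Basis.piTensorProduct_apply, atFactor_tprod, verma_E,
      MultilinearMap.map_update_smul]
    congr 2
    ext1 j
    by_cases hj : j = i
    · subst hj; simp
    · simp [hj]
  rw [dualBasis_apply, map_smul, hE]
  ext l
  rw [hcomap]
  -- At `k i = 0` the truncated index on the left is harmless because its coefficient is zero, and
  -- on the right `k` is not of the form `l + Pi.single i 1`.
  by_cases hk : k i = 0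
  · rw [hk]
    have : k ≠ l + Pi.single i 1 := by
      rintro rfl
      simp at hk
    rw [Finsupp.single_apply, if_neg this]
    simp
  · obtain ⟨k', rfl⟩ : ∃ k', k = k' + Pi.single i 1 := ⟨k - Pi.single i 1, by
      ext j
      by_cases hj : j = i
      · subst hj; simp; omega
      · simp [hj]⟩
    have hne := Complex.ofReal_ne_zero.2 (prodNorm_ne_zero h (k' + Pi.single i 1))
    rw [add_tsub_cancel_right, prodBasis_eq h, smul_smul, smul_smul, map_smul,
      Module.Basis.repr_self]
    have hc : ((prodNorm lam (k' + Pi.single i 1) : ℂ))⁻¹ *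
        (((k' + Pi.single i 1 : Fin n → ℕ) i : ℂ) *
          (lam i - ((k' + Pi.single i 1 : Fin n → ℕ) i : ℂ) + 1)) * prodNorm lam k' = 1 := by
      rw [mul_assoc, inv_mul_eq_iff_eq_mul₀ hne, prodNorm_add_single]
      simp only [Pi.add_apply, Pi.single_eq_same]
      push_cast
      ring
    rw [hc, one_smul, Finsupp.single_apply, Finsupp.single_apply]
    simp

theorem dualBasis_repr_E (x : ⨂[ℂ] _ : Fin n, (ℕ →₀ ℂ)) :
    (dualBasis h).repr ((vermaTensor lam).E x) = lower ℂ (Fin n) ((dualBasis h).repr x) := by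
  refine LinearMap.congr_fun (f := (dualBasis h).repr.toLinearMap ∘ₗ (vermaTensor lam).E)
    (g := lower ℂ (Fin n) ∘ₗ (dualBasis h).repr.toLinearMap)
    ((dualBasis h).ext fun k => ?_) x
  simp only [LinearMap.comp_apply, LinearEquiv.coe_coe, Module.Basis.repr_self]
  simp only [vermaTensor, tensorRep, lower, LinearMap.sum_apply, map_sum, atFactor_E_dualBasis]

theorem dualBasis_repr_H (x : ⨂[ℂ] _ : Fin n, (ℕ →₀ ℂ)) :
    (dualBasis h).repr ((vermaTensor lam).H x) =
      ((∑ i, lam i : ℝ) : ℂ) • (dualBasis h).repr x -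
        (2 : ℂ) • deg ℂ (Fin n) ((dualBasis h).repr x) := by
  refine LinearMap.congr_fun (f := (dualBasis h).repr.toLinearMap ∘ₗ (vermaTensor lam).H)
    (g := ((∑ i, lam i : ℝ) : ℂ) • (dualBasis h).repr.toLinearMap - (2 : ℂ) •
      deg ℂ (Fin n) ∘ₗ (dualBasis h).repr.toLinearMap) ((dualBasis h).ext fun k => ?_) x
  have hH : (vermaTensor lam).H (prodBasis n k) =
      ((∑ i, lam i : ℝ) - 2 * ((∑ i, k i : ℕ) : ℂ)) • prodBasis n k := by
    simp only [vermaTensor, tensorRep, LinearMap.sum_apply, Basis.piTensorProduct_apply,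
      atFactor_tprod, verma_H, MultilinearMap.map_update_smul, Function.update_eq_self]
    rw [← Finset.sum_smul, Finset.sum_sub_distrib, ← Finset.mul_sum]
    push_cast
    rfl
  simp only [LinearMap.comp_apply, LinearMap.sub_apply, LinearMap.smul_apply, LinearEquiv.coe_coe]
  rw [dualBasis_apply, map_smul, hH, smul_comm, ← dualBasis_apply h, map_smul,
    Module.Basis.repr_self]
  ext l
  simp only [Finsupp.smul_apply, Finsupp.sub_apply, deg_apply, smul_eq_mul]
  by_cases hl : k = l
  · subst hl; simp
  · simp [hl]

theorem mem_singular_vermaTensor (m : ℕ) (x : ⨂[ℂ] _ : Fin n, (ℕ →₀ ℂ)) :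
    x ∈ (vermaTensor lam).singular ((∑ i, lam i) - 2 * m) ↔
      lower ℂ (Fin n) ((dualBasis h).repr x) = 0 ∧
        deg ℂ (Fin n) ((dualBasis h).repr x) = (m : ℂ) • (dualBasis h).repr x := by
  rw [Rep.mem_singular, ← (dualBasis h).repr.map_eq_zero_iff, dualBasis_repr_E h]
  refine and_congr_right fun _ => ?_
  rw [← (dualBasis h).repr.injective.eq_iff, dualBasis_repr_H, map_smul]
  constructor
  · intro h1
    have h2 : (2 : ℂ) • deg ℂ (Fin n) ((dualBasis h).repr x) =
        (2 : ℂ) • ((m : ℂ) • (dualBasis h).repr x) := by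
      rw [sub_eq_iff_eq_add, ← sub_eq_iff_eq_add'] at h1
      rw [← h1]
      push_cast
      module
    exact smul_right_injective _ two_ne_zero h2
  · intro h1
    rw [h1]
    push_cast
    module

/-- The form is diagonal with real coefficients, and `|z|²` is the sum of the squares of the real
and imaginary parts. -/
theorem tensorForm_re (x : ⨂[ℂ] _ : Fin n, (ℕ →₀ ℂ)) :
    (tensorForm lam x x).re =
      coordForm lam (((dualBasis h).repr x).mapRange Complex.re rfl)
        (((dualBasis h).repr x).mapRange Complex.re rfl) +
      coordForm lam (((dualBasis h).repr x).mapRange Complex.im rfl)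
        (((dualBasis h).repr x).mapRange Complex.im rfl) := by
  rw [coordForm_apply lam _ _ ((dualBasis h).repr x).support Finsupp.support_mapRange,
    coordForm_apply lam _ _ ((dualBasis h).repr x).support Finsupp.support_mapRange,
    ← Finset.sum_add_distrib]
  have hsupp : ((prodBasis n).repr x).support ⊆ ((dualBasis h).repr x).support := by
    intro k hk
    rw [Finsupp.mem_support_iff, prodBasis_repr h] at hk
    exact Finsupp.mem_support_iff.2 (right_ne_zero_of_mul hk)
  simp only [tensorForm, diagForm, LinearMap.mk₂'ₛₗ_apply]
  rw [Finsupp.sum_of_support_subset _ hsupp _ (by simp), Complex.re_sum]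
  refine Finset.sum_congr rfl fun k _ => ?_
  have hne := prodNorm_ne_zero h k
  have hP : ∏ i, shapNorm (lam i) (k i) = prodNorm lam k := rfl
  rw [prodBasis_repr h, hP, ← Complex.ofReal_inv]
  simp only [Finsupp.mapRange_apply, map_mul, Complex.conj_ofReal, Complex.mul_re, Complex.mul_im,
    Complex.ofReal_re, Complex.ofReal_im, Complex.conj_re, Complex.conj_im]
  field_simp
  ring

theorem lower_mapRange {K L : Type*} [Field K] [Field L] (φ : K →+ L) (f : (Fin n → ℕ) →₀ K) :
    lower L (Fin n) (f.mapRange φ φ.map_zero) =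
      (lower K (Fin n) f).mapRange φ φ.map_zero := by
  ext k
  simp [lower_apply]

theorem deg_mapRange {K L : Type*} [Field K] [CharZero K] [Field L] [CharZero L] (φ : K →+ L)
    (m : ℕ) (f : (Fin n → ℕ) →₀ K) (hf : deg K (Fin n) f = (m : K) • f) :
    deg L (Fin n) (f.mapRange φ φ.map_zero) = (m : L) • f.mapRange φ φ.map_zero := by
  rw [deg_eq_iff] at hf ⊢
  intro k hk
  refine hf k fun h0 => hk ?_
  rw [Finsupp.mapRange_apply, h0, map_zero]

/-- The multiplicity space as a space of singular vectors. -/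
def multEquiv (lam : Fin n → ℝ) (m : ℕ) :
    multSpace lam m ≃ₗ[ℂ] (vermaTensor lam).singular ((∑ i, lam i) - 2 * m) :=
  homEquiv (vermaTensor lam) ((∑ i, lam i) - 2 * m)

include h in
-- `lower` and `deg` have integer coefficients, so the real and imaginary parts of a singular vector
-- are singular of the same degree, and `tensorForm_re` adds their values. Conversely a real
-- singular vector is a complex one with zero imaginary part.
theorem multForm_pos_iff (e m : ℕ) :
    (∀ φ : multSpace lam m, φ ≠ 0 → 0 < (-1) ^ e * (multForm lam m φ φ).re) ↔ Def e lam m := by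
  have hform : ∀ φ : multSpace lam m, multForm lam m φ φ =
      tensorForm lam (multEquiv lam m φ).1 (multEquiv lam m φ).1 := fun φ => rfl
  constructor
  · intro H f h1 h2 h3
    let f' : (Fin n → ℕ) →₀ ℂ := f.mapRange Complex.ofRealHom.toAddMonoidHom (map_zero _)
    have hf' : (dualBasis h).repr ((dualBasis h).repr.symm f') = f' :=
      LinearEquiv.apply_symm_apply _ _
    have hmem : (dualBasis h).repr.symm f' ∈
        (vermaTensor lam).singular ((∑ i, lam i) - 2 * m) := by
      rw [mem_singular_vermaTensor h, hf']
      refine ⟨?_, deg_mapRange _ m f h2⟩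
      rw [lower_mapRange, h1]
      simp
    have h4 := H ((multEquiv lam m).symm ⟨_, hmem⟩) (by
      rw [Ne, LinearEquiv.map_eq_zero_iff]
      intro h0
      have h5 : f' = 0 := (dualBasis h).repr.symm.map_eq_zero_iff.1 (congrArg Subtype.val h0)
      refine h3 ?_
      ext k
      have := DFunLike.congr_fun h5 k
      simpa [f'] using this)
    rw [hform, LinearEquiv.apply_symm_apply, tensorForm_re h, hf'] at h4
    have hre : f'.mapRange Complex.re rfl = f := by ext k; simp [f']
    have him : f'.mapRange Complex.im rfl = 0 := by ext k; simp [f']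
    rwa [hre, him, map_zero, add_zero] at h4
  · intro H φ hφ
    rw [hform, tensorForm_re h]
    set x := multEquiv lam m φ with hx
    have hx0 : x ≠ 0 := by rwa [hx, Ne, LinearEquiv.map_eq_zero_iff]
    obtain ⟨h1, h2⟩ := (mem_singular_vermaTensor h m x.1).1 x.2
    set f := (dualBasis h).repr x.1 with hf
    have hf0 : f ≠ 0 := by
      rw [hf, Ne, LinearEquiv.map_eq_zero_iff]
      exact fun h0 => hx0 (Subtype.ext h0)
    have key : ∀ ψ : ℂ →+ ℝ, f.mapRange ψ ψ.map_zero ≠ 0 → 0 < (-1) ^ e *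
        coordForm lam (f.mapRange ψ ψ.map_zero) (f.mapRange ψ ψ.map_zero) := fun ψ hψ => by
      refine H _ ?_ (deg_mapRange ψ m f h2) hψ
      rw [lower_mapRange, h1]
      simp
    have hre := key Complex.reAddGroupHom
    have him := key Complex.imAddGroupHom
    change f.mapRange Complex.re rfl ≠ 0 → 0 < (-1) ^ e *
      coordForm lam (f.mapRange Complex.re rfl) (f.mapRange Complex.re rfl) at hre
    change f.mapRange Complex.im rfl ≠ 0 → 0 < (-1) ^ e *
      coordForm lam (f.mapRange Complex.im rfl) (f.mapRange Complex.im rfl) at him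
    rw [mul_add]
    by_cases hr : f.mapRange Complex.re rfl = 0
    · by_cases hi : f.mapRange Complex.im rfl = 0
      · refine absurd ?_ hf0
        ext k
        exact Complex.ext (by simpa using DFunLike.congr_fun hr k)
          (by simpa using DFunLike.congr_fun hi k)
      · rw [hr, map_zero, mul_zero, zero_add]
        exact him hi
    · by_cases hi : f.mapRange Complex.im rfl = 0
      · rw [hi, map_zero, mul_zero, add_zero]
        exact hre hr
      · exact add_pos (hre hr) (him hi)

include h in
theorem posDefAt_iff (m : ℕ) : PosDefAt lam m ↔ Def 0 lam m := by
  rw [← multForm_pos_iff h]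
  simp [PosDefAt]

include h in
theorem negDefAt_iff (m : ℕ) : NegDefAt lam m ↔ Def 1 lam m := by
  rw [← multForm_pos_iff h]
  simp [NegDefAt]

/-- The singular vectors of degree `m` in coordinates. -/
def singularCoord (n m : ℕ) : Submodule ℂ ((Fin n → ℕ) →₀ ℂ) :=
  LinearMap.ker (lower ℂ (Fin n)) ⊓ LinearMap.ker (deg ℂ (Fin n) - (m : ℂ) • LinearMap.id)

theorem mem_singularCoord {n m : ℕ} {f : (Fin n → ℕ) →₀ ℂ} :
    f ∈ singularCoord n m ↔ lower ℂ (Fin n) f = 0 ∧ deg ℂ (Fin n) f = (m : ℂ) • f := by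
  simp [singularCoord, sub_eq_zero]

theorem neg_lower_pow_ne_zero {n m : ℕ} {g : (Fin n → ℕ) →₀ ℂ} (hg : ∀ k, g k ≠ 0 → ∑ i, k i = m)
    (j : ℕ) (r : Fin n → ℕ) (hr : ((-lower ℂ (Fin n)) ^ j) g r ≠ 0) : ∑ i, r i + j = m := by
  induction j generalizing r with
  | zero => simpa using hg r hr
  | succ j ih =>
    rw [pow_succ', Module.End.mul_apply, LinearMap.neg_apply, Finsupp.neg_apply, lower_apply,
      neg_ne_zero] at hr
    obtain ⟨i, -, hi⟩ := Finset.exists_ne_zero_of_sum_ne_zero hr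
    have := ih _ hi
    simp only [Pi.add_apply, Finset.sum_add_distrib, Finset.sum_pi_single', Finset.mem_univ,
      if_true] at this
    omega

/-- A singular vector is determined by its component along the highest weight vector of the first
factor, which is arbitrary. -/
theorem finrank_singularCoord (n m : ℕ) :
    Module.finrank ℂ (singularCoord (n + 1) m) =
      (Finset.piAntidiag (Finset.univ : Finset (Fin n)) m).card := by
  let S := Finsupp.supported ℂ ℂ (↑(Finset.piAntidiag (Finset.univ : Finset (Fin n)) m) :
    Set (Fin n → ℕ))
  let T : ((Fin (n + 1) → ℕ) →₀ ℂ) →ₗ[ℂ] ((Fin n → ℕ) →₀ ℂ) :=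
    Finsupp.lapply 0 ∘ₗ (consEquiv n).toLinearMap
  have hT : ∀ f r, T f r = f (Fin.cons 0 r) := fun f r => consEquiv_apply f 0 r
  have hmaps : ∀ f : singularCoord (n + 1) m, (T ∘ₗ (singularCoord (n + 1) m).subtype) f ∈ S := by
    intro f
    rw [Finsupp.mem_supported]
    intro r hr
    have h1 := (deg_eq_iff f.1 m).1 (mem_singularCoord.1 f.2).2 (Fin.cons 0 r)
      (by simpa [hT] using hr)
    rw [Finset.mem_coe, mem_levelSet, ← h1, Fin.sum_univ_succ]
    simp
  have hstep : ∀ f : (Fin (n + 1) → ℕ) →₀ ℂ, ∀ j r, lower ℂ (Fin (n + 1)) f (Fin.cons j r) =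
      f (Fin.cons (j + 1) r) + ∑ i, f (Fin.cons j (r + Pi.single i 1)) := by
    intro f j r
    rw [lower_apply, Fin.sum_univ_succ, cons_add_single_zero]
    simp only [cons_add_single_succ]
  have hinj : Function.Injective (LinearMap.codRestrict S _ hmaps) := by
    refine (injective_iff_map_eq_zero _).2 fun f hf => ?_
    have h0 : ∀ r, f.1 (Fin.cons 0 r) = 0 := fun r => by
      rw [← hT]
      exact DFunLike.congr_fun (congrArg Subtype.val hf) r
    have h1 : ∀ j r, f.1 (Fin.cons j r) = 0 := by
      intro j
      induction j with
      | zero => exact h0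
      | succ j ih =>
        intro r
        have := hstep f.1 j r
        rw [(mem_singularCoord.1 f.2).1] at this
        simpa [ih] using this.symm
    refine Subtype.ext (Finsupp.ext fun k => ?_)
    rw [← Fin.cons_self_tail k]
    exact h1 _ _
  have hsurj : Function.Surjective (LinearMap.codRestrict S _ hmaps) := by
    rintro ⟨g, hg⟩
    have hg' : ∀ k, g k ≠ 0 → ∑ i, k i = m := fun k hk =>
      mem_levelSet.1 (Finset.mem_coe.1 ((Finsupp.mem_supported _ _).1 hg
        (Finsupp.mem_support_iff.2 hk)))
    -- Singularity is the recursion by which slice `j + 1` is `-lower` of slice `j`, so the slices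
    -- must be `(-lower)^j g`. Each application lowers the degree by one, so only `j ≤ m` contribute
    -- and the sum is finite.
    let f : (Fin (n + 1) → ℕ) →₀ ℂ := (consEquiv n).symm
      (∑ j ∈ Finset.range (m + 1), Finsupp.single j (((-lower ℂ (Fin n)) ^ j) g))
    have hf : ∀ j r, f (Fin.cons j r) = ((-lower ℂ (Fin n)) ^ j) g r := by
      intro j r
      rw [← consEquiv_apply, LinearEquiv.apply_symm_apply, Finsupp.finsetSum_apply]
      by_cases hj : j ∈ Finset.range (m + 1)
      · rw [Finset.sum_eq_single_of_mem j hj fun i _ hi => by simp [hi], Finsupp.single_eq_same]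
      · rw [Finset.sum_eq_zero fun i hi => by
          have : i ≠ j := fun h => hj (h ▸ hi)
          simp [this]]
        by_contra hne
        have := neg_lower_pow_ne_zero hg' j r (Ne.symm hne)
        simp only [Finset.mem_range] at hj
        omega
    have hfm : f ∈ singularCoord (n + 1) m := by
      refine mem_singularCoord.2 ⟨Finsupp.ext fun k => ?_, (deg_eq_iff f m).2 fun k hk => ?_⟩
      · rw [← Fin.cons_self_tail k, hstep, hf, pow_succ', Module.End.mul_apply,
          LinearMap.neg_apply, Finsupp.neg_apply, lower_apply]
        simp [hf]
      · rw [← Fin.cons_self_tail k, hf] at hk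
        have := neg_lower_pow_ne_zero hg' _ _ hk
        rw [Fin.sum_univ_succ, add_comm]
        exact this
    refine ⟨⟨f, hfm⟩, Subtype.ext (Finsupp.ext fun r => ?_)⟩
    change T f r = g r
    rw [hT, hf]
    simp
  rw [(LinearEquiv.ofBijective _ ⟨hinj, hsurj⟩).finrank_eq,
    (Finsupp.supportedEquivFinsupp (R := ℂ) (M := ℂ) _).finrank_eq, Module.finrank_finsupp_self]
  simp

/-- Singular vectors in coordinates. -/
def singularEquiv (m : ℕ) :
    (vermaTensor lam).singular ((∑ i, lam i) - 2 * m) ≃ₗ[ℂ] singularCoord n m where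
  toFun x := ⟨(dualBasis h).repr x.1,
    mem_singularCoord.2 ((mem_singular_vermaTensor h m x.1).1 x.2)⟩
  map_add' x y := Subtype.ext (map_add _ _ _)
  map_smul' c x := Subtype.ext (map_smul _ _ _)
  invFun f := ⟨(dualBasis h).repr.symm f.1, by
    rw [mem_singular_vermaTensor h m, LinearEquiv.apply_symm_apply]
    exact mem_singularCoord.1 f.2⟩
  left_inv x := Subtype.ext (by simp)
  right_inv f := Subtype.ext (by simp)

theorem card_piAntidiag_univ (n m : ℕ) :
    (Finset.piAntidiag (Finset.univ : Finset (Fin n)) m).card = (n + m - 1).choose m := by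
  have := Finset.map_sym_eq_piAntidiag (Finset.univ : Finset (Fin n)) m
  rw [← this, Finset.card_map, Finset.sym_univ, Finset.card_univ, Sym.card_sym_eq_choose,
    Fintype.card_fin]

include h in
theorem finrank_multSpace (hn : 2 ≤ n) (m : ℕ) :
    Module.finrank ℂ (multSpace lam m) = (m + n - 2).choose (n - 2) := by
  obtain ⟨p, rfl⟩ : ∃ p, n = p + 2 := ⟨n - 2, by omega⟩
  have h1 : Module.finrank ℂ (multSpace lam m) = Module.finrank ℂ (singularCoord (p + 2) m) :=
    (multEquiv lam m ≪≫ₗ singularEquiv h m).finrank_eq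
  rw [h1, finrank_singularCoord, card_piAntidiag_univ]
  rw [show p + 1 + m - 1 = m + p by omega, show m + (p + 2) - 2 = m + p by omega]
  exact Nat.choose_symm_add

include h in
-- Both signs at once are possible only on the zero space, and for at least two factors the
-- dimension is a positive binomial coefficient.
theorem not_def_of_ne (hn : 2 ≤ n) {e f m : ℕ} (he : Def e lam m) (hf : Def f lam m) :
    e % 2 = f % 2 := by
  by_contra hne
  rw [← multForm_pos_iff h] at he hf
  have h1 : ∀ φ : multSpace lam m, φ = 0 := by
    intro φ
    by_contra hφ
    have h2 := he φ hφ
    have h3 := hf φ hφ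
    rcases Nat.even_or_odd e with h4 | h4 <;> rcases Nat.even_or_odd f with h5 | h5
    · rw [Nat.even_iff] at h4 h5; omega
    · rw [h4.neg_one_pow] at h2; rw [h5.neg_one_pow] at h3; linarith
    · rw [h4.neg_one_pow] at h2; rw [h5.neg_one_pow] at h3; linarith
    · rw [Nat.odd_iff] at h4 h5; omega
  have h2 := finrank_multSpace h hn m
  have h3 : Subsingleton (multSpace lam m) := ⟨fun a b => (h1 a).trans (h1 b).symm⟩
  rw [Module.finrank_zero_of_subsingleton] at h2
  have := Nat.choose_pos (show n - 2 ≤ m + n - 2 by omega)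
  omega

end Coord

/-! ### Lists of highest weights -/

theorem Def.congr_mod {ι : Type*} [Fintype ι] [DecidableEq ι] {e f : ℕ} (h : e % 2 = f % 2)
    {lam : ι → ℝ} {m : ℕ} (hd : Def e lam m) : Def f lam m := fun x h1 h2 h3 => by
  rw [neg_one_pow_eq_pow_mod_two, ← h, ← neg_one_pow_eq_pow_mod_two]
  exact hd x h1 h2 h3

/-- If all product basis vectors of degree `m` have norms of one sign, the form is already definite
on the whole space of degree `m`, not just on singular vectors. -/
theorem def_of_prodNorm_sign {ι : Type*} [Fintype ι] [DecidableEq ι] {e m : ℕ} {lam : ι → ℝ}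
    (h : ∀ k : ι → ℕ, ∑ i, k i = m → 0 < (-1) ^ e * prodNorm lam k) : Def e lam m := by
  intro f _ h2 h3
  rw [coordForm_apply lam f f f.support subset_rfl, Finset.mul_sum]
  refine Finset.sum_pos (fun k hk => ?_) (Finsupp.support_nonempty_iff.2 h3)
  have hk0 := Finsupp.mem_support_iff.1 hk
  have hpos := h k ((deg_eq_iff f m).1 h2 k hk0)
  have h1 : ((-1 : ℝ) ^ e) * (-1) ^ e = 1 := by rw [← mul_pow]; simp
  have h4 : (-1) ^ e * (f k * ((prodNorm lam k)⁻¹ * f k)) =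
      ((-1) ^ e * prodNorm lam k)⁻¹ * (f k) ^ 2 := by
    rw [mul_inv, ← inv_pow, inv_neg, inv_one]
    ring
  rw [h4]
  positivity

theorem def_level_zero {ι : Type*} [Fintype ι] [DecidableEq ι] (lam : ι → ℝ) : Def 0 lam 0 :=
  def_of_prodNorm_sign fun k hk => by
    have : ∀ i, k i = 0 := fun i =>
      Finset.sum_eq_zero_iff.1 hk i (Finset.mem_univ i)
    simp [prodNorm, this, shapNorm]

/-- `Def` for a list of highest weights. -/
def DefL (e : ℕ) (l : List ℝ) (m : ℕ) : Prop := Def e l.get m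

theorem defL_ofFn {n : ℕ} (e : ℕ) (lam : Fin n → ℝ) (m : ℕ) :
    DefL e (List.ofFn lam) m ↔ Def e lam m := by
  have : (List.ofFn lam).get = lam ∘ finCongr List.length_ofFn := by
    ext i
    simp
    rfl
  rw [DefL, this]
  exact def_reindex _ e lam m

theorem exists_equiv_of_perm {l l' : List ℝ} (h : l.Perm l') :
    ∃ σ : Fin l.length ≃ Fin l'.length, ∀ i, l.get i = l'.get (σ i) := by
  induction h with
  | nil => exact ⟨Equiv.refl _, fun i => rfl⟩
  | cons x h ih =>
    rename_i l₁ l₂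
    obtain ⟨σ, hσ⟩ := ih
    refine ⟨(finSuccEquiv _).trans ((Equiv.optionCongr σ).trans (finSuccEquiv _).symm), fun i => ?_⟩
    refine Fin.cases ?_ (fun i => ?_) i
    · simp
    · simpa using hσ i
  | swap x y l =>
    refine ⟨Equiv.swap (0 : Fin (l.length + 2)) (1 : Fin (l.length + 2)), fun i => ?_⟩
    change Fin (l.length + 2) at i
    by_cases h0 : i = 0
    · subst h0
      rw [Equiv.swap_apply_left]
      rfl
    · by_cases h1 : i = 1
      · subst h1
        rw [Equiv.swap_apply_right]
        rfl
      · rw [Equiv.swap_apply_of_ne_of_ne h0 h1]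
        obtain ⟨j, rfl⟩ := Fin.exists_succ_eq.2 h0
        have hj : j ≠ 0 := fun h => h1 (by rw [h]; rfl)
        obtain ⟨j', rfl⟩ := Fin.exists_succ_eq.2 hj
        rfl
  | trans h₁ h₂ ih₁ ih₂ =>
    obtain ⟨σ, hσ⟩ := ih₁
    obtain ⟨τ, hτ⟩ := ih₂
    exact ⟨σ.trans τ, fun i => (hσ i).trans (hτ _)⟩

/-- Permuting the factors permutes the coordinates. It allows fusion to be applied to any two
factors. -/
theorem DefL.perm {l l' : List ℝ} (h : l.Perm l') {e m : ℕ} (hd : DefL e l m) : DefL e l' m := by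
  obtain ⟨σ, hσ⟩ := exists_equiv_of_perm h
  have : l.get = l'.get ∘ σ := funext hσ
  rw [DefL, this] at hd
  exact (def_reindex σ e _ m).1 hd

theorem defL_fuse (e m : ℕ) {a b : ℝ} {l : List ℝ} (ha : NotNat a) (hb : NotNat b)
    (hab : NotNat (a + b)) (h : ∀ x ∈ l, NotNat x) :
    DefL e (a :: b :: l) m ↔
      ∀ k ≤ m, DefL (e + fuseExp ⌈a⌉₊ ⌈b⌉₊ ⌈a + b⌉₊ k) ((a + b - 2 * k) :: l) (m - k) := by
  have h1 := def_fuse e m l.get ha hb hab fun i => h _ (l.get_mem i)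
  have h2 : (Fin.cons a (Fin.cons b l.get : Fin (l.length + 1) → ℝ) : Fin (l.length + 2) → ℝ) =
      (a :: b :: l).get := by
    ext i
    refine Fin.cases rfl (fun i => ?_) i
    exact Fin.cases rfl (fun i => rfl) i
  have h3 : ∀ c : ℝ, (Fin.cons c l.get : Fin (l.length + 1) → ℝ) = (c :: l).get := by
    intro c
    ext i
    exact Fin.cases rfl (fun i => rfl) i
  rw [h2] at h1
  simp only [h3] at h1
  exact h1

/-- The only singular vectors of a generic Verma module are the multiples of `v_0`, of norm `1`. At
levels `m > 0` the space is zero and the condition is empty. -/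
theorem defL_singleton (e m : ℕ) (a : ℝ) : DefL e [a] m ↔ (m = 0 → e % 2 = 0) := by
  have hsing : ∀ f : (Fin 1 → ℕ) →₀ ℝ, lower ℝ (Fin 1) f = 0 → ∀ k, f k ≠ 0 → k = 0 := by
    intro f hf k hk
    by_contra h0
    obtain ⟨k', rfl⟩ : ∃ k', k = k' + Pi.single 0 1 := ⟨k - Pi.single 0 1, by
      ext j
      obtain rfl := Subsingleton.elim j 0
      have : k 0 ≠ 0 := fun h => h0 (funext fun i => by
        obtain rfl := Subsingleton.elim i 0
        exact h)
      simp
      omega⟩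
    have := DFunLike.congr_fun hf k'
    rw [lower_apply] at this
    exact hk (by simpa using this)
  constructor
  · rintro h rfl
    have h1 := h (Finsupp.single 0 1) (by
      ext k
      rw [lower_apply, Finsupp.zero_apply]
      refine Finset.sum_eq_zero fun i _ => ?_
      rw [Finsupp.single_apply, if_neg]
      intro h0
      have := congrFun h0 i
      simp at this) ((deg_eq_iff _ 0).2 fun k hk => by
        rcases eq_or_ne 0 k with rfl | hne
        · simp
        · simp [hne] at hk) (by simp)
    by_contra he
    have ho : Odd e := by rw [Nat.odd_iff]; omega
    rw [coordForm_single, ho.neg_one_pow] at h1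
    simp [prodNorm, shapNorm] at h1
    linarith
  · intro h
    by_cases hm : m = 0
    · subst hm
      exact (def_level_zero _).congr_mod (h rfl).symm
    · intro f h1 h2 h3
      refine absurd ?_ h3
      ext k
      by_contra hk
      have h4 := hsing f h1 k hk
      have h5 := (deg_eq_iff f m).1 h2 k hk
      subst h4
      simp at h5
      exact hm h5.symm

theorem DefL.mod_eq {l : List ℝ} (hl : 2 ≤ l.length) (h : ∀ x ∈ l, NotNat x) {e f m : ℕ}
    (he : DefL e l m) (hf : DefL f l m) : e % 2 = f % 2 :=
  not_def_of_ne (fun i => h _ (l.get_mem i)) hl he hf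

theorem natCeil_sub_two_mul (x : ℝ) (k : ℕ) : ⌈x - 2 * k⌉₊ = ⌈x⌉₊ - 2 * k := by
  have := Nat.ceil_sub_natCast x (2 * k)
  push_cast at this
  exact this

/-- After fusion a single factor is left, which has a singular vector only at level `0`. So only `k
= m` imposes a condition. -/
theorem defL_pair (e m : ℕ) {a b : ℝ} (ha : NotNat a) (hb : NotNat b) (hab : NotNat (a + b)) :
    DefL e [a, b] m ↔ (e + fuseExp ⌈a⌉₊ ⌈b⌉₊ ⌈a + b⌉₊ m) % 2 = 0 := by
  rw [defL_fuse e m ha hb hab (by simp)]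
  simp only [defL_singleton]
  constructor
  · intro h
    exact h m le_rfl (Nat.sub_self m)
  · intro h k hk hkm
    obtain rfl : k = m := by omega
    exact h

/-- The exponent of the sign of the vector of degrees `K`, `m - K` along successive fusions of three
factors. -/
def pathExp (X Y Z S N m K : ℕ) : ℕ :=
  fuseExp X Y S K + fuseExp (S - 2 * K) Z (N - 2 * K) (m - K)

/-- Fusing the first two factors at level `K` and the result with the third at level `m - K` gives
an orthogonal basis of the multiplicity space. Definiteness means that all these signs agree. -/
theorem defL_triple (e m : ℕ) {a b c : ℝ} (ha : NotNat a) (hb : NotNat b) (hc : NotNat c)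
    (hab : NotNat (a + b)) (habc : NotNat (a + b + c)) :
    DefL e [a, b, c] m ↔
      ∀ K ≤ m, (e + pathExp ⌈a⌉₊ ⌈b⌉₊ ⌈c⌉₊ ⌈a + b⌉₊ ⌈a + b + c⌉₊ m K) % 2 = 0 := by
  rw [defL_fuse e m ha hb hab (by simpa using hc)]
  refine forall_congr' fun k => imp_congr_right fun hk => ?_
  have h1 : a + b - 2 * k + c = a + b + c - 2 * k := by ring
  rw [defL_pair _ _ (hab.sub_two_mul k) hc (by rw [h1]; exact habc.sub_two_mul k), h1,
    natCeil_sub_two_mul, natCeil_sub_two_mul, pathExp, add_assoc]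

/-- This is the summand `k = 0` of the fusion, whose sign is `+`. It is the source of the necessary
conditions for more than three factors. -/
theorem DefL.merge {e m : ℕ} {a b : ℝ} {l : List ℝ} (ha : NotNat a) (hb : NotNat b)
    (hab : NotNat (a + b)) (h : ∀ x ∈ l, NotNat x) (hd : DefL e (a :: b :: l) m) :
    DefL e ((a + b) :: l) m := by
  have := (defL_fuse e m ha hb hab h).1 hd 0 (Nat.zero_le _)
  simpa [fuseExp] using this

/-- The highest weights `l` have ceilings `cs` and their sum has ceiling `N`. -/
def HasType (l : List ℝ) (cs : List ℕ) (N : ℕ) : Prop :=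
  List.Forall₂ HasCeil l cs ∧ HasCeil l.sum N

theorem HasType.notNat {l : List ℝ} {cs : List ℕ} {N : ℕ} (h : HasType l cs N) :
    ∀ x ∈ l, NotNat x := by
  obtain ⟨h, -⟩ := h
  induction h with
  | nil => simp
  | cons h _ ih =>
    intro x hx
    rcases List.mem_cons.1 hx with rfl | hx
    · exact h.notNat
    · exact ih x hx

theorem DefL.of_hasType {e m : ℕ} {l l' : List ℝ} {cs : List ℕ} {N : ℕ} (h : HasType l cs N)
    (h' : HasType l' cs N) (hd : DefL e l m) : DefL e l' m := by
  have key : ∀ {l : List ℝ}, HasType l cs N → ∃ lam : Fin cs.length → ℝ, l = List.ofFn lam ∧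
      (∀ i, HasCeil (lam i) (cs.get i)) ∧ HasCeil (∑ i, lam i) N := by
    intro l hl
    have hlen := hl.1.length_eq
    refine ⟨fun i => l.get (Fin.cast hlen.symm i), ?_, fun i => ?_, ?_⟩
    · refine List.ext_get (by simp [hlen]) fun i h1 h2 => by simp
    · exact List.Forall₂.get hl.1 _ i.2
    · have := hl.2
      rw [← Fin.sum_univ_getElem] at this
      rw [← (finCongr hlen).sum_comp]
      simpa using this
  obtain ⟨lam, rfl, h1, h2⟩ := key h
  obtain ⟨lam', rfl, h3, h4⟩ := key h'
  rw [defL_ofFn] at hd ⊢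
  exact def_of_hasCeil h1 h2 h3 h4 hd

/-! ### Parities of signs along fusion paths -/

theorem fuseExp_one (A B C : ℕ) : fuseExp A B C 1 = (1 - A) + (1 - B) + (1 - C) := by
  unfold fuseExp; omega

theorem pathExp_self (X Y Z S N m : ℕ) : pathExp X Y Z S N m m = fuseExp X Y S m := by
  simp [pathExp, fuseExp]

theorem pathExp_pred (X Y Z S N m : ℕ) (hm : 1 ≤ m) : pathExp X Y Z S N m (m - 1) =
    fuseExp X Y S (m - 1) +
      ((1 - (S - 2 * (m - 1))) + (1 - Z) + (1 - (N - 2 * (m - 1)))) := by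
  rw [pathExp, show m - (m - 1) = 1 by omega, fuseExp_one]

theorem pathExp_zero (X Y Z S N m : ℕ) : pathExp X Y Z S N m 0 = fuseExp S Z N m := by
  simp [pathExp, fuseExp]

theorem pathExp_one (X Y Z S N m : ℕ) : pathExp X Y Z S N m 1 =
    (1 - X) + (1 - Y) + (1 - S) + fuseExp (S - 2) Z (N - 2) (m - 1) := by
  rw [pathExp, fuseExp_one]

theorem sub_succ_left (m X : ℕ) : m + 1 - X = m - X + if X < m + 1 then 1 else 0 := by
  split_ifs <;> omega

theorem one_sub_eq_ite (X : ℕ) : 1 - X = if X = 0 then 1 else 0 := by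
  split_ifs <;> omega

theorem parity_min_succ (S m : ℕ) :
    (min (m + 1) (2 * (m + 1) - 1 - S) + min m (2 * m - 1 - S) + (1 - (S - 2 * m))) % 2 =
      (if S + 2 < 2 * (m + 1) ∧ m + 1 ≤ S + 1 then 1 else 0) % 2 := by
  split_ifs <;> omega

theorem parity_min_sub_two (N m : ℕ) :
    (min (m + 1) (2 * (m + 1) - 1 - N) + min m (2 * m - 1 - (N - 2))) % 2 =
      (if N < m + 1 then 1 else 0) % 2 := by
  split_ifs <;> omega

theorem parity_sub_sub_two (S m : ℕ) : (m + 1 - S + (m - (S - 2)) + (1 - S)) % 2 =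
    (if 2 ≤ S ∧ S ≤ m + 1 then 1 else 0) % 2 := by
  split_ifs <;> omega

/-- Comparing the signs at `K = m` and `K = m - 1` cancels `e` and almost all of both exponents.
What remains is a sum of indicators, each of a linear threshold, which must be even. -/
theorem parity_last_two {X Y Z S N m e : ℕ} (hm : 1 ≤ m)
    (h : ∀ K ≤ m, (e + pathExp X Y Z S N m K) % 2 = 0) :
    ((if X < m then 1 else 0) + (if Y < m then 1 else 0) +
      (if S + 2 < 2 * m ∧ m ≤ S + 1 then 1 else 0) + (if Z = 0 then 1 else 0) +
      (if N + 2 ≤ 2 * m then 1 else 0)) % 2 = 0 := by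
  have a1 := h m le_rfl
  have a2 := h (m - 1) (by omega)
  rw [pathExp_self] at a1
  rw [pathExp_pred _ _ _ _ _ _ hm] at a2
  obtain ⟨m, rfl⟩ : ∃ k, m = k + 1 := ⟨m - 1, by omega⟩
  simp only [Nat.add_sub_cancel] at a2
  clear h
  unfold fuseExp at a1 a2
  have hN : 1 - (N - 2 * m) = if N + 2 ≤ 2 * (m + 1) then 1 else 0 := by
    clear a1 a2
    split_ifs <;> omega
  have hS := parity_min_succ S m
  rw [sub_succ_left m X, sub_succ_left m Y] at a1
  rw [one_sub_eq_ite Z, hN] at a2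
  generalize (if X < m + 1 then 1 else 0) = x at *
  generalize (if Y < m + 1 then 1 else 0) = y at *
  generalize (if Z = 0 then 1 else 0) = z at *
  generalize (if N + 2 ≤ 2 * (m + 1) then 1 else 0) = n at *
  generalize (if S + 2 < 2 * (m + 1) ∧ m + 1 ≤ S + 1 then 1 else 0) = s at *
  generalize min (m + 1) (2 * (m + 1) - 1 - S) = u at *
  generalize min m (2 * m - 1 - S) = v at *
  generalize 1 - (S - 2 * m) = w at *
  generalize m - X = x' at *
  generalize m - Y = y' at *
  omega

/-- The same comparison at the other end of the range, for `K = 0` and `K = 1`. -/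
theorem parity_first_two {X Y Z S N m e : ℕ} (hm : 1 ≤ m)
    (h : ∀ K ≤ m, (e + pathExp X Y Z S N m K) % 2 = 0) :
    ((if X = 0 then 1 else 0) + (if Y = 0 then 1 else 0) +
      (if 2 ≤ S ∧ S ≤ m then 1 else 0) + (if Z < m then 1 else 0) +
      (if N < m then 1 else 0)) % 2 = 0 := by
  have a1 := h 0 (by omega)
  have a2 := h 1 hm
  rw [pathExp_zero] at a1
  rw [pathExp_one] at a2
  obtain ⟨m, rfl⟩ : ∃ k, m = k + 1 := ⟨m - 1, by omega⟩
  simp only [Nat.add_sub_cancel] at a2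
  clear h
  unfold fuseExp at a1 a2
  have hS := parity_sub_sub_two S m
  have hN := parity_min_sub_two N m
  rw [sub_succ_left m Z] at a1
  rw [one_sub_eq_ite X, one_sub_eq_ite Y] at a2
  generalize (if X = 0 then 1 else 0) = x at *
  generalize (if Y = 0 then 1 else 0) = y at *
  generalize (if Z < m + 1 then 1 else 0) = z at *
  generalize (if N < m + 1 then 1 else 0) = n at *
  generalize (if 2 ≤ S ∧ S ≤ m + 1 then 1 else 0) = s at *
  generalize min (m + 1) (2 * (m + 1) - 1 - N) = u at *
  generalize min m (2 * m - 1 - (N - 2)) = v at *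
  generalize 1 - S = w at *
  generalize m + 1 - S = w₁ at *
  generalize m - (S - 2) = w₂ at *
  generalize m - Z = z' at *
  omega

/-- The exceptional definite levels for three positive highest weights with ceilings `A ≥ B ≥ C`. -/
def ExcTriple (A B C N m e : ℕ) : Prop :=
  (A = B ∧ B = C ∧ ((N + 2 = 3 * A ∧ e % 2 = 0 ∧ (m + 1 = 2 * A ∨ m = 2 * A)) ∨
    (N = 3 * A ∧ e % 2 = 1 ∧ (m = 2 * A ∨ m = 2 * A + 1)))) ∨
  (A = B ∧ B = C + 1 ∧ ((N + 3 = 3 * A ∧ e % 2 = 0 ∧ m + 1 = 2 * A) ∨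
    (N + 1 = 3 * A ∧ e % 2 = 1 ∧ m = 2 * A))) ∨
  (A = B + 1 ∧ B = C ∧ ((N + 4 = 3 * A ∧ e % 2 = 0 ∧ m + 2 = 2 * A) ∨
    (N + 2 = 3 * A ∧ e % 2 = 1 ∧ m + 1 = 2 * A)))

/-- When `N` takes its least value `A + B + C - 2`, each fusion loses one, so the partial ceilings
are forced. The end comparison at `K = m` is made for the order `B, C, A` and the one at `K = 0` for
`A, B, C`. Together they give `A ≤ C + 1` and fix `m` up to two values; the sign is then read off at
`K = m`. -/
theorem excTriple_of_sum_sub_two {A B C N m e : ℕ} (h1 : B ≤ A) (h2 : C ≤ B) (h3 : 1 ≤ C)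
    (hm : C < m) (hN : N + 2 = A + B + C)
    (hbc : ∀ K ≤ m, (e + pathExp B C A (B + C - 1) N m K) % 2 = 0)
    (hab : ∀ K ≤ m, (e + pathExp A B C (A + B - 1) N m K) % 2 = 0) :
    ExcTriple A B C N m e := by
  have p1 := parity_last_two (by omega) hbc
  have p2 := parity_first_two (by omega) hab
  have p3 := hbc m le_rfl
  rw [pathExp_self, fuseExp] at p3
  clear hbc hab
  have key : A ≤ C + 1 ∧ (A = B → B = C → m + 1 = 2 * A ∨ m = 2 * A) ∧
      (A = B → B = C + 1 → m + 1 = 2 * A) ∧ (A = B + 1 → m + 2 = 2 * A) := by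
    clear p3
    split_ifs at p1 p2 <;> omega
  clear p1 p2
  obtain ⟨k1, k2, k3, k4⟩ := key
  have : (A = B ∧ B = C) ∨ (A = B ∧ B = C + 1) ∨ (A = B + 1 ∧ B = C) := by omega
  rcases this with ⟨rfl, rfl⟩ | ⟨rfl, rfl⟩ | ⟨rfl, rfl⟩
  · have := k2 rfl rfl
    refine Or.inl ⟨rfl, rfl, Or.inl ⟨by omega, ?_, this⟩⟩
    rcases this with h | h <;> omega
  · have := k3 rfl rfl
    exact Or.inr (Or.inl ⟨rfl, rfl, Or.inl ⟨by omega, by omega, by omega⟩⟩)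
  · have := k4 rfl
    exact Or.inr (Or.inr ⟨rfl, rfl, Or.inl ⟨by omega, by omega, by omega⟩⟩)

/-- The opposite extreme, where no fusion loses anything; the argument is the same. -/
theorem excTriple_of_sum {A B C N m e : ℕ} (h1 : B ≤ A) (h2 : C ≤ B) (h3 : 1 ≤ C)
    (hm : C < m) (hN : N = A + B + C)
    (hbc : ∀ K ≤ m, (e + pathExp B C A (B + C) N m K) % 2 = 0)
    (hab : ∀ K ≤ m, (e + pathExp A B C (A + B) N m K) % 2 = 0) :
    ExcTriple A B C N m e := by
  have p1 := parity_last_two (by omega) hbc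
  have p2 := parity_first_two (by omega) hab
  have p3 := hbc m le_rfl
  rw [pathExp_self, fuseExp] at p3
  clear hbc hab
  have key : A ≤ C + 1 ∧ (A = B → B = C → m = 2 * A ∨ m = 2 * A + 1) ∧
      (A = B → B = C + 1 → m = 2 * A) ∧ (A = B + 1 → m + 1 = 2 * A) := by
    clear p3
    split_ifs at p1 p2 <;> omega
  clear p1 p2
  obtain ⟨k1, k2, k3, k4⟩ := key
  have : (A = B ∧ B = C) ∨ (A = B ∧ B = C + 1) ∨ (A = B + 1 ∧ B = C) := by omega
  rcases this with ⟨rfl, rfl⟩ | ⟨rfl, rfl⟩ | ⟨rfl, rfl⟩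
  · have := k2 rfl rfl
    refine Or.inl ⟨rfl, rfl, Or.inr ⟨by omega, ?_, this⟩⟩
    rcases this with h | h <;> omega
  · have := k3 rfl rfl
    exact Or.inr (Or.inl ⟨rfl, rfl, Or.inr ⟨by omega, by omega, by omega⟩⟩)
  · have := k4 rfl
    exact Or.inr (Or.inr ⟨rfl, rfl, Or.inr ⟨by omega, by omega, by omega⟩⟩)

/-- In the intermediate case a partial ceiling may or may not lose one. Since definiteness depends
only on the type, the loss can be placed in the first fusion for one order and in the second for the
other, and the two choices are incompatible. -/
theorem not_of_sum_sub_one {A B C N m e : ℕ} (h1 : B ≤ A) (h2 : C ≤ B) (h3 : 1 ≤ C)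
    (hm : C < m) (hN : N + 1 = A + B + C)
    (hbc : ∀ K ≤ m, (e + pathExp B C A (B + C - 1) N m K) % 2 = 0)
    (hab : ∀ K ≤ m, (e + pathExp A B C (A + B) N m K) % 2 = 0) : False := by
  have p1 := parity_last_two (by omega) hbc
  have p2 := parity_first_two (by omega) hab
  have key : A = C ∧ m = 2 * A := by
    clear hbc hab
    split_ifs at p1 p2 <;> omega
  obtain ⟨rfl, rfl⟩ := key
  obtain rfl : B = A := by omega
  -- The end comparisons leave `A = B = C`, `m = 2A`; the signs at `K = A - 1` and `K = A + 1`
  -- differ there.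
  have q1 := hab (B - 1) (by omega)
  have q2 := hab (B + 1) (by omega)
  clear p1 p2 hbc hab
  obtain rfl : N = 3 * B - 1 := by omega
  unfold pathExp fuseExp at q1 q2
  obtain ⟨b, rfl⟩ : ∃ b, B = b + 1 := ⟨B - 1, by omega⟩
  clear h1 h2 hm hN h3
  omega

/-- Two positive highest weights with ceilings `A`, `B` and a negative one, positive sum. -/
theorem bounds_of_one_neg {A B N m e : ℕ} (hA : 1 ≤ A) (hB : 1 ≤ B) (hN : 1 ≤ N)
    (hm : 1 ≤ m) (hNs : N ≤ A + B)
    (hab : ∀ K ≤ m, (e + pathExp A B 0 (A + B) N m K) % 2 = 0)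
    (hac : ∀ K ≤ m, (e + pathExp A 0 B (N - B) N m K) % 2 = 0)
    (hbc : ∀ K ≤ m, (e + pathExp B 0 A (N - A) N m K) % 2 = 0) :
    (N < m ∧ m ≤ A ∧ m ≤ B ∧ e % 2 = 0) ∨ (A = 1 ∧ B = 1 ∧ N = 2 ∧ m = 2 ∧ e % 2 = 1) := by
  have p1 := parity_first_two hm hab
  have p2 := parity_last_two hm hac
  have p3 := parity_last_two hm hbc
  have key : (N < m ∧ m ≤ A ∧ m ≤ B) ∨ (N = A + B ∧ m = N) := by
    clear hab hac hbc
    split_ifs at p1 p2 p3 <;> omega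
  clear p1 p2 p3
  rcases key with ⟨h1, h2, h3⟩ | ⟨h1, rfl⟩
  · have q := hac m le_rfl
    rw [pathExp_self, fuseExp] at q
    clear hab hac hbc
    exact Or.inl ⟨h1, h2, h3, by omega⟩
  -- The end comparisons also allow `m = N = A + B`. The signs at `K = 0`, `1` and `m - 1` then
  -- leave only `A = B = 1`, with negative sign.
  · have q0 := hab 0 (by omega)
    have q1 := hab 1 (by omega)
    have q2 := hab (m - 1) (by omega)
    rw [pathExp_pred _ _ _ _ _ _ hm] at q2
    rw [pathExp_one] at q1
    rw [pathExp_zero] at q0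
    clear hab hac hbc
    unfold fuseExp at q0 q1 q2
    subst h1
    omega

/-! ### Parity checks for the exceptional triples. -/

theorem fuseExp_mod_two (A B C k : ℕ) : (fuseExp A B C k) % 2 =
    ((k - A) + (k - B) + if C < k then k else if C + 1 < 2 * k then C + 1 else 0) % 2 := by
  unfold fuseExp
  split_ifs <;> omega

/-- Modulo `2` the term `2k - 1 - C` is `C + 1`, so a minimum can be replaced by a case distinction
on linear conditions. With the truncated differences of `N` unfolded as well, the parity can be
decided for whole families at once. -/
theorem pathExp_even_of {X Y Z S N m e K : ℕ} (hK : K ≤ m)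
    (h : (e + ((K - X) + (K - Y) + if S < K then K else if S + 1 < 2 * K then S + 1 else 0) +
      ((m - K - (S - 2 * K)) + (m - K - Z) +
        if N < K + m ∧ 2 * K ≤ N ∨ N < 2 * K ∧ K < m then m - K
        else if N + 1 < 2 * m ∧ 2 * K ≤ N then N + 1 else 0)) % 2 = 0) :
    (e + pathExp X Y Z S N m K) % 2 = 0 := by
  unfold pathExp
  have h1 := fuseExp_mod_two X Y S K
  have h2 := fuseExp_mod_two (S - 2 * K) Z (N - 2 * K) (m - K)
  have h3 : ((if N - 2 * K < m - K then m - K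
      else if N - 2 * K + 1 < 2 * (m - K) then N - 2 * K + 1 else 0) : ℕ) % 2 =
      (if N < K + m ∧ 2 * K ≤ N ∨ N < 2 * K ∧ K < m then m - K
        else if N + 1 < 2 * m ∧ 2 * K ≤ N then N + 1 else 0) % 2 := by
    clear h h1 h2
    split_ifs <;> omega
  omega

theorem pathExp_equal_sum_sub_two_low (a K : ℕ) (hK : K ≤ 2 * a + 1) :
    (0 + pathExp (a + 1) (a + 1) (a + 1) (2 * a + 1) (3 * a + 1) (2 * a + 1) K) % 2 = 0 := by
  refine pathExp_even_of hK ?_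
  split_ifs <;> omega

theorem pathExp_equal_sum_sub_two_high (a K : ℕ) (hK : K ≤ 2 * a + 2) :
    (0 + pathExp (a + 1) (a + 1) (a + 1) (2 * a + 1) (3 * a + 1) (2 * a + 2) K) % 2 = 0 := by
  refine pathExp_even_of hK ?_
  split_ifs <;> omega

theorem pathExp_equal_sum_low (a K : ℕ) (hK : K ≤ 2 * a + 2) :
    (1 + pathExp (a + 1) (a + 1) (a + 1) (2 * a + 2) (3 * a + 3) (2 * a + 2) K) % 2 = 0 := by
  refine pathExp_even_of hK ?_
  split_ifs <;> omega

theorem pathExp_equal_sum_high (a K : ℕ) (hK : K ≤ 2 * a + 3) :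
    (1 + pathExp (a + 1) (a + 1) (a + 1) (2 * a + 2) (3 * a + 3) (2 * a + 3) K) % 2 = 0 := by
  refine pathExp_even_of hK ?_
  split_ifs <;> omega

theorem pathExp_low_sum_sub_two (a K : ℕ) (hK : K ≤ 2 * a + 3) :
    (0 + pathExp (a + 2) (a + 2) (a + 1) (2 * a + 3) (3 * a + 3) (2 * a + 3) K) % 2 = 0 := by
  refine pathExp_even_of hK ?_
  split_ifs <;> omega

theorem pathExp_low_sum (a K : ℕ) (hK : K ≤ 2 * a + 4) :
    (1 + pathExp (a + 2) (a + 2) (a + 1) (2 * a + 4) (3 * a + 5) (2 * a + 4) K) % 2 = 0 := by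
  refine pathExp_even_of hK ?_
  split_ifs <;> omega

theorem pathExp_high_sum_sub_two (a K : ℕ) (hK : K ≤ 2 * a + 2) :
    (0 + pathExp (a + 2) (a + 1) (a + 1) (2 * a + 2) (3 * a + 2) (2 * a + 2) K) % 2 = 0 := by
  refine pathExp_even_of hK ?_
  split_ifs <;> omega

theorem pathExp_high_sum (a K : ℕ) (hK : K ≤ 2 * a + 3) :
    (1 + pathExp (a + 2) (a + 1) (a + 1) (2 * a + 3) (3 * a + 4) (2 * a + 3) K) % 2 = 0 := by
  refine pathExp_even_of hK ?_
  split_ifs <;> omega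

/-! ### Types -/

/-- The ceilings of two reals and of their sum are compatible. -/
def Splits (X Y S : ℕ) : Prop :=
  S = X + Y ∨ (S + 1 = X + Y ∧ 1 ≤ X ∧ 1 ≤ Y) ∨ (Y = 0 ∧ S ≤ X) ∨ (X = 0 ∧ S ≤ Y)

theorem HasCeil.pos_part {x : ℝ} {c : ℕ} (h : HasCeil x c) (hc : 1 ≤ c) : (c : ℝ) - 1 < x :=
  h.2.resolve_left (by omega)

/-- If both ceilings are positive, lower `X` and `Y` by the same amount `(X + Y - s) / 2`, which
lies in `(0, 1)` whether or not the sum loses one. If one ceiling is `0`, a negative summand absorbs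
any difference. -/
theorem HasCeil.exists_split {s : ℝ} {X Y S : ℕ} (hs : HasCeil s S) (h : Splits X Y S) :
    ∃ a b, HasCeil a X ∧ HasCeil b Y ∧ a + b = s := by
  have zero_case : ∀ {X S : ℕ}, HasCeil s S → S ≤ X →
      ∃ a b, HasCeil a X ∧ HasCeil b 0 ∧ a + b = s := by
    intro X S hs hle
    rcases Nat.eq_zero_or_pos X with rfl | hX
    · obtain rfl : S = 0 := by omega
      have := hs.1
      simp only [Nat.cast_zero] at this
      exact ⟨s / 2, s / 2, ⟨by simp; linarith, Or.inl rfl⟩, ⟨by simp; linarith, Or.inl rfl⟩,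
        by ring⟩
    · have h1 := hs.1
      have h2 : (S : ℝ) ≤ X := by exact_mod_cast hle
      -- The summand with ceiling `X` must exceed `X - 1`, and it must exceed `s` for the other one
      -- to be negative. The midpoint of `t` and `X` does both.
      set t := max ((X : ℝ) - 1) s with ht
      have h3 : t < X := max_lt (by linarith) (by linarith)
      have h4 : (X : ℝ) - 1 ≤ t := le_max_left _ _
      have h5 : s ≤ t := le_max_right _ _
      refine ⟨(X + t) / 2, s - (X + t) / 2, ⟨by linarith, Or.inr (by linarith)⟩,
        ⟨by simp; linarith, Or.inl rfl⟩, by ring⟩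
  have add_case : S = X + Y → 1 ≤ X → 1 ≤ Y →
      ∃ a b, HasCeil a X ∧ HasCeil b Y ∧ a + b = s := by
    intro hS hX hY
    have h1 := hs.1
    have h2 := hs.pos_part (by omega)
    rw [hS] at h1 h2
    push_cast at h1 h2
    exact ⟨X - (X + Y - s) / 2, Y - (X + Y - s) / 2, ⟨by linarith, Or.inr (by linarith)⟩,
      ⟨by linarith, Or.inr (by linarith)⟩, by ring⟩
  rcases h with h | ⟨h, hX, hY⟩ | ⟨rfl, h⟩ | ⟨rfl, h⟩
  · rcases Nat.eq_zero_or_pos X with rfl | hX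
    · obtain ⟨a, b, ha, hb, hab⟩ := zero_case hs (show S ≤ Y by omega)
      exact ⟨b, a, hb, ha, by linarith⟩
    · rcases Nat.eq_zero_or_pos Y with rfl | hY
      · exact zero_case hs (by omega)
      · exact add_case h hX hY
  · have h1 := hs.1
    have h2 := hs.pos_part
    have h3 : (S : ℝ) + 1 = X + Y := by exact_mod_cast h
    have h4 := hs.pos_part (by omega)
    exact ⟨X - (X + Y - s) / 2, Y - (X + Y - s) / 2, ⟨by linarith, Or.inr (by linarith)⟩,
      ⟨by linarith, Or.inr (by linarith)⟩, by ring⟩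
  · exact zero_case hs h
  · obtain ⟨a, b, ha, hb, hab⟩ := zero_case hs h
    exact ⟨b, a, hb, ha, by linarith⟩

/-- Some highest weights have the given ceilings. -/
def Consistent (cs : List ℕ) (N : ℕ) : Prop := ∃ l, HasType l cs N

/-- Some highest weights with the given ceilings have a definite multiplicity space. -/
def DefT (e : ℕ) (cs : List ℕ) (N m : ℕ) : Prop := ∃ l, HasType l cs N ∧ DefL e l m

/-- By the deformation argument one choice of weights of the given type is as good as any other. -/
theorem HasType.defT_iff {l : List ℝ} {cs : List ℕ} {e N m : ℕ} (h : HasType l cs N) :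
    DefT e cs N m ↔ DefL e l m :=
  ⟨fun ⟨_, h', hd⟩ => DefL.of_hasType h' h hd, fun hd => ⟨l, h, hd⟩⟩

theorem DefT.consistent {cs : List ℕ} {e N m : ℕ} (h : DefT e cs N m) : Consistent cs N :=
  ⟨h.choose, h.choose_spec.1⟩

theorem hasCeil_exists (N : ℕ) : ∃ x, HasCeil x N :=
  ⟨N - 1 / 2, by linarith, Or.inr (by linarith)⟩

theorem consistent_singleton (N : ℕ) : Consistent [N] N := by
  obtain ⟨x, hx⟩ := hasCeil_exists N
  exact ⟨[x], by simpa using hx, by simpa using hx⟩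

theorem HasType.exists_split {l : List ℝ} {X Y S N : ℕ} {cs : List ℕ}
    (h : HasType l (S :: cs) N) (hs : Splits X Y S) :
    ∃ a b l', l = (a + b) :: l' ∧ HasCeil a X ∧ HasCeil b Y ∧ HasCeil (a + b) S ∧
      HasType (a :: b :: l') (X :: Y :: cs) N := by
  obtain ⟨h1, h2⟩ := h
  cases h1 with
  | cons hx hl =>
    obtain ⟨a, b, ha, hb, rfl⟩ := hx.exists_split hs
    exact ⟨a, b, _, rfl, ha, hb, hx, List.Forall₂.cons ha (List.Forall₂.cons hb hl),
      by simpa [add_assoc] using h2⟩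

theorem Consistent.split {X Y S N : ℕ} {cs : List ℕ} (h : Consistent (S :: cs) N)
    (hs : Splits X Y S) : Consistent (X :: Y :: cs) N := by
  obtain ⟨l, hl⟩ := h
  obtain ⟨a, b, l', -, -, -, -, h'⟩ := hl.exists_split hs
  exact ⟨_, h'⟩

theorem HasType.exists_perm {l : List ℝ} {cs cs' : List ℕ} {N : ℕ} (hp : cs.Perm cs')
    (h : HasType l cs N) : ∃ l', l.Perm l' ∧ HasType l' cs' N := by
  obtain ⟨h1, h2⟩ := h
  have : Relation.Comp List.Perm (List.Forall₂ HasCeil) l cs' := by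
    rw [← List.forall₂_comp_perm_eq_perm_comp_forall₂]
    exact ⟨cs, h1, hp⟩
  obtain ⟨l', hp', h'⟩ := this
  exact ⟨l', hp', h', by rwa [← hp'.sum_eq]⟩

theorem Consistent.perm {cs cs' : List ℕ} {N : ℕ} (hp : cs.Perm cs') (h : Consistent cs N) :
    Consistent cs' N := by
  obtain ⟨l, hl⟩ := h
  obtain ⟨l', -, h'⟩ := hl.exists_perm hp
  exact ⟨l', h'⟩

theorem DefT.perm {cs cs' : List ℕ} {e N m : ℕ} (hp : cs.Perm cs') (h : DefT e cs N m) :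
    DefT e cs' N m := by
  obtain ⟨l, hl, hd⟩ := h
  obtain ⟨l', hp', h'⟩ := hl.exists_perm hp
  exact ⟨l', h', hd.perm hp'⟩

theorem DefT.congr_mod {cs : List ℕ} {e f N m : ℕ} (hef : e % 2 = f % 2) (h : DefT e cs N m) :
    DefT f cs N m := by
  obtain ⟨l, hl, hd⟩ := h
  exact ⟨l, hl, Def.congr_mod hef hd⟩

theorem DefT.mod_eq {cs : List ℕ} {e f N m : ℕ} (hcs : 2 ≤ cs.length) (h : DefT e cs N m)
    (h' : DefT f cs N m) : e % 2 = f % 2 := by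
  obtain ⟨l, hl, hd⟩ := h
  exact DefL.mod_eq (by rwa [hl.1.length_eq]) hl.notNat hd (hl.defT_iff.1 h')

/-- The weights are chosen by starting from the merged type and splitting its first entry, so `S`
can be any compatible ceiling for which the merged type exists. -/
theorem DefT.merge {cs : List ℕ} {e N m X Y S : ℕ} (h : DefT e (X :: Y :: cs) N m)
    (hs : Splits X Y S) (hc : Consistent (S :: cs) N) : DefT e (S :: cs) N m := by
  obtain ⟨l, hl⟩ := hc
  obtain ⟨a, b, l', rfl, ha, hb, hab, h'⟩ := hl.exists_split hs
  refine ⟨_, hl, DefL.merge ha.notNat hb.notNat hab.notNat (fun x hx => ?_) (h'.defT_iff.1 h)⟩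
  exact h'.notNat x (by simp [hx])

theorem hasCeil_sub_two_mul {x : ℝ} {c : ℕ} (h : HasCeil x c) (k : ℕ) :
    HasCeil (x - 2 * k) (c - 2 * k) := by
  rw [hasCeil_iff, natCeil_sub_two_mul, h.ceil_eq]
  exact ⟨h.notNat.sub_two_mul k, rfl⟩

/-- Fusion in the constructive direction: one compatible `S` suffices. Subtracting `2k` from a
weight truncates its ceiling in `ℕ`, so the summands are again described by types. -/
theorem DefT.of_fuse {cs : List ℕ} {e N m X Y S : ℕ} (hs : Splits X Y S)
    (hc : Consistent (S :: cs) N)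
    (h : ∀ k ≤ m, DefT (e + fuseExp X Y S k) ((S - 2 * k) :: cs) (N - 2 * k) (m - k)) :
    DefT e (X :: Y :: cs) N m := by
  obtain ⟨l, hl⟩ := hc
  obtain ⟨a, b, l', rfl, ha, hb, hab, h'⟩ := hl.exists_split hs
  refine ⟨_, h', (defL_fuse e m ha.notNat hb.notNat hab.notNat fun x hx =>
    h'.notNat x (by simp [hx])).2 fun k hk => ?_⟩
  have ht : HasType ((a + b - 2 * k) :: l') ((S - 2 * k) :: cs) (N - 2 * k) := by
    obtain ⟨h1, h2⟩ := hl
    cases h1 with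
    | cons _ hl' =>
      refine ⟨List.Forall₂.cons (hasCeil_sub_two_mul hab k) hl', ?_⟩
      have := hasCeil_sub_two_mul h2 k
      rw [List.sum_cons] at this ⊢
      rwa [sub_add_eq_add_sub]
  rw [ha.ceil_eq, hb.ceil_eq, hab.ceil_eq]
  exact ht.defT_iff.1 (h k hk)

theorem exists_triple {X Y Z S N : ℕ} (h1 : Splits X Y S) (h2 : Splits S Z N) :
    ∃ a b c, HasCeil a X ∧ HasCeil b Y ∧ HasCeil c Z ∧ HasCeil (a + b) S ∧
      HasCeil (a + b + c) N := by
  obtain ⟨x, hx⟩ := hasCeil_exists N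
  obtain ⟨s, c, hs, hc, rfl⟩ := hx.exists_split h2
  obtain ⟨a, b, ha, hb, rfl⟩ := hs.exists_split h1
  exact ⟨a, b, c, ha, hb, hc, hs, hx⟩

/-- The left side does not mention `S`. A definite type therefore satisfies the parity conditions
for every compatible `S`, while one `S` is enough to prove definiteness. -/
theorem defT_triple_iff {e X Y Z S N m : ℕ} (h1 : Splits X Y S) (h2 : Splits S Z N) :
    DefT e [X, Y, Z] N m ↔ ∀ K ≤ m, (e + pathExp X Y Z S N m K) % 2 = 0 := by
  obtain ⟨a, b, c, ha, hb, hc, hab, habc⟩ := exists_triple h1 h2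
  have ht : HasType [a, b, c] [X, Y, Z] N := by
    refine ⟨by simp [ha, hb, hc], by simpa [add_assoc] using habc⟩
  rw [ht.defT_iff, defL_triple e m ha.notNat hb.notNat hc.notNat hab.notNat habc.notNat,
    ha.ceil_eq, hb.ceil_eq, hc.ceil_eq, hab.ceil_eq, habc.ceil_eq]

theorem defT_pair_iff {e X Y N m : ℕ} (h : Splits X Y N) :
    DefT e [X, Y] N m ↔ (e + fuseExp X Y N m) % 2 = 0 := by
  obtain ⟨x, hx⟩ := hasCeil_exists N
  obtain ⟨a, b, ha, hb, rfl⟩ := hx.exists_split h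
  have ht : HasType [a, b] [X, Y] N := ⟨by simp [ha, hb], by simpa using hx⟩
  rw [ht.defT_iff, defL_pair e m ha.notNat hb.notNat hx.notNat,
    ha.ceil_eq, hb.ceil_eq, hx.ceil_eq]

/-! ### Consistency of types -/

/-- Each weight is below its ceiling, and a positive one by less than `1`; summing gives both
bounds. -/
theorem HasType.bounds {l : List ℝ} {cs : List ℕ} {N : ℕ} (h : HasType l cs N) (hcs : cs ≠ []) :
    N ≤ cs.sum ∧ ((∀ c ∈ cs, 1 ≤ c) → cs.sum < N + cs.length) := by
  obtain ⟨h1, h2⟩ := h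
  have hlt : ∀ {l : List ℝ} {cs : List ℕ}, List.Forall₂ HasCeil l cs → cs ≠ [] →
      l.sum < (cs.sum : ℕ) := by
    intro l cs h
    induction h with
    | nil => simp
    | @cons x c l cs hx hl ih =>
      intro _
      rw [List.sum_cons, List.sum_cons, Nat.cast_add]
      cases hl with
      | nil => simpa using hx.1
      | cons hy hl => linarith [hx.1, ih (by simp)]
  have hgt : ∀ {l : List ℝ} {cs : List ℕ}, List.Forall₂ HasCeil l cs → (∀ c ∈ cs, 1 ≤ c) →
      (cs.sum : ℕ) ≤ l.sum + cs.length := by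
    intro l cs h
    induction h with
    | nil => simp
    | @cons x c l cs hx hl ih =>
      intro h
      have h3 := ih fun c hc => h c (by simp [hc])
      have h4 := hx.pos_part (h c (by simp))
      rw [List.sum_cons, List.sum_cons, Nat.cast_add, List.length_cons, Nat.cast_add]
      simp only [Nat.cast_one]
      linarith
  have h3 := hlt h1 hcs
  constructor
  · rcases Nat.eq_zero_or_pos N with rfl | hN
    · exact Nat.zero_le _
    · have h4 := h2.pos_part hN
      have : (N : ℝ) < (cs.sum + 1 : ℕ) := by push_cast; push_cast at h3; linarith
      have : N < cs.sum + 1 := by exact_mod_cast this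
      omega
  · intro h
    have h4 := hgt h1 h
    have : ((cs.sum : ℕ) : ℝ) < (N + cs.length : ℕ) := by
      push_cast; push_cast at h4; linarith [h2.1]
    exact_mod_cast this

theorem Consistent.bounds {cs : List ℕ} {N : ℕ} (h : Consistent cs N) (hcs : cs ≠ []) :
    N ≤ cs.sum ∧ ((∀ c ∈ cs, 1 ≤ c) → cs.sum < N + cs.length) :=
  h.choose_spec.bounds hcs

/-- The first two entries are joined, losing one as long as `N` is small enough to allow it. This
uses up the excess of the sum of the ceilings over `N`. -/
theorem consistent_of_pos {c : ℕ} {cs : List ℕ} {N : ℕ} (hc : 1 ≤ c) (h : ∀ x ∈ cs, 1 ≤ x)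
    (h1 : N ≤ c + cs.sum) (h2 : c + cs.sum < N + (cs.length + 1)) : Consistent (c :: cs) N := by
  induction cs generalizing c with
  | nil =>
    simp only [List.sum_nil, List.length_nil, add_zero, zero_add] at h1 h2
    obtain rfl : c = N := by omega
    exact consistent_singleton _
  | cons d cs ih =>
    have hd := h d (by simp)
    have h' : ∀ x ∈ cs, 1 ≤ x := fun x hx => h x (by simp [hx])
    rw [List.sum_cons] at h1 h2
    rw [List.length_cons] at h2
    by_cases hN : N ≤ c + d - 1 + cs.sum
    · exact (ih (c := c + d - 1) (by omega) h' hN (by omega)).split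
        (Or.inr (Or.inl ⟨by omega, hc, hd⟩))
    · exact (ih (c := c + d) (by omega) h' (by omega) (by omega)).split (Or.inl rfl)

theorem consistent_of_zero {cs : List ℕ} {N : ℕ} (h : N ≤ cs.sum) : Consistent (0 :: cs) N := by
  -- The entry `c` collects all positive ceilings, against which the negative weight adjusts the
  -- sum. The other entries are then split off `c` without loss.
  suffices H : ∀ (c : ℕ) (cs : List ℕ), N ≤ c + cs.sum → Consistent (c :: 0 :: cs) N by
    cases cs with
    | nil =>
      simp only [List.sum_nil, nonpos_iff_eq_zero] at h
      subst h
      exact consistent_singleton 0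
    | cons d cs => exact (H d cs (by simpa using h)).perm (List.Perm.swap _ _ _)
  intro c cs h
  induction cs generalizing c with
  | nil => exact (consistent_singleton N).split (Or.inr (Or.inr (Or.inl ⟨rfl, by simpa using h⟩)))
  | cons d cs ih =>
    have h1 := (ih (c + d) (by rw [List.sum_cons] at h; omega)).split
      (X := c) (Y := d) (Or.inl rfl)
    exact h1.perm (List.Perm.cons _ (List.Perm.swap _ _ _))

theorem consistent_of_mem_zero {cs : List ℕ} {N : ℕ} (h0 : 0 ∈ cs) (h : N ≤ cs.sum) :
    Consistent cs N := by
  have hp := List.perm_cons_erase h0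
  have hs := hp.sum_eq
  rw [List.sum_cons, zero_add] at hs
  exact (consistent_of_zero (hs ▸ h)).perm hp.symm

/-- Merging without loss needs the intermediate types to exist. A zero entry ensures this, since a
negative weight adapts to any admissible `N`. -/
theorem DefT.merge_list {e c N m : ℕ} {xs ys : List ℕ} (h : DefT e (c :: (xs ++ ys)) N m)
    (h0 : 0 ∈ (c + xs.sum) :: ys) : DefT e ((c + xs.sum) :: ys) N m := by
  induction xs generalizing c with
  | nil => simpa using h
  | cons x xs ih =>
    have hb := (h.consistent.bounds (by simp)).1
    rw [List.sum_cons, ← add_assoc] at h0 ⊢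
    refine ih (DefT.merge h (Or.inl rfl) (consistent_of_mem_zero ?_ ?_)) h0
    · rcases List.mem_cons.1 h0 with h0 | h0
      · have : c + x = 0 := by omega
        simp [this]
      · simp [h0]
    · simp only [List.cons_append, List.sum_cons] at hb ⊢
      omega

/-! ### Necessary conditions for definiteness -/

/-- Fusing the two negative weights first, the last two signs already give the bound, and `K = m`
gives the sign. -/
theorem DefT.two_neg {e A N m : ℕ} (hA : 1 ≤ A) (hm : 1 ≤ m) (h : DefT e [0, 0, A] N m) :
    2 * m ≤ N + 1 ∧ e % 2 = m % 2 := by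
  have hN : N ≤ A := by simpa using (h.consistent.bounds (by simp)).1
  have h1 := (defT_triple_iff (S := 0) (Or.inl rfl) (Or.inr (Or.inr (Or.inr ⟨rfl, hN⟩)))).1 h
  have p := parity_last_two hm h1
  have q := h1 m le_rfl
  rw [pathExp_self, fuseExp] at q
  clear h1
  constructor
  · clear q
    split_ifs at p <;> omega
  · clear p
    have h2 : min m (2 * m - 1 - 0) = m := by omega
    rw [h2] at q
    omega

/-- All three pairs may be fused first. The partial ceilings `N - B` and `N - A` are admissible
because the negative weight can be taken far from zero. For `N = 0` the two pairs containing the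
negative weight suffice. -/
theorem DefT.one_neg {e A B N m : ℕ} (hA : 1 ≤ A) (hB : 1 ≤ B) (hm : 1 ≤ m)
    (h : DefT e [A, B, 0] N m) :
    (N < m ∧ m ≤ A ∧ m ≤ B ∧ e % 2 = 0) ∨ (A = 1 ∧ B = 1 ∧ N = 2 ∧ m = 2 ∧ e % 2 = 1) := by
  have hN : N ≤ A + B := by simpa using (h.consistent.bounds (by simp)).1
  have hac := (defT_triple_iff (S := N - B) (Or.inr (Or.inr (Or.inl ⟨rfl, by omega⟩)))
    (by unfold Splits; omega)).1 (h.perm (List.Perm.cons A (List.Perm.swap 0 B [])))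
  have hbc := (defT_triple_iff (S := N - A) (Or.inr (Or.inr (Or.inl ⟨rfl, by omega⟩)))
    (by unfold Splits; omega)).1 (h.perm (cs' := [B, 0, A])
      ((List.Perm.swap B A [0]).trans (List.Perm.cons B (List.Perm.swap 0 A []))))
  rcases Nat.eq_zero_or_pos N with rfl | hN'
  · have p := parity_last_two hm hac
    have p' := parity_last_two hm hbc
    have q := hac m le_rfl
    rw [pathExp_self, fuseExp] at q
    clear hac hbc
    left
    have h2 : m ≤ A := by split_ifs at p <;> omega
    have h3 : m ≤ B := by split_ifs at p' <;> omega
    clear p p'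
    exact ⟨hm, h2, h3, by omega⟩
  · have hab := (defT_triple_iff (S := A + B) (Or.inl rfl)
      (Or.inr (Or.inr (Or.inl ⟨rfl, hN⟩)))).1 h
    exact bounds_of_one_neg hA hB hN' hm hN hab hac hbc

theorem DefT.excTriple {e A B C N m : ℕ} (h1 : B ≤ A) (h2 : C ≤ B) (h3 : 1 ≤ C) (hm : C < m)
    (h : DefT e [A, B, C] N m) : ExcTriple A B C N m e := by
  have hN := h.consistent.bounds (by simp)
  simp only [List.sum_cons, List.sum_nil, List.mem_cons, List.not_mem_nil, or_false,
    forall_eq_or_imp, forall_eq, List.length_cons, List.length_nil] at hN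
  have hN2 := hN.2 ⟨by omega, by omega, by omega⟩
  have hp : [A, B, C].Perm [B, C, A] := (List.Perm.swap B A [C]).trans
    (List.Perm.cons B (List.Perm.swap C A []))
  have key : ∀ {X Y Z S}, Splits X Y S → Splits S Z N → DefT e [X, Y, Z] N m →
      ∀ K ≤ m, (e + pathExp X Y Z S N m K) % 2 = 0 := fun a b c => (defT_triple_iff a b).1 c
  have hr : N = A + B + C ∨ N + 1 = A + B + C ∨ N + 2 = A + B + C := by omega
  rcases hr with hr | hr | hr
  · exact excTriple_of_sum h1 h2 h3 hm hr
      (key (Or.inl rfl) (Or.inl (by omega)) (h.perm hp)) (key (Or.inl rfl) (Or.inl (by omega)) h)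
  · exact (not_of_sum_sub_one h1 h2 h3 hm hr
      (key (Or.inr (Or.inl (by omega))) (Or.inl (by omega)) (h.perm hp))
      (key (Or.inl rfl) (Or.inr (Or.inl (by omega))) h)).elim
  · exact excTriple_of_sum_sub_two h1 h2 h3 hm hr
      (key (Or.inr (Or.inl (by omega))) (Or.inr (Or.inl (by omega))) (h.perm hp))
      (key (Or.inr (Or.inl (by omega))) (Or.inr (Or.inl (by omega))) h)

/-- All negative weights are merged into one, and all positive ones except `B` into another. -/
theorem DefT.to_one_neg {e A B N m : ℕ} {ps zs : List ℕ}
    (h : DefT e (A :: (ps ++ B :: 0 :: zs)) N m) (hz : ∀ z ∈ zs, z = 0) :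
    DefT e [A + ps.sum, B, 0] N m := by
  have hzs : zs.sum = 0 := List.sum_eq_zero hz
  have h1 : DefT e (0 :: (zs ++ (A :: (ps ++ [B])))) N m := by
    refine h.perm (List.perm_iff_count.2 fun x => ?_)
    simp only [List.count_cons, List.count_append, List.count_nil]
    omega
  have h2 := h1.merge_list (by simp [hzs])
  rw [hzs, add_zero] at h2
  have h3 : DefT e (A :: (ps ++ [B, 0])) N m := by
    refine h2.perm (List.perm_iff_count.2 fun x => ?_)
    simp only [List.count_cons, List.count_append, List.count_nil]
    omega
  exact h3.merge_list (by simp)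

theorem DefT.to_two_neg {e A N m : ℕ} {ps zs : List ℕ}
    (h : DefT e (A :: (ps ++ 0 :: 0 :: zs)) N m) (hz : ∀ z ∈ zs, z = 0) :
    DefT e [0, 0, A + ps.sum] N m := by
  have hzs : zs.sum = 0 := List.sum_eq_zero hz
  have h1 : DefT e (0 :: (zs ++ (A :: (ps ++ [0])))) N m := by
    refine h.perm (List.perm_iff_count.2 fun x => ?_)
    simp only [List.count_cons, List.count_append, List.count_nil]
    omega
  have h2 := h1.merge_list (by simp [hzs])
  rw [hzs, add_zero] at h2
  have h3 : DefT e (A :: (ps ++ [0, 0])) N m := by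
    refine h2.perm (List.perm_iff_count.2 fun x => ?_)
    simp only [List.count_cons, List.count_append, List.count_nil]
    omega
  refine (h3.merge_list (by simp)).perm (List.perm_iff_count.2 fun x => ?_)
  simp only [List.count_cons, List.count_nil]
  omega

/-- The exceptional definite levels for at least four positive highest weights. -/
def ExcLong (A B C D : ℕ) (rest : List ℕ) (N m e : ℕ) : Prop :=
  (rest = [] ∧ A = 1 ∧ B = 1 ∧ C = 1 ∧ D = 1 ∧ N = 4 ∧ m = 3 ∧ e % 2 = 1) ∨
  (rest = [] ∧ A = 2 ∧ B = 2 ∧ C = 2 ∧ D = 2 ∧ N = 5 ∧ m = 4 ∧ e % 2 = 0) ∨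
  ((∀ c ∈ rest, c = 1) ∧ A = 1 ∧ B = 1 ∧ C = 1 ∧ D = 1 ∧ N = 1 ∧ m = 2 ∧ e % 2 = 0) ∨
  ((∀ c ∈ rest, c = 1) ∧ A = 2 ∧ B = 1 ∧ C = 1 ∧ D = 1 ∧ N = 2 ∧ m = 2 ∧ e % 2 = 0)

theorem DefT.merge_pos {e A B N m f : ℕ} {cs : List ℕ} (h : DefT e (A :: B :: cs) N m)
    (hA : 1 ≤ A) (hB : 1 ≤ B) (hcs : ∀ c ∈ cs, 1 ≤ c) (hf : f ≤ 1)
    (h1 : N + f ≤ A + B + cs.sum) (h2 : A + B + cs.sum < N + f + (cs.length + 1)) :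
    DefT e ((A + B - f) :: cs) N m :=
  h.merge (by unfold Splits; omega) (consistent_of_pos (by omega) hcs (by omega) (by omega))

/-- In an exceptional triple the entries differ by at most one. For a triple with first entry `A +
B` or `A + B - 1` and last entry `D ≤ A, B`, this bounds `D`, and leaves finitely many quadruples.
-/
theorem excLong_base {A B C D N m e : ℕ} (h1 : B ≤ A) (h2 : C ≤ B) (h3 : D ≤ C) (hD : 1 ≤ D)
    (hm : D < m) (hN : N ≤ A + B + C + D) (hN' : A + B + C + D < N + 4)
    (k0 : A + B + C + D < N + 3 → ExcTriple (A + B) C D N m e)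
    (k1 : N + 1 ≤ A + B + C + D → ExcTriple (A + B - 1) C D N m e) :
    (A = 1 ∧ B = 1 ∧ C = 1 ∧ D = 1 ∧ N = 4 ∧ m = 3 ∧ e % 2 = 1) ∨
      (A = 2 ∧ B = 2 ∧ C = 2 ∧ D = 2 ∧ N = 5 ∧ m = 4 ∧ e % 2 = 0) ∨
      (A = 1 ∧ B = 1 ∧ C = 1 ∧ D = 1 ∧ N = 1 ∧ m = 2 ∧ e % 2 = 0) ∨
      (A = 2 ∧ B = 1 ∧ C = 1 ∧ D = 1 ∧ N = 2 ∧ m = 2 ∧ e % 2 = 0) := by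
  have c0 : ExcTriple (A + B) C D N m e → A = 1 ∧ B = 1 ∧ C = 1 ∧ D = 1 ∧
      ((N = 2 ∧ m = 2) ∨ (N = 4 ∧ m = 3 ∧ e % 2 = 1)) := by
    clear k0 k1 hN hN'
    rintro (⟨a1, a2, k⟩ | ⟨a1, a2, k⟩ | ⟨a1, a2, k⟩)
    · omega
    · omega
    · obtain ⟨rfl, rfl, rfl, rfl⟩ : A = 1 ∧ B = 1 ∧ C = 1 ∧ D = 1 := by clear k; omega
      omega
  have c1 : ExcTriple (A + B - 1) C D N m e →
      (A = 1 ∧ B = 1 ∧ C = 1 ∧ D = 1 ∧ ((N = 1 ∧ m = 2 ∧ e % 2 = 0) ∨ N = 3)) ∨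
      (A = 2 ∧ B = 2 ∧ C = 2 ∧ D = 2 ∧ ((N = 5 ∧ m = 4 ∧ e % 2 = 0) ∨ N = 7)) ∨
      (A = 2 ∧ B = 1 ∧ C = 1 ∧ D = 1 ∧ ((N = 2 ∧ m = 2 ∧ e % 2 = 0) ∨ N = 4)) := by
    clear k0 k1 hN hN' c0
    rintro (⟨a1, a2, k⟩ | ⟨a1, a2, k⟩ | ⟨a1, a2, k⟩)
    · left
      obtain ⟨rfl, rfl, rfl, rfl⟩ : A = 1 ∧ B = 1 ∧ C = 1 ∧ D = 1 := by clear k; omega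
      omega
    · omega
    · right
      have : (A = 2 ∧ B = 2 ∧ C = 2 ∧ D = 2) ∨ (A = 2 ∧ B = 1 ∧ C = 1 ∧ D = 1) := by
        clear k; omega
      rcases this with ⟨rfl, rfl, rfl, rfl⟩ | ⟨rfl, rfl, rfl, rfl⟩ <;> omega
  by_cases hr : N + 1 ≤ A + B + C + D
  · have k2 := c1 (k1 hr)
    -- If both merges exist, the one without loss requires unit ceilings and `N = 2` or `4`, the
    -- other then `N = 1` or `3`.
    by_cases hr' : A + B + C + D < N + 3
    · have k3 := c0 (k0 hr')
      clear c0 c1 k0 k1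
      obtain ⟨rfl, rfl, rfl, rfl, k⟩ := k3
      exfalso
      rcases k2 with ⟨-, -, -, -, k'⟩ | ⟨h, -⟩ | ⟨h, -⟩
      · omega
      · omega
      · omega
    · clear c0 c1 k0 k1
      rcases k2 with ⟨rfl, rfl, rfl, rfl, k⟩ | ⟨rfl, rfl, rfl, rfl, k⟩ | ⟨rfl, rfl, rfl, rfl, k⟩ <;>
        omega
  · have k3 := c0 (k0 (by omega))
    clear c0 c1 k0 k1
    obtain ⟨rfl, rfl, rfl, rfl, k⟩ := k3
    left
    omega

/-- Merging the two largest ceilings keeps the list sorted and reduces to one factor fewer. Five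
unit ceilings with `N = 4` are excluded by the merge without loss, and the quadruple of twos cannot
arise from a merge; only the two families of ones persist. -/
theorem DefT.excLong {e A B C D N m : ℕ} {rest : List ℕ} (h1 : B ≤ A) (h2 : C ≤ B) (h3 : D ≤ C)
    (h4 : (D :: rest).Pairwise (· ≥ ·)) (h5 : ∀ c ∈ D :: rest, 1 ≤ c) (hm : ∃ c ∈ D :: rest, c < m)
    (h : DefT e (A :: B :: C :: D :: rest) N m) : ExcLong A B C D rest N m e := by
  induction rest generalizing A B C D with
  | nil =>
    have hD : 1 ≤ D := h5 D (by simp)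
    have hm' : D < m := by simpa using hm
    have hN := h.consistent.bounds (by simp)
    simp only [List.sum_cons, List.sum_nil, List.mem_cons, List.not_mem_nil, or_false,
      forall_eq_or_imp, forall_eq, List.length_cons, List.length_nil] at hN
    have hN2 := hN.2 ⟨by omega, by omega, by omega, by omega⟩
    have key : ∀ f ≤ 1, N + f ≤ A + B + (C + D) → A + B + (C + D) < N + f + 3 →
        ExcTriple (A + B - f) C D N m e := by
      intro f hf k1 k2
      exact DefT.excTriple (by omega) h3 hD hm' (h.merge_pos (by omega) (by omega)
        (by simp; omega) hf (by simpa using k1) (by simpa using k2))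
    have k0 := key 0 (by omega)
    have k1 := key 1 le_rfl
    clear key h h4 h5 hm
    unfold ExcLong
    simp only [true_and, List.not_mem_nil, false_imp_iff, implies_true]
    exact excLong_base h1 h2 h3 hD hm' (by omega) (by omega) (fun h => k0 (by omega) (by omega))
      (fun h => k1 (by omega) (by omega))
  | cons E rest ih =>
    have hD : 1 ≤ D := h5 D (by simp)
    have hE : 1 ≤ E := h5 E (by simp)
    have hED : E ≤ D := by
      rw [List.pairwise_cons] at h4
      exact h4.1 E (by simp)
    have hN := h.consistent.bounds (by simp)
    simp only [List.sum_cons, List.length_cons] at hN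
    have hN2 := hN.2 (by
      intro c hc
      simp only [List.mem_cons] at hc h5
      rcases hc with rfl | rfl | rfl | hc
      · omega
      · omega
      · omega
      · exact h5 c hc)
    have hm' : ∃ c ∈ E :: rest, c < m := by
      obtain ⟨c, hc, hcm⟩ := hm
      rcases List.mem_cons.1 hc with rfl | hc
      · exact ⟨E, by simp, by omega⟩
      · exact ⟨c, hc, hcm⟩
    have key : ∀ f ≤ 1, N + f ≤ A + B + (C + (D + (E + rest.sum))) →
        A + B + (C + (D + (E + rest.sum))) < N + f + (rest.length + 4) →
        ExcLong (A + B - f) C D E rest N m e := by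
      intro f hf k1 k2
      refine ih (by omega) h3 hED (List.pairwise_cons.1 h4).2 (fun c hc => h5 c (by simp [hc])) hm'
        (h.merge_pos (by omega) (by omega) ?_ hf (by simpa using k1) (by simpa using k2))
      intro c hc
      rcases List.mem_cons.1 hc with rfl | hc
      · omega
      · exact h5 c hc
    have k0 := key 0 (by omega)
    have k1 := key 1 le_rfl
    have hlen : rest = [] → rest.sum = 0 ∧ rest.length = 0 := by rintro rfl; simp
    have hmem : (∀ c ∈ E :: rest, c = 1) ↔ E = 1 ∧ ∀ c ∈ rest, c = 1 := by simp
    have hsum : (∀ c ∈ rest, c = 1) → rest.sum = rest.length := fun hr => by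
      have := List.eq_replicate_of_mem hr
      rw [this]; simp
    clear key h h4 h5 hm hm' ih
    unfold ExcLong at k0 k1 ⊢
    rw [hmem]
    generalize (∀ c ∈ rest, c = 1) = R at *
    generalize (rest = []) = R' at *
    generalize rest.sum = s at *
    generalize rest.length = t at *
    simp only [reduceCtorEq, false_and, false_or]
    by_cases hr : N + 1 ≤ A + B + (C + (D + (E + s)))
    · have k2 := k1 hr (by omega)
      clear k1
      rcases k2 with k | k | k | k
      · have := k0 (by omega) (by have := hlen k.1; omega)
        omega
      · omega
      · have := hsum k.1
        left
        refine ⟨⟨?_, k.1⟩, ?_⟩ <;> omega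
      · have := hsum k.1
        right
        refine ⟨⟨?_, k.1⟩, ?_⟩ <;> omega
    · have := k0 (by omega) (by omega)
      omega

/-! ### Sufficient conditions for definiteness -/

theorem Consistent.defT_zero {cs : List ℕ} {N : ℕ} (h : Consistent cs N) : DefT 0 cs N 0 := by
  obtain ⟨l, hl⟩ := h
  exact ⟨l, hl, def_level_zero _⟩

theorem neg_one_pow_sum_mul_prodNorm_pos {ι : Type*} [Fintype ι] {lam : ι → ℝ}
    (h : ∀ i, NotNat (lam i)) (k : ι → ℕ) :
    0 < (-1) ^ (∑ i, (k i - ⌈lam i⌉₊)) * prodNorm lam k := by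
  rw [prodNorm, ← Finset.prod_pow_eq_pow_sum, ← Finset.prod_mul_distrib]
  exact Finset.prod_pos fun i _ => shapNorm_sign (h i) (k i)

theorem def_neg {n : ℕ} {lam : Fin n → ℝ} (h : ∀ i, lam i < 0) (m : ℕ) : Def m lam m := by
  refine def_of_prodNorm_sign fun k hk => ?_
  have := neg_one_pow_sum_mul_prodNorm_pos (fun i => NotNat.of_neg (h i)) k
  simp only [fun i => Nat.ceil_eq_zero.2 (h i).le, Nat.sub_zero, hk] at this
  exact this

/-- Each index of a basis vector of degree `m` is at most `m`, hence at most the ceiling of its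
weight, so no factor of the norms is negative. -/
theorem def_of_le_ceil {n : ℕ} {lam : Fin n → ℝ} (h : ∀ i, NotNat (lam i)) {m : ℕ}
    (hm : ∀ i, m ≤ ⌈lam i⌉₊) : Def 0 lam m := by
  refine def_of_prodNorm_sign fun k hk => ?_
  have := neg_one_pow_sum_mul_prodNorm_pos h k
  have h0 : ∑ i, (k i - ⌈lam i⌉₊) = 0 := Finset.sum_eq_zero fun i _ => by
    have h1 := Finset.single_le_sum (f := k) (fun j _ => Nat.zero_le _) (Finset.mem_univ i)
    have := hm i
    omega
  rwa [h0] at this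

/-- One positive highest weight, with ceiling `A`. -/
theorem defT_one_pos {A N m k : ℕ} (hN : N ≤ A) (hm : m = 0 ∨ 2 * m ≤ N + 1) :
    DefT m (0 :: (List.replicate k 0 ++ [A])) N m := by
  induction k generalizing N m with
  | zero =>
    rw [List.replicate_zero, List.nil_append,
      defT_pair_iff (Or.inr (Or.inr (Or.inr ⟨rfl, hN⟩)))]
    unfold fuseExp
    omega
  | succ k ih =>
    rw [List.replicate_succ, List.cons_append]
    -- Two negative weights fuse to negative ones, with sign `(-1)^j` at level `j`. This matches the
    -- change of the sign from level `m` to level `m - j`.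
    refine DefT.of_fuse (S := 0) (Or.inl rfl) (consistent_of_zero (by simpa using hN))
      fun j hj => ?_
    rw [Nat.zero_sub]
    refine (ih (N := N - 2 * j) (m := m - j) (by omega) (by omega)).congr_mod ?_
    unfold fuseExp
    omega

/-- One negative highest weight. -/
theorem defT_one_neg {Z N m : ℕ} {ps : List ℕ} (hN : N ≤ Z) (hm : m = 0 ∨ N + 1 ≤ m)
    (hZ : m ≤ Z) (hps : ∀ c ∈ ps, m ≤ c) : DefT 0 (0 :: (ps ++ [Z])) N m := by
  induction ps generalizing N m with
  | nil =>
    rw [List.nil_append, defT_pair_iff (Or.inr (Or.inr (Or.inr ⟨rfl, hN⟩)))]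
    unfold fuseExp
    omega
  | cons x ps ih =>
    have hx : m ≤ x := hps x (by simp)
    -- The negative weight is taken so negative that its sum with the positive one stays negative.
    -- As `j ≤ m ≤ x`, the fusion exponent is then `2j`, so no sign appears.
    refine DefT.of_fuse (S := 0) (Or.inr (Or.inr (Or.inr ⟨rfl, Nat.zero_le _⟩)))
      (consistent_of_zero (by simp; omega)) fun j hj => ?_
    rw [Nat.zero_sub]
    refine (ih (N := N - 2 * j) (m := m - j) (by omega) (by omega) (by omega) fun c hc => ?_).congr_mod ?_
    · have := hps c (by simp [hc])
      omega
    · unfold fuseExp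
      omega

/-! ### Existence of the exceptional definite spaces. -/

theorem defT_one_one_zero : DefT 1 [1, 1, 0] 2 2 := by
  rw [defT_triple_iff (S := 2) (by unfold Splits; omega) (by unfold Splits; omega)]
  decide

theorem ExcTriple.defT {A B C N m e : ℕ} (hC : 1 ≤ C) (h : ExcTriple A B C N m e) :
    DefT e [A, B, C] N m := by
  have key : ∀ {S f : ℕ}, Splits A B S → Splits S C N → e % 2 = f % 2 →
      (∀ K ≤ m, (f + pathExp A B C S N m K) % 2 = 0) → DefT e [A, B, C] N m :=
    fun h1 h2 h3 h4 => ((defT_triple_iff h1 h2).2 h4).congr_mod h3.symm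
  rcases h with ⟨rfl, rfl, ⟨h1, h2, h3⟩ | ⟨h1, h2, h3⟩⟩ | ⟨rfl, rfl, ⟨h1, h2, h3⟩ | ⟨h1, h2, h3⟩⟩ |
    ⟨rfl, rfl, ⟨h1, h2, h3⟩ | ⟨h1, h2, h3⟩⟩
  · obtain ⟨a, rfl⟩ : ∃ a, A = a + 1 := ⟨A - 1, by omega⟩
    obtain rfl : N = 3 * a + 1 := by omega
    refine key (S := 2 * a + 1) (f := 0) (by unfold Splits; omega) (by unfold Splits; omega) h2 ?_
    rcases h3 with h3 | h3
    · obtain rfl : m = 2 * a + 1 := by omega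
      exact pathExp_equal_sum_sub_two_low a
    · obtain rfl : m = 2 * a + 2 := by omega
      exact pathExp_equal_sum_sub_two_high a
  · obtain ⟨a, rfl⟩ : ∃ a, A = a + 1 := ⟨A - 1, by omega⟩
    obtain rfl : N = 3 * a + 3 := by omega
    refine key (S := 2 * a + 2) (f := 1) (by unfold Splits; omega) (by unfold Splits; omega) h2 ?_
    rcases h3 with h3 | h3
    · obtain rfl : m = 2 * a + 2 := by omega
      exact pathExp_equal_sum_low a
    · obtain rfl : m = 2 * a + 3 := by omega
      exact pathExp_equal_sum_high a
  · obtain ⟨a, rfl⟩ : ∃ a, C = a + 1 := ⟨C - 1, by omega⟩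
    obtain rfl : N = 3 * a + 3 := by omega
    obtain rfl : m = 2 * a + 3 := by omega
    exact key (S := 2 * a + 3) (f := 0) (by unfold Splits; omega) (by unfold Splits; omega) h2
      (pathExp_low_sum_sub_two a)
  · obtain ⟨a, rfl⟩ : ∃ a, C = a + 1 := ⟨C - 1, by omega⟩
    obtain rfl : N = 3 * a + 5 := by omega
    obtain rfl : m = 2 * a + 4 := by omega
    exact key (S := 2 * a + 4) (f := 1) (by unfold Splits; omega) (by unfold Splits; omega) h2
      (pathExp_low_sum a)
  · obtain ⟨a, rfl⟩ : ∃ a, B = a + 1 := ⟨B - 1, by omega⟩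
    obtain rfl : N = 3 * a + 2 := by omega
    obtain rfl : m = 2 * a + 2 := by omega
    exact key (S := 2 * a + 2) (f := 0) (by unfold Splits; omega) (by unfold Splits; omega) h2
      (pathExp_high_sum_sub_two a)
  · obtain ⟨a, rfl⟩ : ∃ a, B = a + 1 := ⟨B - 1, by omega⟩
    obtain rfl : N = 3 * a + 4 := by omega
    obtain rfl : m = 2 * a + 3 := by omega
    exact key (S := 2 * a + 3) (f := 1) (by unfold Splits; omega) (by unfold Splits; omega) h2
      (pathExp_high_sum a)

/-- With partial ceiling `2` the summands are an exceptional positive triple, the exceptional triple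
with one negative weight, an ordinary level with one negative weight, and a level zero. -/
theorem defT_ones_four : DefT 1 [1, 1, 1, 1] 4 3 := by
  refine DefT.of_fuse (S := 2) (Or.inl rfl)
    (consistent_of_pos (by norm_num) (by simp) (by simp) (by simp)) fun k hk => ?_
  interval_cases k
  · exact ExcTriple.defT le_rfl (by unfold ExcTriple; decide)
  · exact (defT_one_one_zero.perm (by decide)).congr_mod (by decide)
  · exact (defT_one_neg (ps := [1]) (Z := 1) (N := 0) (m := 1) (by simp) (by simp) (by simp)
      (by simp)).congr_mod (by decide)
  · exact (consistent_of_zero (by simp)).defT_zero.congr_mod (by decide)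

theorem defT_twos_four : DefT 0 [2, 2, 2, 2] 5 4 := by
  refine DefT.of_fuse (S := 3) (by unfold Splits; omega)
    (consistent_of_pos (by norm_num) (by simp) (by simp) (by simp)) fun k hk => ?_
  interval_cases k
  · exact ExcTriple.defT (by norm_num) (by unfold ExcTriple; decide)
  · exact ((ExcTriple.defT (A := 2) (B := 2) (C := 1) (N := 3) (m := 3) (e := 0) le_rfl
      (by unfold ExcTriple; decide)).perm (by decide)).congr_mod (by decide)
  · exact (defT_one_neg (ps := [2]) (Z := 2) (N := 1) (m := 2) (by simp) (by simp) (by simp)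
      (by simp)).congr_mod (by decide)
  · exact (defT_one_neg (ps := [2]) (Z := 2) (N := 0) (m := 1) (by simp) (by simp) (by simp)
      (by simp)).congr_mod (by decide)
  · exact (consistent_of_zero (by simp)).defT_zero.congr_mod (by decide)

/-- Joining two unit ceilings into one reproduces the family with one factor fewer at `k = 0`. The
other summands have a negative weight and level at most `1`. The induction starts at an exceptional
triple. -/
theorem defT_ones (j : ℕ) : DefT 0 (1 :: (List.replicate (j + 1) 1 ++ [1])) 1 2 := by
  induction j with
  | zero => exact ExcTriple.defT le_rfl (by unfold ExcTriple; decide)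
  | succ j ih =>
    rw [List.replicate_succ, List.cons_append]
    refine DefT.of_fuse (S := 1) (by unfold Splits; omega) ih.consistent fun k hk => ?_
    have hone : ∀ c ∈ List.replicate (j + 1) 1, 1 ≤ c := fun c hc =>
      (List.eq_of_mem_replicate hc).ge
    interval_cases k
    · exact ih
    · exact (defT_one_neg (N := 0) (m := 1) (by simp) (by simp) le_rfl hone).congr_mod (by decide)
    · exact (consistent_of_zero (by simp)).defT_zero.congr_mod (by decide)

theorem defT_two_ones (j : ℕ) : DefT 0 (2 :: (List.replicate (j + 1) 1 ++ [1])) 2 2 := by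
  induction j with
  | zero => exact ExcTriple.defT le_rfl (by unfold ExcTriple; decide)
  | succ j ih =>
    rw [List.replicate_succ, List.cons_append]
    refine DefT.of_fuse (S := 2) (by unfold Splits; omega) ih.consistent fun k hk => ?_
    have hone : ∀ c ∈ List.replicate (j + 1) 1, 1 ≤ c := fun c hc =>
      (List.eq_of_mem_replicate hc).ge
    interval_cases k
    · exact ih
    · exact (defT_one_neg (N := 0) (m := 1) (by simp) (by simp) le_rfl hone).congr_mod (by decide)
    · exact (consistent_of_zero (by simp)).defT_zero.congr_mod (by decide)

theorem replicate_append_one (j : ℕ) :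
    List.replicate (j + 1) 1 ++ [1] = 1 :: 1 :: List.replicate j 1 := by
  rw [← List.replicate_succ', List.replicate_succ, List.replicate_succ]

theorem ExcLong.defT {A B C D N m e : ℕ} {rest : List ℕ} (h : ExcLong A B C D rest N m e) :
    DefT e (A :: B :: C :: D :: rest) N m := by
  rcases h with ⟨rfl, rfl, rfl, rfl, rfl, rfl, rfl, he⟩ | ⟨rfl, rfl, rfl, rfl, rfl, rfl, rfl, he⟩ |
    ⟨hr, rfl, rfl, rfl, rfl, rfl, rfl, he⟩ | ⟨hr, rfl, rfl, rfl, rfl, rfl, rfl, he⟩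
  · exact defT_ones_four.congr_mod (by omega)
  · exact defT_twos_four.congr_mod (by omega)
  · have h := defT_ones (rest.length + 1)
    rw [replicate_append_one, List.replicate_succ, ← List.eq_replicate_of_mem hr] at h
    exact h.congr_mod (by omega)
  · have h := defT_two_ones (rest.length + 1)
    rw [replicate_append_one, List.replicate_succ, ← List.eq_replicate_of_mem hr] at h
    exact h.congr_mod (by omega)

/-! ### The sign function for two factors -/

theorem HasCeil.int_ceil {x : ℝ} {c : ℕ} (h : HasCeil x c) (hc : 1 ≤ c) : ⌈x⌉ = c := by
  rw [Int.ceil_eq_iff]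
  push_cast
  exact ⟨h.pos_part hc, h.1.le⟩

theorem HasCeil.int_floor {x : ℝ} {c : ℕ} (h : HasCeil x c) (hc : 1 ≤ c) : ⌊x⌋ = c - 1 := by
  rw [Int.floor_eq_iff]
  push_cast
  have := h.1
  exact ⟨(h.pos_part hc).le, by linarith⟩

theorem HasCeil.zero_lt_iff {x : ℝ} {c : ℕ} (h : HasCeil x c) : 1 ≤ c ↔ 0 < x := by
  constructor
  · intro hc
    have := h.pos_part hc
    have : (1 : ℝ) ≤ c := by exact_mod_cast hc
    linarith
  · intro hx
    have : (0 : ℝ) < c := hx.trans h.1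
    exact_mod_cast this

theorem HasCeil.eq_zero_iff {x : ℝ} {c : ℕ} (h : HasCeil x c) : c = 0 ↔ x < 0 := by
  have h0 : x ≠ 0 := by simpa using h.notNat 0
  have := h.zero_lt_iff
  constructor
  · intro hc
    have : ¬ 0 < x := by rw [← this]; omega
    exact lt_of_le_of_ne (not_lt.1 this) h0
  · intro hx
    have : ¬ 1 ≤ c := by rw [this]; exact hx.not_gt
    omega

theorem sign_choose {x : ℝ} {c : ℕ} (h : HasCeil x c) (k : ℕ) :
    ((SignType.sign (Ring.choose x k) : SignType) : ℤ) = (-1) ^ (k - c) := by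
  have h1 := shapNorm_sign h.notNat k
  rw [h.ceil_eq, shapNorm_eq_choose] at h1
  have hf : (0 : ℝ) < ((k.factorial : ℝ)) ^ 2 := by positivity
  have h2 : 0 < (-1) ^ (k - c) * Ring.choose x k := by
    refine pos_of_mul_pos_right (a := ((k.factorial : ℝ)) ^ 2) ?_ hf.le
    linarith
  rcases Nat.even_or_odd (k - c) with he | ho
  · rw [he.neg_one_pow] at h2 ⊢
    rw [sign_pos (by linarith)]
    rfl
  · rw [ho.neg_one_pow] at h2 ⊢
    rw [sign_neg (by linarith)]
    rfl

theorem half_bounds {s : ℝ} {N : ℕ} (h : HasCeil s N) (hN : 1 ≤ N) :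
    ⌊s / 2⌋ = (((N - 1) / 2 : ℕ) : ℤ) ∧ ⌈s / 2⌉ = (((N + 1) / 2 : ℕ) : ℤ) ∧
      ⌊(s + 1) / 2⌋ = ((N / 2 : ℕ) : ℤ) ∧ ⌈(s + 1) / 2⌉ = (((N + 2) / 2 : ℕ) : ℤ) := by
  have h1 := h.1
  have h2 := h.pos_part hN
  have c1 : (2 * ((N - 1) / 2 : ℕ) : ℝ) ≤ N - 1 := by
    have : 2 * ((N - 1) / 2) + 1 ≤ N := by omega
    have : ((2 * ((N - 1) / 2) + 1 : ℕ) : ℝ) ≤ N := by exact_mod_cast this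
    push_cast at this
    linarith
  have c2 : (N : ℝ) ≤ 2 * ((N - 1) / 2 : ℕ) + 2 := by
    have : N ≤ 2 * ((N - 1) / 2) + 2 := by omega
    exact_mod_cast this
  have c3 : ((N + 1) / 2 : ℕ) = (N - 1) / 2 + 1 := by omega
  have c4 : (2 * (N / 2 : ℕ) : ℝ) ≤ N := by
    have : 2 * (N / 2) ≤ N := by omega
    exact_mod_cast this
  have c5 : (N : ℝ) ≤ 2 * (N / 2 : ℕ) + 1 := by
    have : N ≤ 2 * (N / 2) + 1 := by omega
    exact_mod_cast this
  have c6 : ((N + 2) / 2 : ℕ) = N / 2 + 1 := by omega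
  refine ⟨?_, ?_, ?_, ?_⟩
  · rw [Int.floor_eq_iff]
    rw [Int.cast_natCast]
    constructor <;> linarith
  · rw [Int.ceil_eq_iff, c3, Int.cast_natCast, Nat.cast_add_one]
    constructor <;> linarith
  · rw [Int.floor_eq_iff]
    rw [Int.cast_natCast]
    constructor <;> linarith
  · rw [Int.ceil_eq_iff, c6, Int.cast_natCast, Nat.cast_add_one]
    constructor <;> linarith

theorem neg_one_pow_congr {a b : ℕ} (h : a % 2 = b % 2) : (-1 : ℤ) ^ a = (-1) ^ b := by
  rw [neg_one_pow_eq_pow_mod_two, h, ← neg_one_pow_eq_pow_mod_two]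

theorem negOnePow_natCast (a : ℕ) : ((a : ℤ).negOnePow : ℤ) = (-1) ^ a := by
  simp [Int.negOnePow_def]

/-- The ranges in the definition of `gNeg` are those on which the truncated terms of `fuseExp` have
constant linear form, up to coinciding parities; the halves of the sum come from the threshold `2k -
1 > N`. -/
theorem gNeg_eq {x y : ℝ} {A N : ℕ} (hx : HasCeil x A) (hy : y < 0) (hs : HasCeil (x + y) N)
    (k : ℕ) : gNeg x y k = (-1) ^ fuseExp A 0 N k := by
  have hNA : N ≤ A := by
    have h1 : ⌈x + y⌉₊ ≤ ⌈x⌉₊ := Nat.ceil_mono (by linarith)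
    rwa [hx.ceil_eq, hs.ceil_eq] at h1
  unfold gNeg
  split_ifs with h1 h2 h3 h4 h5 h6
  · obtain rfl : A = 0 := hx.eq_zero_iff.2 h1
    refine neg_one_pow_congr ?_
    unfold fuseExp
    omega
  · obtain rfl : N = 0 := hs.eq_zero_iff.2 h2
    rw [sign_choose hx]
    refine neg_one_pow_congr ?_
    unfold fuseExp
    omega
  all_goals
    have hN : 1 ≤ N := by
      have := hs.eq_zero_iff.not.2 h2
      omega
    obtain ⟨b1, b2, b3, b4⟩ := half_bounds hs hN
    have b5 := hs.int_ceil hN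
    have b6 := hx.int_ceil (by omega)
    simp only [b1, b2, b3, b4, b5, b6] at *
  · refine neg_one_pow_congr ?_
    unfold fuseExp
    omega
  · rw [negOnePow_natCast]
    refine neg_one_pow_congr ?_
    unfold fuseExp
    omega
  · rw [← Nat.cast_add, ← Nat.cast_add, negOnePow_natCast]
    refine neg_one_pow_congr ?_
    have e1 : (N + 1) / 2 + (N + 2) / 2 + k = N + 1 + k := by omega
    have e2 : N + 1 ≤ 2 * k := by omega
    have e3 : k ≤ N := by omega
    rw [e1]
    clear * - e2 e3 hNA
    unfold fuseExp
    omega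
  · refine (Even.neg_one_pow ?_).symm
    rw [Nat.even_iff]
    unfold fuseExp
    omega
  · rw [← Nat.cast_add, negOnePow_natCast]
    refine neg_one_pow_congr ?_
    unfold fuseExp
    omega

/-- For two positive weights, shifting `y` by `2B` and the level by `B` reduces the middle ranges to
one negative weight. Only the sign is asserted because `g` need not be `±1` there. -/
theorem g_sign {x y : ℝ} {A B N : ℕ} (hx : HasCeil x A) (hy : HasCeil y B)
    (hs : HasCeil (x + y) N) (hBA : B ≤ A) (k : ℕ) :
    (0 < g x y k ↔ fuseExp A B N k % 2 = 0) ∧ (g x y k < 0 ↔ fuseExp A B N k % 2 = 1) := by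
  have pow_sign : ∀ a : ℕ, (0 < (-1 : ℤ) ^ a ↔ a % 2 = 0) ∧ ((-1 : ℤ) ^ a < 0 ↔ a % 2 = 1) := by
    intro a
    rcases Nat.even_or_odd a with h | h
    · rw [h.neg_one_pow]
      have := Nat.even_iff.1 h
      simp [this]
    · rw [h.neg_one_pow]
      have := Nat.odd_iff.1 h
      simp [this]
  have pow_cases : ∀ a : ℕ, (a % 2 = 0 ∧ (-1 : ℤ) ^ a = 1) ∨ (a % 2 = 1 ∧ (-1 : ℤ) ^ a = -1) := by
    intro a
    rcases Nat.even_or_odd a with h | h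
    · exact Or.inl ⟨Nat.even_iff.1 h, h.neg_one_pow⟩
    · exact Or.inr ⟨Nat.odd_iff.1 h, h.neg_one_pow⟩
  unfold g
  by_cases h0 : y < 0
  · obtain rfl : B = 0 := hy.eq_zero_iff.2 h0
    rw [if_pos h0, gNeg_eq hx h0 hs]
    exact pow_sign _
  · have hB : 1 ≤ B := by
      have := hy.eq_zero_iff.not.2 h0
      omega
    have hNub : N ≤ A + B := by
      have : (N : ℝ) < (A + B + 1 : ℕ) := by
        push_cast
        have h1 := hx.1
        have h2 := hy.1
        rcases Nat.eq_zero_or_pos N with h | h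
        · rw [h]; simp; positivity
        · have := hs.pos_part h
          linarith
      have : N < A + B + 1 := by exact_mod_cast this
      omega
    have hNlb : A + B ≤ N + 1 := by
      have : ((A + B : ℕ) : ℝ) < (N + 2 : ℕ) := by
        push_cast
        have h1 := hx.pos_part (by omega)
        have h2 := hy.pos_part hB
        have h3 := hs.1
        linarith
      have : A + B < N + 2 := by exact_mod_cast this
      omega
    have c1 := hx.int_ceil (by omega)
    have c2 := hy.int_ceil hB
    have f1 := hx.int_floor (by omega)
    have f2 := hy.int_floor hB
    have f3 := hs.int_floor (by omega)
    have hgn : gNeg x (y - 2 * (⌈y⌉ : ℤ)) (k - ⌈y⌉₊) = (-1) ^ fuseExp A 0 (N - 2 * B) (k - B) := by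
      rw [hy.ceil_eq, c2]
      refine gNeg_eq hx ?_ ?_ _
      · have := hy.1
        have : (1 : ℝ) ≤ B := by exact_mod_cast hB
        push_cast
        linarith
      · rw [Int.cast_natCast, ← add_sub_assoc]
        exact hasCeil_sub_two_mul hs B
    rw [if_neg h0, hgn, c1, c2, f1, f2, f3]
    split_ifs with h1 h2 h3
    · have : fuseExp A B N k % 2 = 0 := by
        unfold fuseExp
        omega
      simp [this]
    · have : fuseExp A 0 (N - 2 * B) (k - B) % 2 = fuseExp A B N k % 2 := by
        clear hgn c1 c2 f1 f2 f3 pow_sign pow_cases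
        unfold fuseExp
        omega
      rw [← this]
      exact pow_sign _
    -- The floor correction is `2 (A + B - N - 1)`. It vanishes for `N = A + B - 1` and is `-2` for
    -- `N = A + B`, which makes the value negative whatever the sign of the first term.
    · have key : (N + 1 = A + B ∧ fuseExp A 0 (N - 2 * B) (k - B) % 2 = fuseExp A B N k % 2) ∨
          (N = A + B ∧ fuseExp A B N k % 2 = 1) := by
        clear hgn c1 c2 f1 f2 f3 pow_sign pow_cases
        have : N + 1 = A + B ∨ N = A + B := by omega
        rcases this with h | h
        · left
          refine ⟨h, ?_⟩
          unfold fuseExp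
          omega
        · right
          refine ⟨h, ?_⟩
          unfold fuseExp
          omega
      rcases pow_cases (fuseExp A 0 (N - 2 * B) (k - B)) with ⟨p1, p2⟩ | ⟨p1, p2⟩ <;>
        rw [p2] <;> omega
    · have hk : A + B ≤ k := by omega
      have : ((k : ℤ) - A - B) = ((k - A - B : ℕ) : ℤ) := by omega
      rw [this, negOnePow_natCast]
      have h4 : (k - A - B) % 2 = fuseExp A B N k % 2 := by
        clear hgn c1 c2 f1 f2 f3 pow_sign pow_cases
        unfold fuseExp
        omega
      rw [← h4]
      exact pow_sign _

/-! ### Classification by types -/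

theorem defT_iff_one_pos {e A N m k : ℕ} (hA : 1 ≤ A) (hk : 2 ≤ k)
    (hc : Consistent (A :: List.replicate k 0) N) :
    DefT e (A :: List.replicate k 0) N m ↔ 2 * m ≤ N + 1 ∧ e % 2 = m % 2 := by
  obtain ⟨j, rfl⟩ : ∃ j, k = j + 2 := ⟨k - 2, by omega⟩
  have hN : N ≤ A := by simpa using (hc.bounds (by simp)).1
  have hsuff : 2 * m ≤ N + 1 → DefT m (A :: List.replicate (j + 2) 0) N m := fun h => by
    refine (defT_one_pos (k := j + 1) hN (Or.inr h)).perm (List.perm_iff_count.2 fun x => ?_)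
    simp only [List.count_cons, List.count_append, List.replicate_succ, List.count_nil]
    omega
  constructor
  · intro h
    rcases Nat.eq_zero_or_pos m with rfl | hm
    · exact ⟨by omega, h.mod_eq (by simp) (hsuff (by omega))⟩
    · have h1 : DefT e (A :: ([] ++ 0 :: 0 :: List.replicate j 0)) N m := h
      have := h1.to_two_neg fun z hz => List.eq_of_mem_replicate hz
      exact DefT.two_neg (by simpa using hA) hm this
  · rintro ⟨h1, h2⟩
    exact (hsuff h1).congr_mod h2.symm

/-- For `m ≥ 1`, merging to one negative weight gives `N < m` or `N = m = 2`, while merging to two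
gives `2m ≤ N + 1`. These contradict each other. -/
theorem defT_iff_many_neg {e N m k : ℕ} {ps : List ℕ} (hp : 2 ≤ ps.length) (h1 : ∀ c ∈ ps, 1 ≤ c)
    (hk : 2 ≤ k) (hc : Consistent (ps ++ List.replicate k 0) N) :
    DefT e (ps ++ List.replicate k 0) N m ↔ m = 0 ∧ e % 2 = 0 := by
  obtain ⟨j, rfl⟩ : ∃ j, k = j + 2 := ⟨k - 2, by omega⟩
  constructor
  · intro h
    obtain ⟨A, ps, rfl⟩ : ∃ A ps', ps = A :: ps' := by
      cases ps with
      | nil => simp at hp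
      | cons A ps => exact ⟨A, ps, rfl⟩
    obtain ⟨qs, B, rfl⟩ : ∃ qs B, ps = qs ++ [B] := by
      rcases List.eq_nil_or_concat' ps with rfl | ⟨qs, B, rfl⟩
      · simp at hp
      · exact ⟨qs, B, rfl⟩
    have hm : m = 0 := by
      by_contra hm
      have hA : 1 ≤ A := h1 A (by simp)
      have hB : 1 ≤ B := h1 B (by simp)
      have e1 : DefT e (A :: (qs ++ B :: 0 :: List.replicate (j + 1) 0)) N m := by
        simpa [List.replicate_succ] using h
      have e2 : DefT e (A :: ((qs ++ [B]) ++ 0 :: 0 :: List.replicate j 0)) N m := by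
        simpa [List.replicate_succ] using h
      have k1 := DefT.one_neg (by omega) hB (by omega)
        (e1.to_one_neg fun z hz => List.eq_of_mem_replicate hz)
      have k2 := DefT.two_neg (by omega) (by omega)
        (e2.to_two_neg fun z hz => List.eq_of_mem_replicate hz)
      omega
    subst hm
    exact ⟨rfl, h.mod_eq (by simp; omega) hc.defT_zero⟩
  · rintro ⟨rfl, h⟩
    exact hc.defT_zero.congr_mod h.symm

/-- All positive weights but the smallest are merged. The exceptional case requires their ceilings
to add up to `1`, so there is only one of them. -/
theorem defT_iff_one_neg {e A B N m : ℕ} {qs : List ℕ} (hA : 1 ≤ A) (hB : 1 ≤ B)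
    (hq : ∀ c ∈ A :: qs, B ≤ c) (hc : Consistent (A :: (qs ++ [B, 0])) N) :
    DefT e (A :: (qs ++ [B, 0])) N m ↔
      ((m = 0 ∨ (N + 1 ≤ m ∧ m ≤ B)) ∧ e % 2 = 0) ∨
        (qs = [] ∧ A = 1 ∧ B = 1 ∧ N = 2 ∧ m = 2 ∧ e % 2 = 1) := by
  constructor
  · intro h
    rcases Nat.eq_zero_or_pos m with rfl | hm
    · exact Or.inl ⟨Or.inl rfl, h.mod_eq (by simp) hc.defT_zero⟩
    · have k := DefT.one_neg (by omega) hB hm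
        (DefT.to_one_neg (zs := []) h (by simp))
      rcases k with k | ⟨k1, k2⟩
      · left
        exact ⟨Or.inr ⟨by omega, by omega⟩, by omega⟩
      · right
        have hs : qs = [] := by
          cases qs with
          | nil => rfl
          | cons x qs =>
            have := hq x (by simp)
            simp only [List.sum_cons] at k1
            omega
        subst hs
        simp only [List.sum_nil, add_zero] at k1
        exact ⟨rfl, k1, k2⟩
  · rintro (⟨h | ⟨h1, h2⟩, h3⟩ | ⟨rfl, rfl, rfl, rfl, rfl, h⟩)
    · subst h
      exact hc.defT_zero.congr_mod h3.symm
    · have h4 := defT_one_neg (ps := A :: qs) (Z := B) (N := N) (m := m) (by omega) (Or.inr h1) h2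
        (fun c hc => h2.trans (hq c hc))
      refine (h4.perm (List.perm_iff_count.2 fun x => ?_)).congr_mod h3.symm
      simp only [List.count_cons, List.count_append, List.count_nil]
      omega
    · exact defT_one_one_zero.congr_mod (by omega)

/-- Floors are ceilings minus one, and the parameter `d` of each family is `A - 1`. The families
with at least four weights are excluded by length. -/
theorem exceptionalPos_triple {A B C N m : ℕ} (hC : 1 ≤ C) :
    ExceptionalPos [(N : ℤ) - 1, (A : ℤ) - 1, (B : ℤ) - 1, (C : ℤ) - 1] m ↔
      ExcTriple A B C N m 0 := by
  have hl : ∀ (x : ℤ) (p : ℕ) (l : List ℤ), 4 ≤ p → l.length = p →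
      [(N : ℤ) - 1, (A : ℤ) - 1, (B : ℤ) - 1, (C : ℤ) - 1] ≠ x :: l := by
    intro x p l hp hl h
    have := congrArg List.length h
    simp only [List.length_cons, List.length_nil] at this
    omega
  unfold ExceptionalPos ExcTriple
  constructor
  · rintro (⟨d, h0, h1, h2⟩ | ⟨d, h0, h1, h2⟩ | ⟨d, h0, h1, h2⟩ | ⟨h1, -⟩ | ⟨p, hp, h1, -⟩ |
      ⟨p, hp, h1, -⟩)
    · simp only [List.cons.injEq, and_true] at h1
      left
      omega
    · simp only [List.cons.injEq, and_true] at h1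
      right; left
      omega
    · simp only [List.cons.injEq, and_true] at h1
      right; right
      omega
    · simp at h1
    · exact (hl _ p _ hp (by simp) h1).elim
    · exact (hl _ p _ hp (by simp; omega) h1).elim
  · rintro (⟨h1, h2, h3⟩ | ⟨h1, h2, h3⟩ | ⟨h1, h2, h3⟩)
    · exact Or.inl ⟨(A : ℤ) - 1, by omega, by simp only [List.cons.injEq, and_true, true_and]; omega, by omega⟩
    · exact Or.inr (Or.inl ⟨(A : ℤ) - 1, by omega, by simp only [List.cons.injEq, and_true, true_and]; omega,
        by omega⟩)
    · exact Or.inr (Or.inr (Or.inl ⟨(A : ℤ) - 1, by omega,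
        by simp only [List.cons.injEq, and_true, true_and]; omega, by omega⟩))

theorem exceptionalNeg_triple {A B C N m : ℕ} (hC : 1 ≤ C) :
    ExceptionalNeg [(N : ℤ) - 1, (A : ℤ) - 1, (B : ℤ) - 1, (C : ℤ) - 1] m ↔
      ExcTriple A B C N m 1 := by
  unfold ExceptionalNeg ExcTriple
  constructor
  · rintro (⟨d, h0, h1, h2⟩ | ⟨d, h0, h1, h2⟩ | ⟨d, h0, h1, h2⟩ | ⟨h1, -⟩)
    · simp only [List.cons.injEq, and_true] at h1
      left
      omega
    · simp only [List.cons.injEq, and_true] at h1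
      right; left
      omega
    · simp only [List.cons.injEq, and_true] at h1
      right; right
      omega
    · simp at h1
  · rintro (⟨h1, h2, h3⟩ | ⟨h1, h2, h3⟩ | ⟨h1, h2, h3⟩)
    · exact Or.inl ⟨(A : ℤ) - 1, by omega, by simp only [List.cons.injEq, and_true, true_and]; omega, by omega⟩
    · exact Or.inr (Or.inl ⟨(A : ℤ) - 1, by omega, by simp only [List.cons.injEq, and_true, true_and]; omega,
        by omega⟩)
    · exact Or.inr (Or.inr (Or.inl ⟨(A : ℤ) - 1, by omega,
        by simp only [List.cons.injEq, and_true, true_and]; omega, by omega⟩))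

theorem map_eq_replicate_zero {rest : List ℕ} (k : ℕ) :
    rest.map (fun c : ℕ => (c : ℤ) - 1) = List.replicate k 0 ↔
      rest.length = k ∧ ∀ c ∈ rest, c = 1 := by
  rw [List.eq_replicate_iff, List.length_map]
  refine and_congr_right fun _ => ?_
  simp only [List.mem_map, forall_exists_index, and_imp, forall_apply_eq_imp_iff₂]
  refine forall₂_congr fun c _ => ?_
  omega

theorem exceptionalPos_long {A B C D N m : ℕ} {rest : List ℕ} :
    ExceptionalPos (((N : ℤ) - 1) :: (A :: B :: C :: D :: rest).map fun c : ℕ => (c : ℤ) - 1) m ↔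
      ExcLong A B C D rest N m 0 := by
  unfold ExceptionalPos ExcLong
  simp only [List.map_cons]
  constructor
  · rintro (⟨d, h0, h1, h2⟩ | ⟨d, h0, h1, h2⟩ | ⟨d, h0, h1, h2⟩ | ⟨h1, h2⟩ | ⟨p, hp, h1, h2⟩ |
      ⟨p, hp, h1, h2⟩)
    · simp at h1
    · simp at h1
    · simp at h1
    · simp only [List.cons.injEq, List.map_eq_nil_iff] at h1
      right; left
      obtain ⟨a1, a2, a3, a4, a5, a6⟩ := h1
      exact ⟨a6, by omega, by omega, by omega, by omega, by omega, h2, trivial⟩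
    · obtain ⟨p, rfl⟩ : ∃ j, p = j + 4 := ⟨p - 4, by omega⟩
      simp only [List.replicate_succ, List.cons.injEq, map_eq_replicate_zero] at h1
      right; right; left
      obtain ⟨a1, a2, a3, a4, a5, a6, a7⟩ := h1
      exact ⟨a7, by omega, by omega, by omega, by omega, by omega, h2, trivial⟩
    · obtain ⟨p, rfl⟩ : ∃ j, p = j + 4 := ⟨p - 4, by omega⟩
      rw [show p + 4 - 1 = p + 3 by omega] at h1
      simp only [List.replicate_succ, List.cons.injEq, map_eq_replicate_zero] at h1
      right; right; right
      obtain ⟨a1, a2, a3, a4, a5, a6, a7⟩ := h1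
      exact ⟨a7, by omega, by omega, by omega, by omega, by omega, h2, trivial⟩
  · rintro (⟨rfl, h⟩ | ⟨rfl, rfl, rfl, rfl, rfl, rfl, rfl, -⟩ | ⟨hr, rfl, rfl, rfl, rfl, rfl, rfl, -⟩ |
      ⟨hr, rfl, rfl, rfl, rfl, rfl, rfl, -⟩)
    · omega
    · right; right; right; left
      norm_num
    · right; right; right; right; left
      refine ⟨rest.length + 4, by omega, ?_, rfl⟩
      simp only [List.replicate_succ, List.cons.injEq, map_eq_replicate_zero]
      simpa using hr
    · right; right; right; right; right
      refine ⟨rest.length + 4, by omega, ?_, rfl⟩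
      rw [show rest.length + 4 - 1 = rest.length + 3 by omega]
      simp only [List.replicate_succ, List.cons.injEq, map_eq_replicate_zero]
      simpa using hr

theorem exceptionalNeg_long {A B C D N m : ℕ} {rest : List ℕ} :
    ExceptionalNeg (((N : ℤ) - 1) :: (A :: B :: C :: D :: rest).map fun c : ℕ => (c : ℤ) - 1) m ↔
      ExcLong A B C D rest N m 1 := by
  unfold ExceptionalNeg ExcLong
  simp only [List.map_cons]
  constructor
  · rintro (⟨d, h0, h1, h2⟩ | ⟨d, h0, h1, h2⟩ | ⟨d, h0, h1, h2⟩ | ⟨h1, h2⟩)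
    · simp at h1
    · simp at h1
    · simp at h1
    · simp only [List.cons.injEq, List.map_eq_nil_iff] at h1
      left
      obtain ⟨a1, a2, a3, a4, a5, a6⟩ := h1
      exact ⟨a6, by omega, by omega, by omega, by omega, by omega, h2, trivial⟩
  · rintro (⟨rfl, rfl, rfl, rfl, rfl, rfl, rfl, -⟩ | ⟨-, h⟩ | ⟨-, h⟩ | ⟨-, h⟩)
    · right; right; right
      norm_num
    · omega
    · omega
    · omega

/-! ### Highest weights of a given type -/

/-- The ceilings of the highest weights, negative ones being replaced by `0`. -/
def ceilType {n : ℕ} (lam : Fin n → ℝ) : List ℕ := List.ofFn fun i => ⌈lam i⌉₊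

theorem IsGeneric.notNat {n : ℕ} {lam : Fin n → ℝ} (h : IsGeneric lam) (i : Fin n) :
    NotNat (lam i) := h.1 i

theorem IsGeneric.notNat_sum {n : ℕ} {lam : Fin n → ℝ} (h : IsGeneric lam) :
    NotNat (∑ i, lam i) := h.2

theorem IsGeneric.hasType {n : ℕ} {lam : Fin n → ℝ} (h : IsGeneric lam) :
    HasType (List.ofFn lam) (ceilType lam) ⌈∑ i, lam i⌉₊ := by
  refine ⟨?_, ?_⟩
  · rw [List.forall₂_iff_get]
    refine ⟨by simp [ceilType], fun i h1 h2 => ?_⟩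
    simp only [ceilType, List.get_ofFn]
    exact (h.notNat _).hasCeil
  · rw [List.sum_ofFn]
    exact h.notNat_sum.hasCeil

theorem IsGeneric.posDefAt_iff {n : ℕ} {lam : Fin n → ℝ} (h : IsGeneric lam) (m : ℕ) :
    PosDefAt lam m ↔ DefT 0 (ceilType lam) ⌈∑ i, lam i⌉₊ m := by
  rw [h.hasType.defT_iff, defL_ofFn, SL2.posDefAt_iff h.1]

theorem IsGeneric.negDefAt_iff {n : ℕ} {lam : Fin n → ℝ} (h : IsGeneric lam) (m : ℕ) :
    NegDefAt lam m ↔ DefT 1 (ceilType lam) ⌈∑ i, lam i⌉₊ m := by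
  rw [h.hasType.defT_iff, defL_ofFn, SL2.negDefAt_iff h.1]

theorem length_ceilType {n : ℕ} (lam : Fin n → ℝ) : (ceilType lam).length = n := by
  simp [ceilType]

theorem NotNat.natCeil_eq {x : ℝ} (h : NotNat x) : ⌈x⌉₊ = (⌊x⌋ + 1).toNat := by
  have hc := h.hasCeil
  rcases Nat.eq_zero_or_pos ⌈x⌉₊ with h0 | h0
  · have hx : x < 0 := hc.eq_zero_iff.1 h0
    have : ⌊x⌋ < 0 := Int.floor_lt.2 (by simpa using hx)
    omega
  · rw [hc.int_floor h0]
    simp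

theorem IsGeneric.type_congr {n : ℕ} {lam lam' : Fin n → ℝ} (h : IsGeneric lam)
    (h' : IsGeneric lam') (ht : explicitType lam' = explicitType lam) :
    ceilType lam' = ceilType lam ∧ ⌈∑ i, lam' i⌉₊ = ⌈∑ i, lam i⌉₊ := by
  unfold explicitType at ht
  rw [List.cons.injEq, List.ofFn_inj] at ht
  refine ⟨?_, ?_⟩
  · unfold ceilType
    congr 1
    funext i
    rw [(h.notNat i).natCeil_eq, (h'.notNat i).natCeil_eq, congrFun ht.2 i]
  · rw [h.notNat_sum.natCeil_eq, h'.notNat_sum.natCeil_eq, ht.1]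

theorem pairwise_ceilType {n : ℕ} {lam : Fin n → ℝ} (h : Antitone lam) :
    (ceilType lam).Pairwise (· ≥ ·) := by
  rw [ceilType, List.pairwise_ofFn]
  exact fun i j hij => Nat.ceil_mono (h hij.le)

/-- The ceilings of the positive and of the negative highest weights. -/
theorem ceilType_eq_append {n p : ℕ} {lam : Fin n → ℝ}
    (hp : ∀ i : Fin n, 0 < lam i ↔ (i : ℕ) < p) :
    ceilType lam = (ceilType lam).take p ++ List.replicate (n - p) 0 ∧
      ∀ c ∈ (ceilType lam).take p, 1 ≤ c := by
  refine ⟨?_, fun c hc => ?_⟩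
  · conv_lhs => rw [← List.take_append_drop p (ceilType lam)]
    congr 1
    rw [List.eq_replicate_iff]
    refine ⟨by simp [length_ceilType], fun c hc => ?_⟩
    rw [List.mem_drop_iff_getElem] at hc
    obtain ⟨j, hj, rfl⟩ := hc
    simp only [ceilType, List.getElem_ofFn, Nat.ceil_eq_zero]
    rw [← not_lt, hp]
    simp
  · rw [List.mem_take_iff_getElem] at hc
    obtain ⟨j, hj, rfl⟩ := hc
    simp only [ceilType, List.getElem_ofFn, Nat.one_le_ceil_iff]
    rw [hp]
    exact (lt_min_iff.1 hj).1

theorem take_ceilType_succ {n : ℕ} (lam : Fin n → ℝ) (q : Fin n) :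
    (ceilType lam).take (q + 1) = (ceilType lam).take q ++ [⌈lam q⌉₊] := by
  rw [List.take_succ_eq_append_getElem (by simp [length_ceilType])]
  simp [ceilType]

theorem explicitType_of_pos {n : ℕ} {lam : Fin n → ℝ} (h : IsGeneric lam) (hn : n ≠ 0)
    (hp : ∀ i, 0 < lam i) : explicitType lam =
      ((⌈∑ i, lam i⌉₊ : ℤ) - 1) :: (ceilType lam).map fun c : ℕ => (c : ℤ) - 1 := by
  have key : ∀ x : ℝ, NotNat x → 0 < x → ⌊x⌋ = (⌈x⌉₊ : ℤ) - 1 := fun x hx h0 =>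
    hx.hasCeil.int_floor (hx.hasCeil.zero_lt_iff.2 h0)
  have : Nonempty (Fin n) := ⟨⟨0, Nat.pos_of_ne_zero hn⟩⟩
  unfold explicitType ceilType
  rw [List.map_ofFn, key _ h.notNat_sum (Finset.sum_pos (fun i _ => hp i) Finset.univ_nonempty)]
  congr 2
  funext i
  exact key _ (h.notNat i) (hp i)

theorem exceptional_iff {cs : List ℕ} {N m : ℕ} (hs : cs.Pairwise (· ≥ ·)) (h1 : ∀ c ∈ cs, 1 ≤ c)
    (hl : 3 ≤ cs.length) :
    ((∃ c ∈ cs, c < m) → (DefT 0 cs N m →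
        ExceptionalPos (((N : ℤ) - 1) :: cs.map fun c : ℕ => (c : ℤ) - 1) m) ∧
      (DefT 1 cs N m →
        ExceptionalNeg (((N : ℤ) - 1) :: cs.map fun c : ℕ => (c : ℤ) - 1) m)) ∧
    (ExceptionalPos (((N : ℤ) - 1) :: cs.map fun c : ℕ => (c : ℤ) - 1) m → DefT 0 cs N m) ∧
    (ExceptionalNeg (((N : ℤ) - 1) :: cs.map fun c : ℕ => (c : ℤ) - 1) m → DefT 1 cs N m) := by
  match cs, hl with
  | [A, B, C], _ =>
    have hC : 1 ≤ C := h1 C (by simp)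
    simp only [List.pairwise_cons, List.mem_cons, List.not_mem_nil, or_false, forall_eq_or_imp,
      forall_eq] at hs
    simp only [List.map_cons, List.map_nil, exceptionalPos_triple hC, exceptionalNeg_triple hC]
    refine ⟨fun hm => ?_, fun h => h.defT hC, fun h => h.defT hC⟩
    have hCm : C < m := by
      simp only [List.mem_cons, List.not_mem_nil, or_false, exists_eq_or_imp,
        exists_eq_left] at hm
      omega
    exact ⟨DefT.excTriple (by omega) (by omega) hC hCm, DefT.excTriple (by omega) (by omega) hC hCm⟩
  | A :: B :: C :: D :: rest, _ =>
    simp only [exceptionalPos_long, exceptionalNeg_long]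
    rw [List.pairwise_cons, List.pairwise_cons, List.pairwise_cons] at hs
    obtain ⟨hA, hB, hC, hD⟩ := hs
    refine ⟨fun hm => ?_, fun h => h.defT, fun h => h.defT⟩
    have hDm : ∃ c ∈ D :: rest, c < m := by
      obtain ⟨c, hc, hcm⟩ := hm
      have e1 := hA D (by simp)
      have e2 := hB D (by simp)
      have e3 := hC D (by simp)
      simp only [List.mem_cons] at hc
      rcases hc with rfl | rfl | rfl | hc
      · exact ⟨D, by simp, by omega⟩
      · exact ⟨D, by simp, by omega⟩
      · exact ⟨D, by simp, by omega⟩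
      · exact ⟨c, by simpa using hc, hcm⟩
    have h1' : ∀ c ∈ D :: rest, 1 ≤ c := fun c hc => h1 c (by
      simp only [List.mem_cons] at hc ⊢; tauto)
    exact ⟨DefT.excLong (hA B (by simp)) (hB C (by simp)) (hC D (by simp)) hD h1' hDm,
      DefT.excLong (hA B (by simp)) (hB C (by simp)) (hC D (by simp)) hD h1' hDm⟩

/-! ### The classification -/

section Classification

variable {n : ℕ} {lam : Fin n → ℝ}

/-- The space is nonzero, so one admissible exponent settles both signs. -/
theorem IsGeneric.definite_of_defT {m f : ℕ} (h : IsGeneric lam) (hn : 2 ≤ n)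
    (hd : DefT f (ceilType lam) ⌈∑ i, lam i⌉₊ m) :
    DefiniteAt lam m ∧ (PosDefAt lam m ↔ f % 2 = 0) ∧ (NegDefAt lam m ↔ f % 2 = 1) := by
  have hlen : 2 ≤ (ceilType lam).length := by rwa [length_ceilType]
  have h0 : PosDefAt lam m ↔ f % 2 = 0 := by
    rw [h.posDefAt_iff]
    exact ⟨fun hp => hd.mod_eq hlen hp, fun hf => hd.congr_mod hf⟩
  have h1 : NegDefAt lam m ↔ f % 2 = 1 := by
    rw [h.negDefAt_iff]
    exact ⟨fun hp => hd.mod_eq hlen hp, fun hf => hd.congr_mod hf⟩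
  refine ⟨?_, h0, h1⟩
  rw [DefiniteAt, h0, h1]
  omega

theorem IsGeneric.consistent (h : IsGeneric lam) :
    Consistent (ceilType lam) ⌈∑ i, lam i⌉₊ := ⟨_, h.hasType⟩

theorem IsGeneric.defT_iff_def {e m : ℕ} (h : IsGeneric lam) :
    DefT e (ceilType lam) ⌈∑ i, lam i⌉₊ m ↔ Def e lam m := by
  rw [h.hasType.defT_iff, defL_ofFn]

theorem definite_no_pos (h : IsGeneric lam) (hn : 2 ≤ n) (hp : ∀ i : Fin n, ¬ 0 < lam i) (m : ℕ) :
    DefiniteAt lam m ∧ (PosDefAt lam m ↔ Even m) ∧ (NegDefAt lam m ↔ Odd m) := by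
  have hneg : ∀ i, lam i < 0 := fun i =>
    lt_of_le_of_ne (not_lt.1 (hp i)) (by simpa using h.1 i 0)
  rw [Nat.even_iff, Nat.odd_iff]
  exact h.definite_of_defT hn (h.defT_iff_def.2 (def_neg hneg m))

theorem definite_two_factors {lam : Fin 2 → ℝ} (h : IsGeneric lam) (hanti : Antitone lam) (m : ℕ) :
    DefiniteAt lam m ∧ (PosDefAt lam m ↔ 0 < g (lam 0) (lam 1) m) ∧
      (NegDefAt lam m ↔ g (lam 0) (lam 1) m < 0) := by
  have hs : NotNat (lam 0 + lam 1) := by simpa using h.notNat_sum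
  have hd : DefT (fuseExp ⌈lam 0⌉₊ ⌈lam 1⌉₊ ⌈lam 0 + lam 1⌉₊ m) (ceilType lam)
      ⌈∑ i, lam i⌉₊ m := by
    rw [h.hasType.defT_iff]
    simp only [List.ofFn_succ, List.ofFn_zero]
    refine (defL_pair _ m (h.notNat 0) (h.notNat 1) hs).2 ?_
    omega
  obtain ⟨g1, g2⟩ := g_sign (h.notNat 0).hasCeil (h.notNat 1).hasCeil hs.hasCeil
    (Nat.ceil_mono (hanti (Fin.zero_le 1))) m
  rw [g1, g2]
  exact h.definite_of_defT le_rfl hd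

theorem max_ceil_half {s : ℝ} (hs : NotNat s) :
    max 0 ⌈s / 2⌉ = (((⌈s⌉₊ + 1) / 2 : ℕ) : ℤ) := by
  have hc := hs.hasCeil
  rcases Nat.eq_zero_or_pos ⌈s⌉₊ with h0 | h0
  · have hneg : s < 0 := hc.eq_zero_iff.1 h0
    have : ⌈s / 2⌉ ≤ 0 := Int.ceil_le.2 (by push_cast; linarith)
    rw [max_eq_left this, h0]
    rfl
  · rw [(half_bounds hc h0).2.1]
    exact max_eq_right (Int.natCast_nonneg _)

theorem definite_one_pos (h : IsGeneric lam) (hp : ∀ i : Fin n, 0 < lam i ↔ (i : ℕ) < 1)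
    (hn : 3 ≤ n) :
    ({m : ℕ | DefiniteAt lam m}.ncard : ℤ) = max 1 ⌈((∑ i, lam i) + 2) / 2⌉ ∧
      ∀ m : ℕ,
        (PosDefAt lam m ↔ (m : ℤ) ≤ max 0 ⌈(∑ i, lam i) / 2⌉ ∧ Even m) ∧
        (NegDefAt lam m ↔ (m : ℤ) ≤ max 0 ⌈(∑ i, lam i) / 2⌉ ∧ Odd m) := by
  have hmax := max_ceil_half h.notNat_sum
  have key : ∀ e m, DefT e (ceilType lam) ⌈∑ i, lam i⌉₊ m ↔
      2 * m ≤ ⌈∑ i, lam i⌉₊ + 1 ∧ e % 2 = m % 2 := by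
    intro e m
    obtain ⟨h1, h2⟩ := ceilType_eq_append hp
    rw [show (1 : ℕ) = ((⟨0, by omega⟩ : Fin n) : ℕ) + 1 from rfl, take_ceilType_succ] at h1 h2
    simp only [List.take_zero, List.nil_append, List.mem_singleton, forall_eq,
      List.singleton_append] at h1 h2
    have hc := h.consistent
    rw [h1] at hc ⊢
    exact defT_iff_one_pos h2 (by omega) hc
  have hpos : ∀ m, PosDefAt lam m ↔ (m : ℤ) ≤ max 0 ⌈(∑ i, lam i) / 2⌉ ∧ Even m := by
    intro m
    rw [h.posDefAt_iff, key, hmax, Nat.even_iff]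
    omega
  have hneg : ∀ m, NegDefAt lam m ↔ (m : ℤ) ≤ max 0 ⌈(∑ i, lam i) / 2⌉ ∧ Odd m := by
    intro m
    rw [h.negDefAt_iff, key, hmax, Nat.odd_iff]
    omega
  refine ⟨?_, fun m => ⟨hpos m, hneg m⟩⟩
  have hset : {m : ℕ | DefiniteAt lam m} =
      ↑(Finset.range ((⌈∑ i, lam i⌉₊ + 1) / 2 + 1)) := by
    ext m
    simp only [Set.mem_ofPred_eq, DefiniteAt, hpos, hneg, hmax, Finset.coe_range, Set.mem_Iio,
      Nat.even_iff, Nat.odd_iff]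
    omega
  have h2 : ((∑ i, lam i) + 2) / 2 = (∑ i, lam i) / 2 + 1 := by ring
  rw [hset, Set.ncard_coe_finset, Finset.card_range, h2, Int.ceil_add_one]
  push_cast
  push_cast at hmax
  omega

theorem definite_many_neg (h : IsGeneric lam) {p : ℕ}
    (hp : ∀ i : Fin n, 0 < lam i ↔ (i : ℕ) < p) (hp2 : 2 ≤ p) (hpn : p + 2 ≤ n) (m : ℕ) :
    (PosDefAt lam m ↔ m = 0) ∧ ¬ NegDefAt lam m := by
  have key : ∀ e, DefT e (ceilType lam) ⌈∑ i, lam i⌉₊ m ↔ m = 0 ∧ e % 2 = 0 := by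
    intro e
    obtain ⟨h1, h2⟩ := ceilType_eq_append hp
    have hlen : 2 ≤ ((ceilType lam).take p).length := by
      rw [List.length_take, length_ceilType]
      omega
    have hc := h.consistent
    rw [h1] at hc ⊢
    exact defT_iff_many_neg hlen h2 (by omega) hc
  rw [h.posDefAt_iff, h.negDefAt_iff, key, key]
  omega

theorem explicitType_eq_one_neg_iff (h : IsGeneric lam)
    (hp : ∀ i : Fin n, 0 < lam i ↔ (i : ℕ) + 1 < n) (hs : 0 < ∑ i, lam i) :
    explicitType lam = [1, 0, 0, -1] ↔ ceilType lam = [1, 1, 0] ∧ ⌈∑ i, lam i⌉₊ = 2 := by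
  have hS := h.notNat_sum.hasCeil
  constructor
  · intro ht
    have hn : n = 3 := by
      have := congrArg List.length ht
      simpa [explicitType] using this
    subst hn
    simp only [explicitType, List.ofFn_succ, List.ofFn_zero, List.cons.injEq] at ht
    obtain ⟨t0, t1, t2, t3, -⟩ := ht
    simp only [ceilType, List.ofFn_succ, List.ofFn_zero]
    rw [(h.notNat _).natCeil_eq, (h.notNat _).natCeil_eq, (h.notNat _).natCeil_eq,
      h.notNat_sum.natCeil_eq, t0, t1, t2, t3]
    decide
  · rintro ⟨h1, h2⟩
    have hn : n = 3 := by
      have := congrArg List.length h1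
      simpa [ceilType] using this
    subst hn
    simp only [ceilType, List.ofFn_succ, List.ofFn_zero, List.cons.injEq, and_true] at h1
    obtain ⟨c0, c1, c2⟩ := h1
    have d0 := (h.notNat 0).hasCeil
    have d1 := (h.notNat 1).hasCeil
    have d2 := (h.notNat 2).hasCeil
    change ⌈lam 0⌉₊ = 1 at c0
    change ⌈lam 1⌉₊ = 1 at c1
    change ⌈lam 2⌉₊ = 0 at c2
    rw [c0] at d0
    rw [c1] at d1
    rw [c2] at d2
    rw [h2] at hS
    have e2 := d2.eq_zero_iff.1 rfl
    -- The ceiling type does not record the floor of a negative weight. Here the sum exceeds `1` and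
    -- the other two weights are below `1`, so this one exceeds `-1`.
    have e3 : ⌊lam 2⌋ = -1 := by
      rw [Int.floor_eq_iff]
      have a0 := d0.1
      have a1 := d1.1
      have a2 := hS.pos_part (by norm_num)
      rw [Fin.sum_univ_three] at a2
      push_cast at a0 a1 a2 ⊢
      constructor <;> linarith
    have f0 := d0.int_floor le_rfl
    have f1 := d1.int_floor le_rfl
    have f2 := hS.int_floor (by norm_num)
    simp only [explicitType, List.ofFn_succ, List.ofFn_zero]
    change [⌊∑ i, lam i⌋, ⌊lam 0⌋, ⌊lam 1⌋, ⌊lam 2⌋] = _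
    rw [e3, f0, f1, f2]
    norm_num

theorem defT_one_neg_iff (h : IsGeneric lam) (hanti : Antitone lam) (q : Fin n)
    (hq : (q : ℕ) + 2 = n) (hn : 3 ≤ n) (hp : ∀ i : Fin n, 0 < lam i ↔ (i : ℕ) + 1 < n) (e m : ℕ) :
    DefT e (ceilType lam) ⌈∑ i, lam i⌉₊ m ↔
      ((m = 0 ∨ (⌈∑ i, lam i⌉₊ + 1 ≤ m ∧ m ≤ ⌈lam q⌉₊)) ∧ e % 2 = 0) ∨
        (ceilType lam = [1, 1, 0] ∧ ⌈∑ i, lam i⌉₊ = 2 ∧ m = 2 ∧ e % 2 = 1) := by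
  obtain ⟨h1, h2⟩ := ceilType_eq_append (p := q + 1) (lam := lam) fun i => by rw [hp]; omega
  have hsort := (pairwise_ceilType hanti).sublist (List.take_sublist (q + 1) _)
  rw [show n - (q + 1) = 1 by omega, take_ceilType_succ] at h1
  rw [take_ceilType_succ] at h2 hsort
  have hlen : ((ceilType lam).take q).length = q := by
    rw [List.length_take, length_ceilType]
    omega
  generalize (ceilType lam).take q = ps at h1 h2 hsort hlen
  have hc := h.consistent
  rw [h1] at hc ⊢
  generalize ⌈lam q⌉₊ = B at *
  generalize ⌈∑ i, lam i⌉₊ = N at *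
  cases ps with
  | nil => simp at hlen; omega
  | cons A qs =>
    have hB : ∀ c ∈ A :: qs, B ≤ c := fun c hc =>
      (List.pairwise_append.1 hsort).2.2 c hc B (by simp)
    have heq : A :: qs ++ [B] ++ List.replicate 1 0 = A :: (qs ++ [B, 0]) := by simp
    rw [heq] at hc ⊢
    rw [defT_iff_one_neg (h2 A (by simp)) (h2 B (by simp)) hB hc]
    refine or_congr_right ?_
    cases qs with
    | nil => simp; tauto
    | cons x qs => cases qs <;> simp

theorem definite_one_neg (h : IsGeneric lam) (hanti : Antitone lam) (q : Fin n)
    (hq : (q : ℕ) + 2 = n) (hn : 3 ≤ n) (hp : ∀ i : Fin n, 0 < lam i ↔ (i : ℕ) + 1 < n) :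
    ((∑ i, lam i) < 0 →
      ({m : ℕ | DefiniteAt lam m}.ncard : ℤ) = ⌈lam q + 1⌉ ∧
      ∀ m : ℕ, (PosDefAt lam m ↔ (m : ℤ) ≤ ⌈lam q⌉) ∧ ¬ NegDefAt lam m) ∧
    (0 < (∑ i, lam i) → ⌈(∑ i, lam i) + 1⌉ ≤ ⌈lam q⌉ →
      ({m : ℕ | DefiniteAt lam m}.ncard : ℤ) = ⌈lam q⌉ - ⌊(∑ i, lam i)⌋ ∧
      ∀ m : ℕ,
        (PosDefAt lam m ↔ m = 0 ∨ (⌈(∑ i, lam i) + 1⌉ ≤ (m : ℤ) ∧ (m : ℤ) ≤ ⌈lam q⌉)) ∧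
        ¬ NegDefAt lam m) ∧
    (0 < (∑ i, lam i) → ⌈lam q⌉ < ⌈(∑ i, lam i) + 1⌉ → ∀ m : ℕ,
      (PosDefAt lam m ↔ m = 0) ∧
      (NegDefAt lam m ↔ explicitType lam = [1, 0, 0, -1] ∧ m = 2)) := by
  have key := defT_one_neg_iff h hanti q hq hn hp
  have hqc := (h.notNat q).hasCeil
  have hq1 : 1 ≤ ⌈lam q⌉₊ := hqc.zero_lt_iff.2 ((hp q).2 (by omega))
  have hqi := hqc.int_ceil hq1
  have hS := h.notNat_sum.hasCeil
  have hpos : ∀ m, PosDefAt lam m ↔ m = 0 ∨ (⌈∑ i, lam i⌉₊ + 1 ≤ m ∧ m ≤ ⌈lam q⌉₊) := by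
    intro m
    rw [h.posDefAt_iff, key]
    simp
  have hneg : ∀ m, NegDefAt lam m ↔ ceilType lam = [1, 1, 0] ∧ ⌈∑ i, lam i⌉₊ = 2 ∧ m = 2 := by
    intro m
    rw [h.negDefAt_iff, key]
    simp
  -- In the exceptional type the smallest positive ceiling is `1`, below `N + 1 = 3`. So the
  -- exception can occur only in the third case.
  have hno : ⌈∑ i, lam i⌉₊ = 2 → ceilType lam = [1, 1, 0] → ⌈lam q⌉₊ = 1 := by
    intro _ h1
    have hn3 : n = 3 := by
      have := congrArg List.length h1
      simpa [ceilType] using this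
    subst hn3
    obtain rfl : q = 1 := Fin.ext (by simpa using hq)
    simp only [ceilType, List.ofFn_succ, List.ofFn_zero, List.cons.injEq, and_true] at h1
    exact h1.2.1
  refine ⟨fun hs => ?_, fun hs hle => ?_, fun hs hlt m => ?_⟩
  · have hN := hS.eq_zero_iff.2 hs
    rw [hN] at hpos hneg
    have hneg' : ∀ m, ¬ NegDefAt lam m := fun m hm => by
      have := (hneg m).1 hm
      omega
    refine ⟨?_, fun m => ⟨?_, hneg' m⟩⟩
    · have hset : {m : ℕ | DefiniteAt lam m} = ↑(Finset.range (⌈lam q⌉₊ + 1)) := by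
        ext m
        simp only [Set.mem_ofPred_eq, DefiniteAt, hpos, hneg', or_false, Finset.coe_range,
          Set.mem_Iio]
        omega
      rw [hset, Set.ncard_coe_finset, Finset.card_range, Int.ceil_add_one, hqi]
      push_cast
      rfl
    · rw [hpos, hqi]
      omega
  · have hN := hS.zero_lt_iff.2 hs
    rw [Int.ceil_add_one, hS.int_ceil hN, hqi] at hle ⊢
    have hneg' : ∀ m, ¬ NegDefAt lam m := fun m hm => by
      obtain ⟨h1, h2, -⟩ := (hneg m).1 hm
      have := hno h2 h1
      omega
    refine ⟨?_, fun m => ⟨?_, hneg' m⟩⟩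
    · have hset : {m : ℕ | DefiniteAt lam m} =
          ↑(insert 0 (Finset.Icc (⌈∑ i, lam i⌉₊ + 1) ⌈lam q⌉₊)) := by
        ext m
        simp only [Set.mem_ofPred_eq, DefiniteAt, hpos, hneg', or_false, Finset.coe_insert,
          Finset.coe_Icc, Set.mem_insert_iff, Set.mem_Icc]
      rw [hset, Set.ncard_coe_finset, Finset.card_insert_of_notMem (by simp), Nat.card_Icc,
        hS.int_floor hN]
      omega
    · rw [hpos]
      omega
  · have hN := hS.zero_lt_iff.2 hs
    rw [Int.ceil_add_one, hS.int_ceil hN, hqi] at hlt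
    refine ⟨?_, ?_⟩
    · rw [hpos]
      omega
    · rw [hneg, explicitType_eq_one_neg_iff h hp hs, and_assoc]

/-- Up to the smallest ceiling all norms are positive, which also rules out negative definiteness.
Above it some ceiling is smaller than `m`, and only the exceptional types remain. -/
theorem definite_all_pos (h : IsGeneric lam) (hanti : Antitone lam) (q : Fin n)
    (hq : (q : ℕ) + 1 = n) (hn : 3 ≤ n) (hp : ∀ i : Fin n, 0 < lam i) (m : ℕ) :
    (PosDefAt lam m ↔ (m : ℤ) ≤ ⌈lam q⌉ ∨ ExceptionalPos (explicitType lam) m) ∧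
      (NegDefAt lam m ↔ ExceptionalNeg (explicitType lam) m) := by
  have hqi := (h.notNat q).hasCeil.int_ceil ((h.notNat q).hasCeil.zero_lt_iff.2 (hp q))
  have hlen : 3 ≤ (ceilType lam).length := by rwa [length_ceilType]
  have hge : ∀ c ∈ ceilType lam, 1 ≤ c := by
    intro c hc
    obtain ⟨i, rfl⟩ := (List.mem_ofFn' _ _).1 hc
    exact (h.notNat i).hasCeil.zero_lt_iff.2 (hp i)
  obtain ⟨h1, h2, h3⟩ := exceptional_iff (N := ⌈∑ i, lam i⌉₊) (m := m)
    (pairwise_ceilType hanti) hge hlen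
  rw [explicitType_of_pos h (by omega) hp, h.posDefAt_iff, h.negDefAt_iff, hqi, Nat.cast_le]
  by_cases hm : m ≤ ⌈lam q⌉₊
  · have hd : DefT 0 (ceilType lam) ⌈∑ i, lam i⌉₊ m :=
      h.defT_iff_def.2 (def_of_le_ceil h.1 fun i => hm.trans (Nat.ceil_mono (hanti (by
        rw [Fin.le_def]; omega))))
    refine ⟨⟨fun _ => Or.inl hm, fun _ => hd⟩, fun hd' => ?_, h3⟩
    have := hd.mod_eq (by omega) hd'
    omega
  · have hex : ∃ c ∈ ceilType lam, c < m :=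
      ⟨⌈lam q⌉₊, (List.mem_ofFn' _ _).2 ⟨q, rfl⟩, not_le.1 hm⟩
    exact ⟨⟨fun hd => Or.inr ((h1 hex).1 hd), fun hd => h2 (hd.resolve_left hm)⟩, (h1 hex).2, h3⟩

end Classification

end SL2

end

theorem theorem1p1 (n : ℕ) (hn : 2 ≤ n) (lam : Fin n → ℝ) (hgen : SL2.IsGeneric lam)
    (hanti : Antitone lam) (p : ℕ) (hpn : p ≤ n) (hp : ∀ i : Fin n, 0 < lam i ↔ (i : ℕ) < p) :
    -- the dimension of every multiplicity space
    (∀ m : ℕ, Module.finrank ℂ (SL2.multSpace lam m) = (m + n - 2).choose (n - 2)) ∧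
    -- the answer depends only on the floors of `λ` and of the `λ_i`
    (∀ lam' : Fin n → ℝ, SL2.IsGeneric lam' → Antitone lam' →
      SL2.explicitType lam' = SL2.explicitType lam → ∀ m : ℕ,
        (SL2.PosDefAt lam' m ↔ SL2.PosDefAt lam m) ∧
        (SL2.NegDefAt lam' m ↔ SL2.NegDefAt lam m)) ∧
    -- no positive highest weight
    (p = 0 → ∀ m : ℕ, SL2.DefiniteAt lam m ∧
      (SL2.PosDefAt lam m ↔ Even m) ∧ (SL2.NegDefAt lam m ↔ Odd m)) ∧
    -- two factors
    (∀ i₁ i₂ : Fin n, n = 2 → (i₁ : ℕ) = 0 → (i₂ : ℕ) = 1 → ∀ m : ℕ, SL2.DefiniteAt lam m ∧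
      (SL2.PosDefAt lam m ↔ 0 < SL2.g (lam i₁) (lam i₂) m) ∧
      (SL2.NegDefAt lam m ↔ SL2.g (lam i₁) (lam i₂) m < 0)) ∧
    -- one positive highest weight, at least three factors
    (p = 1 → 3 ≤ n →
      ({m : ℕ | SL2.DefiniteAt lam m}.ncard : ℤ) = max 1 ⌈((∑ i, lam i) + 2) / 2⌉ ∧
      ∀ m : ℕ,
        (SL2.PosDefAt lam m ↔ (m : ℤ) ≤ max 0 ⌈(∑ i, lam i) / 2⌉ ∧ Even m) ∧
        (SL2.NegDefAt lam m ↔ (m : ℤ) ≤ max 0 ⌈(∑ i, lam i) / 2⌉ ∧ Odd m)) ∧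
    -- at least two positive and at least two negative highest weights
    (2 ≤ p → p + 2 ≤ n → 4 ≤ n → ∀ m : ℕ,
      (SL2.PosDefAt lam m ↔ m = 0) ∧ ¬ SL2.NegDefAt lam m) ∧
    -- exactly one negative highest weight; `q` is the index of the smallest positive highest weight `λ_p`
    (∀ q : Fin n, (q : ℕ) + 1 = p → p + 1 = n → 3 ≤ n →
      ((∑ i, lam i) < 0 →
        ({m : ℕ | SL2.DefiniteAt lam m}.ncard : ℤ) = ⌈lam q + 1⌉ ∧
        ∀ m : ℕ, (SL2.PosDefAt lam m ↔ (m : ℤ) ≤ ⌈lam q⌉) ∧ ¬ SL2.NegDefAt lam m) ∧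
      (0 < (∑ i, lam i) → ⌈(∑ i, lam i) + 1⌉ ≤ ⌈lam q⌉ →
        ({m : ℕ | SL2.DefiniteAt lam m}.ncard : ℤ) = ⌈lam q⌉ - ⌊(∑ i, lam i)⌋ ∧
        ∀ m : ℕ,
          (SL2.PosDefAt lam m ↔ m = 0 ∨ (⌈(∑ i, lam i) + 1⌉ ≤ (m : ℤ) ∧ (m : ℤ) ≤ ⌈lam q⌉)) ∧
          ¬ SL2.NegDefAt lam m) ∧
      (0 < (∑ i, lam i) → ⌈lam q⌉ < ⌈(∑ i, lam i) + 1⌉ → ∀ m : ℕ,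
        (SL2.PosDefAt lam m ↔ m = 0) ∧
        (SL2.NegDefAt lam m ↔ SL2.explicitType lam = [1, 0, 0, -1] ∧ m = 2))) ∧
    -- all highest weights positive; `q` is the index of the smallest highest weight `λ_p`
    (∀ q : Fin n, (q : ℕ) + 1 = p → p = n → 3 ≤ n → ∀ m : ℕ,
      (SL2.PosDefAt lam m ↔
        (m : ℤ) ≤ ⌈lam q⌉ ∨ SL2.ExceptionalPos (SL2.explicitType lam) m) ∧
      (SL2.NegDefAt lam m ↔ SL2.ExceptionalNeg (SL2.explicitType lam) m)) := by
  have hfin := fun m => SL2.finrank_multSpace hgen.1 hn m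
  refine ⟨hfin, fun lam' hgen' _ ht m => ?_, fun h0 m => ?_, fun i₁ i₂ h2 hi₁ hi₂ m => ?_,
    fun h1 h3 => ?_, fun h2 hp2 _ m => ?_, fun q hq hpn' h3 => ?_, fun q hq hpn' h3 m => ?_⟩
  · obtain ⟨t1, t2⟩ := hgen.type_congr hgen' ht
    rw [hgen'.posDefAt_iff, hgen'.negDefAt_iff, hgen.posDefAt_iff, hgen.negDefAt_iff, t1, t2]
    exact ⟨Iff.rfl, Iff.rfl⟩
  · exact SL2.definite_no_pos hgen hn (fun i => by rw [hp]; omega) m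
  · subst h2
    obtain rfl : i₁ = 0 := Fin.ext hi₁
    obtain rfl : i₂ = 1 := Fin.ext hi₂
    exact SL2.definite_two_factors hgen hanti m
  · subst h1
    exact SL2.definite_one_pos hgen hp h3
  · exact SL2.definite_many_neg hgen hp h2 hp2 m
  · exact SL2.definite_one_neg hgen hanti q (by omega) h3 fun i => by rw [hp]; omega
  · exact SL2.definite_all_pos hgen hanti q (by omega) h3 (fun i => by rw [hp]; omega) m
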